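/- Let $\mathcal C$ be the set of integer compositions $(n_1,\dots,n_k)$, $k\ge 0$, $n_i\ge 1$. For $0\le\alpha\le 1$ and $\theta\ge 0$, an *up-down oCRP$(\alpha,\theta)$* is a continuous-time Markov chain on $\mathcal C$ which from $(n_1,\dots,n_k)$ makes, for each $1\le i\le k$, a transition to $(n_1,\dots,n_i+1,\dots,n_k)$ at rate $n_i-\alpha$, to $(n_1,\dots,n_i,1,n_{i+1},\dots,n_k)$ at rate $\alpha$, and at rate $n_i$ to $(n_1,\dots,n_i-1,\dots,n_k)$ (where the $i$-th entry is deleted if $n_i=1$), and to $(1,n_1,\dots,n_k)$ at rate $\theta$; rates leading to the same state are added. A *$Q_\alpha$-chain* is a continuous-time Markov chain on $\{0,1,2,\dots\}$ with rates $m-\alpha$ for $m\to m+1$ and $m$ for $m\to m-1$, $m\ge 1$, and $0$ absorbing. *Marked excursions.* For $n\ge 1$ let $Z^i$, $i\ge 0$, be independent $Q_\alpha$-chains with $Z^0(0)=n$ and $Z^i(0)=1$ for $i\ge 1$, with absorption times $\zeta_i=\inf\{s\ge0: Z^i(s)=0\}$, and let $J$ be an independent Poisson process of rate $\alpha$. Put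 $X_t=-t+\sum_{i=0}^{J_t}\zeta_i$ for $t\ge 0$, $X_{0-}=0$, and $T=\inf\{t\ge 0: X_t=0\}$. Mark the $i$-th jump of $X$ (the $0$-th one is at time $0$) by $Z^i$. Let $P_n$ be the law of the marked process $(X,Z)$ stopped at time $T$. *Skewer.* The skewer at level $y\ge 0$ of a marked path $X$ lists from left to right, over all jump times $t$ with $X_{t-}\le y<X_t$, the values $Z(y-X_{t-})$, where $Z$ is the mark of the jump at time $t$. *Negative time axis.* Let $\theta>0$. Let $A_1<A_2<\cdots$ be the times of a Poisson process of rate $\theta$ and, independently, let $X^{(1)},X^{(2)},\dots$ be IID marked excursions with law $P_1$ (realised as independent copies of the above stopped process with $n=1$), of lengths $\xi_1,\xi_2,\dots$. Put $L_0=0$, $L_j=-A_j-\sum_{i=1}^j\xi_i$ and $R_j=L_j+\xi_j$ for $j\ge 1$. For $t<0$ let $X_t=A_j+X^{(j)}_{t-L_j}$ if $t\in[L_j,R_j]$, and $X_t=|t|-\sum_{i=1}^{j-1}\xi_i$ if $t\in(R_j,L_{j-1})$, with the jumps marked as in the excursions. Let $\mathcal S_-^y$ be the skewer of $(X_t)_{t<0}$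 at level $y$. **Theorem.** Let $0\le\alpha\le 1$, $\theta>0$ and $(n_1,\dots,n_k)\in\mathcal C$. Let $\mathcal S^{1,y},\dots,\mathcal S^{k,y}$ be the skewers at level $y$ of independent marked excursions with laws $P_{n_1},\dots,P_{n_k}$ (constructed as above), independent of the marked process on the negative time axis, and let $\mathcal S^y=\mathcal S^{1,y}\mathcal S^{2,y}\cdots\mathcal S^{k,y}$ be their concatenation. Then the process of concatenations $(\mathcal S_-^y\,\mathcal S^y)_{y\ge 0}$ is almost surely $\mathcal C$-valued for all $y\ge 0$ and is an up-down oCRP$(\alpha,\theta)$ starting from $(n_1,\dots,n_k)$. -/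

import Mathlib

open MeasureTheory ProbabilityTheory
open scoped NNReal ENNReal

noncomputable section

/-! ### Continuous-time Markov chains on a countable state space -/

/-- Total jump rate out of `x`; `q x y`, `y ≠ x`, are the off-diagonal entries of a Q-matrix
(diagonal entries of `q` are ignored). -/
def totalRate {S : Type*} (q : S → S → ℝ) (x : S) : ℝ := by
  classical
  exact ∑' y, if y = x then 0 else q x y

/-- Transition matrix of the jump chain: `q x y / totalRate q x` off the diagonal, and the chain
stays put at absorbing states. -/
def jumpProb {S : Type*} (q : S → S → ℝ) (x y : S) : ℝ := by
  classical
  exact if totalRate q x = 0 then (if y = x then 1 else 0)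
    else (if y = x then 0 else q x y / totalRate q x)

/-- `X` is a (right-continuous, non-explosive) continuous-time Markov chain with Q-matrix `q`
started from `x₀`, in terms of its jump chain `Y` and holding times `H`: the chain `Y` is Markov
with transition matrix `jumpProb q` from `x₀`, and given `Y` the holding times are independent and
exponential with rates `totalRate q (Y n)` (infinite if this rate is `0`). -/
def IsMarkovChain {Ω S : Type*} [MeasurableSpace Ω] [Countable S]
    (q : S → S → ℝ) (x₀ : S) (X : Ω → ℝ≥0 → S) (μ : Measure Ω) : Prop :=
  ∃ (Y : ℕ → Ω → S) (H : ℕ → Ω → ℝ≥0∞),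
    (∀ n x, MeasurableSet {ω | Y n ω = x}) ∧ (∀ n, Measurable (H n)) ∧
    (∀ᵐ ω ∂μ, Y 0 ω = x₀) ∧
    (∀ (n : ℕ) (y : ℕ → S) (t : ℕ → ℝ≥0), y 0 = x₀ →
      μ {ω | ∀ m ≤ n, Y m ω = y m ∧ (t m : ℝ≥0∞) < H m ω} =
        ENNReal.ofReal ((∏ m ∈ Finset.range n, jumpProb q (y m) (y (m + 1))) *
          ∏ m ∈ Finset.range (n + 1), Real.exp (-(totalRate q (y m) * t m)))) ∧
    (∀ᵐ ω ∂μ, ∑' n, H n ω = ∞) ∧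
    (∀ᵐ ω ∂μ, ∀ (n : ℕ) (t : ℝ≥0), ∑ m ∈ Finset.range n, H m ω ≤ t →
      (t : ℝ≥0∞) < ∑ m ∈ Finset.range (n + 1), H m ω → X ω t = Y n ω)

/-- The Poisson process of rate `r ≥ 0`: the pure birth chain on `ℕ` from `0` with constant
rate `r`. -/
def IsPoissonProcess {Ω : Type*} [MeasurableSpace Ω] (r : ℝ) (J : Ω → ℝ≥0 → ℕ)
    (μ : Measure Ω) : Prop :=
  IsMarkovChain (fun m l => if l = m + 1 then r else 0) 0 J μ

/-- Table sizes: from `m ≥ 1` to `m + 1` at rate `m - α` and to `m - 1` at rate `m`; the state `0`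
is absorbing. -/
def tableRate (α : ℝ) (m l : ℕ) : ℝ :=
  if m = 0 then 0 else if l = m + 1 then (m : ℝ) - α else if l + 1 = m then (m : ℝ) else 0

/-- Transition rates of the up-down oCRP on integer compositions, i.e. finite lists of positive
integers. Rates of different transitions with the same target are added up. -/
def upDownRate (α θ : ℝ) (c c' : List ℕ+) : ℝ :=
  (∑ i : Fin c.length, if c' = c.set i (c.get i + 1) then ((c.get i : ℕ) : ℝ) - α else 0) +
  (∑ i : Fin c.length, if c' = c.insertIdx ((i : ℕ) + 1) 1 then α else 0) +
  (if c' = 1 :: c then θ else 0) +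
  ∑ i : Fin c.length,
    if c' = (if c.get i = 1 then c.eraseIdx i else c.set i (c.get i - 1))
    then ((c.get i : ℕ) : ℝ) else 0

/-- `C` is a (continuous-time) up-down oCRP with parameters `(α, θ)` starting from `c`. -/
def IsUpDownOCRP {Ω : Type*} [MeasurableSpace Ω] (α θ : ℝ) (c : List ℕ+)
    (C : Ω → ℝ≥0 → List ℕ+) (μ : Measure Ω) : Prop :=
  IsMarkovChain (upDownRate α θ) c C μ

/-! ### Marked paths and their skewers -/

/-- A real path, of which the part over the time set `dom` is considered, where a jump at time `t`
is marked by the integer-valued path `mark t` (values of `mark` at other times are irrelevant). -/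
structure MarkedPath where
  dom : Set ℝ
  path : ℝ → ℝ
  mark : ℝ → ℝ≥0 → ℕ

namespace MarkedPath

/-- Birth level `X_{t-}` of the jump at time `t`; the death level is `X_t`. -/
def birth (E : MarkedPath) (t : ℝ) : ℝ := Function.leftLim E.path t

/-- The times of the jumps that cross level `y`. -/
def crossings (E : MarkedPath) (y : ℝ≥0) : Set ℝ :=
  {t | t ∈ E.dom ∧ E.birth t ≤ y ∧ (y : ℝ) < E.path t}

/-- The skewer at level `y`: from left to right, the marks of the jumps that cross level `y`,
evaluated at level `y`. (Empty if there are infinitely many such jumps.) -/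
def skewer (E : MarkedPath) (y : ℝ≥0) : List ℕ := by
  classical
  exact if h : (E.crossings y).Finite then
    (h.toFinset.sort (· ≤ ·)).map fun t => E.mark t (y - E.birth t).toNNReal
  else []

/-- The hitting time of zero, `inf {t ≥ 0 : X_t = 0}`. -/
def hit (X : ℝ → ℝ) : ℝ := sInf {t | 0 ≤ t ∧ X t = 0}

end MarkedPath

/-- A path of the Poisson process `J` together with paths of the table sizes `Z i`, `i ≥ 0`. -/
abbrev DrivingPath : Type := (ℝ≥0 → ℕ) × (ℕ → ℝ≥0 → ℕ)

/-- Absorption time of a table size path. -/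
def absorptionTime (z : ℝ≥0 → ℕ) : ℝ≥0 := sInf {s | z s = 0}

/-- `X t = -t + ∑_{i = 0}^{J t} ζ i` for `t ≥ 0`; the value `0` at negative times implements the
convention `X_{0-} = 0`, so that `ζ 0` is a jump at time `0`. -/
def contour (w : DrivingPath) (t : ℝ) : ℝ :=
  if t < 0 then 0
  else -t + ∑ i ∈ Finset.range (w.1 t.toNNReal + 1), (absorptionTime (w.2 i) : ℝ)

/-- The marked process stopped when `X` hits `0`. Its `i`-th jump takes place at the time when
`J` jumps to `i` (at time `0` if `i = 0`) and is marked by `Z i`. -/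
def markedContour (w : DrivingPath) : MarkedPath where
  dom := Set.Icc 0 (MarkedPath.hit (contour w))
  path := contour w
  mark t := w.2 (w.1 t.toNNReal)

/-- `W` consists of independent table size chains, the one with index `0` started from `n` and
all others from `1`, and of an independent Poisson process of rate `α`. -/
structure IsDriving {Ω : Type*} [MeasurableSpace Ω] (α : ℝ) (n : ℕ) (W : Ω → DrivingPath)
    (μ : Measure Ω) : Prop where
  measurable : Measurable W
  poisson : IsPoissonProcess α (fun ω => (W ω).1) μ
  first : IsMarkovChain (tableRate α) n (fun ω => (W ω).2 0) μ
  others : ∀ i, 1 ≤ i → IsMarkovChain (tableRate α) 1 (fun ω => (W ω).2 i) μ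
  indep_tables : iIndepFun (fun i ω => (W ω).2 i) μ
  indep_poisson : IndepFun (fun ω => (W ω).1) (fun ω => (W ω).2) μ

/-! ### The marked process on the negative time axis

`M` is a path of a counting process and `E j`, `j ≥ 0`, are marked excursions; `E j` is the
`(j+1)`-st one to the left of time `0`. -/

/-- The time of the `j`-th jump of `M` for `j ≥ 1`, and `0` for `j = 0`. -/
def jumpTime (M : ℝ≥0 → ℕ) (j : ℕ) : ℝ≥0 := sInf {t | j ≤ M t}

/-- The length of an excursion. -/
def excLength (E : MarkedPath) : ℝ := MarkedPath.hit E.path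

/-- Left endpoint of the `j`-th excursion, `j ≥ 1`; the value for `j = 0` is `0`. -/
def leftEnd (M : ℝ≥0 → ℕ) (E : ℕ → MarkedPath) (j : ℕ) : ℝ :=
  -(jumpTime M j : ℝ) - ∑ i ∈ Finset.range j, excLength (E i)

/-- The time interval of the excursion `E j`. -/
def excInterval (M : ℝ≥0 → ℕ) (E : ℕ → MarkedPath) (j : ℕ) : Set ℝ :=
  Set.Icc (leftEnd M E (j + 1)) (leftEnd M E (j + 1) + excLength (E j))

/-- The time interval of unit negative drift between `E j` and `E (j-1)` (or time `0`,
if `j = 0`). -/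
def driftInterval (M : ℝ≥0 → ℕ) (E : ℕ → MarkedPath) (j : ℕ) : Set ℝ :=
  Set.Ioo (leftEnd M E (j + 1) + excLength (E j)) (leftEnd M E j)

open Classical in
/-- The marked process `(X_t)_{t < 0}`: a process of unit negative drift into which the excursion
`E j` is inserted at the level given by the `(j+1)`-st jump time of `M`. -/
def negMarkedPath (M : ℝ≥0 → ℕ) (E : ℕ → MarkedPath) : MarkedPath where
  dom := Set.Iio 0
  path t :=
    if h : ∃ j, t ∈ excInterval M E j then
      jumpTime M (Nat.find h + 1) + (E (Nat.find h)).path (t - leftEnd M E (Nat.find h + 1))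
    else if h : ∃ j, t ∈ driftInterval M E j then
      |t| - ∑ i ∈ Finset.range (Nat.find h), excLength (E i)
    else 0
  mark t :=
    if h : ∃ j, t ∈ excInterval M E j then
      (E (Nat.find h)).mark (t - leftEnd M E (Nat.find h + 1))
    else 0

end

/-! The level `y` plays the role of time, and the point is that the contour, cut at a level,
consists of fresh independent excursions above that level.

Scanned from left to right, an excursion is encoded by a finite word of letters (level, new table
size). Its law `excursionLaw` has a density `weight` with respect to the sum, over all lengths, of
products of Lebesgue measure on levels and counting measure on sizes. A priori a step up by `h` from
size `n` contributes `tableRate` times exp(-(2n-α)h), a step down by `g` to a birth contributes α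
exp(-αg), and the last descent to zero contributes exp(-αg). Ascents and descents of an excursion
balance, so all the factors exp(-αg) can be moved to the ascents: an ascent then costs exp(-2nh) and
a birth only α. This is `machineIntegral_machineValue`, where a machine writes the word from the
jump chains and holding times.

In this form the density can be cut at its lowest letter (`lintegral_relSplit`). If this letter, at
level b, is the first one, it is the first jump of the first table, and an excursion from the new
size remains above b. Otherwise all letters in front are higher, so the letter is reached by a
descent from a dead table and is a birth; the words in front and behind are then independent
excursions above b from sizes n and 1. Either way a factor exp(-2nb) splits off. Thus b is
exponential of rate 2n = (n-α) + n + α, and the block n turns into n+1, n-1 or (n,1) at the rates of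
the up-down chain. Competing exponential clocks and loss of memory extend this to lists of
independent excursions (`lintegral_forestNext`) and, with exponential gaps between insertion levels,
to immigration of a leftmost table at rate θ (`lintegral_configNext`). `configLaw_step` is the
resulting one-step Markov property, and `measure_cylinder` iterates it.

Two finiteness statements enter. Excursions are almost surely finite: the mass of `excursionLaw` is
at most one, being a halting probability, and as a function of the initial size it solves a
recursion whose only solution is one (`eq_one_of_extinction_recursion`). The chain does not explode:
the expectation of exp(-T), for T the level of the m-th event, tends to zero as m grows
(`lintegral_configDiscount_le`).

It remains to return to paths. The hypotheses only assert that suitable jump chains and holding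
times exist; `readPath` recovers them measurably from a path, so they inherit independence, and
`eq_chainLaw` identifies their law. Pathwise, the skewer of a contour is the section of its word
(`GoodDriving.exists_crossedAt`), and the section of a configuration is unchanged when everything up
to its first event is cut away (`ConfigSection.next`). Hence the skewer at `y` lists the table sizes
after the last event up to `y`. -/

set_option linter.unusedSectionVars false

/-! ### Measurable structure on lists -/

section Lists

variable {X Y β γ δ : Type*}

/-- The list of the first `n` terms of a sequence. -/
def seqPrefix : ℕ → (ℕ → X) → List X
  | 0, _ => []
  | n + 1, f => f 0 :: seqPrefix n fun i => f (i + 1)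

theorem length_seqPrefix (n : ℕ) (f : ℕ → X) : (seqPrefix n f).length = n := by
  induction n generalizing f with
  | zero => rfl
  | succ n ih => simp [seqPrefix, ih]

theorem getD_seqPrefix (n i : ℕ) (f : ℕ → X) (x : X) :
    (seqPrefix n f).getD i x = if i < n then f i else x := by
  induction n generalizing f i with
  | zero => simp [seqPrefix]
  | succ n ih =>
    cases i with
    | zero => simp [seqPrefix]
    | succ i => rw [seqPrefix, List.getD_cons_succ, ih]; simp

theorem seqPrefix_getD (l : List X) (x : X) :
    seqPrefix l.length (fun i => l.getD i x) = l := by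
  induction l with
  | nil => rfl
  | cons a l ih => simpa [seqPrefix] using ih

variable [MeasurableSpace X] [MeasurableSpace Y] [MeasurableSpace β] [MeasurableSpace γ]
  [MeasurableSpace δ]

/-- A set of lists is measurable if its trace on the lists of each given length is. -/
instance List.instMeasurableSpace : MeasurableSpace (List X) :=
  ⨅ n, MeasurableSpace.map (seqPrefix n) MeasurableSpace.pi

theorem measurableSet_list {s : Set (List X)} :
    MeasurableSet s ↔ ∀ n, MeasurableSet (seqPrefix n ⁻¹' s) := by
  unfold List.instMeasurableSpace
  rw [MeasurableSpace.measurableSet_iInf]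
  rfl

theorem measurable_seqPrefix (n : ℕ) : Measurable (seqPrefix n : (ℕ → X) → List X) :=
  fun _ hs => measurableSet_list.1 hs n

theorem measurable_of_list {F : List X → γ}
    (h : ∀ n, Measurable fun f => F (seqPrefix n f)) : Measurable F :=
  fun _ hs => measurableSet_list.2 fun n => h n hs

theorem measurable_list_length : Measurable (List.length : List X → ℕ) :=
  measurable_of_list fun n => by simp [length_seqPrefix]

theorem measurable_list_getD (i : ℕ) (x : X) : Measurable fun l : List X => l.getD i x :=
  measurable_of_list fun n => by
    simp only [getD_seqPrefix]
    split_ifs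
    · fun_prop
    · exact measurable_const

/-- The list is recovered from its length and from its entries, padded to a sequence by an arbitrary
point. The length takes countably many values, so it may be held fixed even in the presence of a
parameter. -/
theorem measurable_of_prod_list [Nonempty X] {F : β × List X → γ}
    (h : ∀ n, Measurable fun p : β × (ℕ → X) => F (p.1, seqPrefix n p.2)) : Measurable F := by
  obtain ⟨x⟩ := ‹Nonempty X›
  have h1 : Measurable fun p : (β × (ℕ → X)) × ℕ => F (p.1.1, seqPrefix p.2 p.1.2) :=
    measurable_from_prod_countable_left fun n => h n
  have h2 : Measurable fun p : β × List X => ((p.1, fun i => p.2.getD i x), p.2.length) := by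
    refine Measurable.prodMk (Measurable.prodMk measurable_fst ?_)
      (measurable_list_length.comp measurable_snd)
    exact measurable_pi_lambda _ fun i => (measurable_list_getD i x).comp measurable_snd
  convert h1.comp h2 using 1
  ext p
  simp only [Function.comp, seqPrefix_getD]

/-- Functions that are defined by recursion on a list are measurable. -/
theorem measurable_list_rec [Nonempty X] {F : β → List X → γ} (φ : β → X → β)
    (G : β × X × List X × γ → γ) (hφ : Measurable fun p : β × X => φ p.1 p.2)
    (hG : Measurable G) (h0 : Measurable fun b => F b [])
    (hF : ∀ b a l, F b (a :: l) = G (b, a, l, F (φ b a) l)) :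
    Measurable fun p : β × List X => F p.1 p.2 := by
  refine measurable_of_prod_list fun n => ?_
  induction n with
  | zero => exact h0.comp measurable_fst
  | succ n ih =>
    simp only [seqPrefix, hF]
    have hs : Measurable fun p : β × (ℕ → X) => fun i => p.2 (i + 1) := by fun_prop
    have h0 : Measurable fun p : β × (ℕ → X) => φ p.1 (p.2 0) :=
      hφ.comp (measurable_fst.prodMk (by fun_prop))
    have h1 : Measurable fun p : β × (ℕ → X) => F (φ p.1 (p.2 0)) (seqPrefix n fun i => p.2 (i + 1)) :=
      ih.comp (h0.prodMk hs)
    exact hG.comp (measurable_fst.prodMk (Measurable.prodMk (by fun_prop)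
      (((measurable_seqPrefix n).comp hs).prodMk h1)))

theorem measurable_list_cons [Nonempty X] : Measurable fun p : X × List X => p.1 :: p.2 := by
  refine measurable_of_prod_list fun n => ?_
  have h : Measurable fun p : X × (ℕ → X) => (fun i : ℕ => Nat.casesOn i p.1 p.2 : ℕ → X) := by
    refine measurable_pi_lambda _ fun i => ?_
    cases i
    · exact measurable_fst
    · exact (measurable_pi_apply _).comp measurable_snd
  exact (measurable_seqPrefix (n + 1)).comp h

@[fun_prop]
theorem Measurable.list_cons [Nonempty X] {f : β → X} {g : β → List X} (hf : Measurable f)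
    (hg : Measurable g) : Measurable fun b => f b :: g b :=
  measurable_list_cons.comp (hf.prodMk hg)

@[fun_prop]
theorem Measurable.list_append [Nonempty X] {f g : β → List X} (hf : Measurable f)
    (hg : Measurable g) : Measurable fun b => f b ++ g b := by
  have : Measurable fun p : List X × List X => p.2 ++ p.1 :=
    measurable_list_rec (F := fun b l => l ++ b) (fun b _ => b) (fun q => q.2.1 :: q.2.2.2)
      (by fun_prop) (by fun_prop) (by simpa using measurable_id') (by simp)
  exact this.comp (hg.prodMk hf)

theorem Measurable.list_map [Nonempty X] [Nonempty Y] {f : β → X → Y} {g : β → List X}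
    (hf : Measurable fun p : β × X => f p.1 p.2) (hg : Measurable g) :
    Measurable fun b => (g b).map (f b) := by
  have : Measurable fun p : β × List X => p.2.map (f p.1) :=
    measurable_list_rec (F := fun b l => l.map (f b)) (fun b _ => b)
      (fun q => f q.1 q.2.1 :: q.2.2.2) (by fun_prop)
      (Measurable.list_cons (hf.comp (measurable_fst.prodMk (measurable_fst.comp measurable_snd)))
        (by fun_prop)) (by simp) (by simp)
  exact this.comp (measurable_id.prodMk hg)

theorem measurableSet_list_forall [Nonempty X] {s : Set (β × X)} (hs : MeasurableSet s) :
    MeasurableSet {p : β × List X | ∀ x ∈ p.2, (p.1, x) ∈ s} := by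
  classical
  have : Measurable fun p : β × List X => decide (∀ x ∈ p.2, (p.1, x) ∈ s) := by
    refine measurable_list_rec (F := fun b l => decide (∀ x ∈ l, (b, x) ∈ s)) (fun b _ => b)
      (fun q => decide ((q.1, q.2.1) ∈ s) && q.2.2.2) (by fun_prop) ?_ (by simp) (by simp)
    have h1 : Measurable fun q : β × X × List X × Bool => decide ((q.1, q.2.1) ∈ s) := by
      refine measurable_to_bool ?_
      have : Measurable fun q : β × X × List X × Bool => (q.1, q.2.1) := by fun_prop
      convert this hs using 1
      ext; simp
    exact (measurable_of_countable fun p : Bool × Bool => p.1 && p.2).comp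
      (h1.prodMk (by fun_prop))
  convert this (measurableSet_singleton true) using 1
  ext; simp

theorem measurableSet_list_forall_mem [Nonempty X] {s : Set X} (hs : MeasurableSet s) :
    MeasurableSet {w : List X | ∀ x ∈ w, x ∈ s} := by
  have := measurableSet_list_forall (β := Unit) (s := {p : Unit × X | p.2 ∈ s})
    (measurable_snd hs)
  exact (measurable_const.prodMk measurable_id : Measurable fun w : List X => ((), w)) this

theorem measurableSet_list_nil [Nonempty X] : MeasurableSet {l : List X | l = []} := by
  convert measurable_list_length (X := X) (measurableSet_singleton 0) using 1
  ext l; simp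

instance [Nonempty X] [Countable X] [MeasurableSingletonClass X] :
    MeasurableSingletonClass (List X) := by
  refine ⟨fun l => ?_⟩
  obtain ⟨x⟩ := ‹Nonempty X›
  have : ({l} : Set (List X)) = {k | k.length = l.length} ∩ ⋂ i, {k | k.getD i x = l.getD i x} := by
    ext k
    simp only [Set.mem_singleton_iff, Set.mem_inter_iff, Set.mem_ofPred_eq, Set.mem_iInter]
    constructor
    · rintro rfl; simp
    · rintro ⟨h1, h2⟩
      rw [← seqPrefix_getD k x, ← seqPrefix_getD l x, h1]
      simp only [h2]
  rw [this]
  exact (measurable_list_length (measurableSet_singleton _)).inter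
    (MeasurableSet.iInter fun i => measurable_list_getD i x (measurableSet_singleton _))

end Lists

/-! ### Free monoid measures -/

section FreeMeasure

variable {X β : Type*} [MeasurableSpace X] [Nonempty X] [MeasurableSpace β]

/-- The `k`-fold product of `ν` as a measure on lists of length `k`. -/
noncomputable def powMeasure (ν : Measure X) : ℕ → Measure (List X)
  | 0 => Measure.dirac []
  | k + 1 => (ν.prod (powMeasure ν k)).map fun p => p.1 :: p.2

/-- The sum over all lengths of the product measures on lists. -/
noncomputable def freeMeasure (ν : Measure X) : Measure (List X) := Measure.sum (powMeasure ν)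

variable (ν : Measure X) [SFinite ν]

instance (k : ℕ) : SFinite (powMeasure ν k) := by
  induction k with
  | zero => unfold powMeasure; infer_instance
  | succ k ih => unfold powMeasure; infer_instance

instance : SFinite (freeMeasure ν) := by unfold freeMeasure; infer_instance

theorem lintegral_powMeasure_succ (k : ℕ) {F : List X → ℝ≥0∞} (hF : Measurable F) :
    ∫⁻ w, F w ∂powMeasure ν (k + 1) = ∫⁻ a, ∫⁻ w, F (a :: w) ∂powMeasure ν k ∂ν := by
  rw [powMeasure, lintegral_map hF measurable_list_cons, lintegral_prod _ (by fun_prop)]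

theorem lintegral_freeMeasure {F : List X → ℝ≥0∞} :
    ∫⁻ w, F w ∂freeMeasure ν = ∑' k, ∫⁻ w, F w ∂powMeasure ν k := by
  rw [freeMeasure, lintegral_sum_measure]

theorem lintegral_freeMeasure_cons {F : List X → ℝ≥0∞} (hF : Measurable F) :
    ∫⁻ w, F w ∂freeMeasure ν = F [] + ∫⁻ a, ∫⁻ w, F (a :: w) ∂freeMeasure ν ∂ν := by
  rw [lintegral_freeMeasure, tsum_eq_zero_add' ENNReal.summable]
  congr 1
  · simp only [powMeasure]; rw [lintegral_dirac' _ hF]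
  · simp_rw [lintegral_freeMeasure, lintegral_powMeasure_succ ν _ hF]
    rw [lintegral_tsum]
    intro k
    have : Measurable fun p : X × List X => F (p.1 :: p.2) := by fun_prop
    exact (this.lintegral_prod_right').aemeasurable

theorem ae_powMeasure_length (k : ℕ) : ∀ᵐ w ∂powMeasure ν k, w.length = k := by
  induction k with
  | zero => simp [powMeasure, ae_dirac_iff measurableSet_list_nil]
  | succ k ih =>
    have hm : MeasurableSet {w : List X | w.length = k + 1} :=
      measurable_list_length (measurableSet_singleton _)
    rw [powMeasure, ae_map_iff (by fun_prop) hm]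
    simp only [List.length_cons, Nat.add_right_cancel_iff]
    exact Measure.quasiMeasurePreserving_snd.ae ih

theorem ae_freeMeasure_forall {s : Set X} (hs : MeasurableSet s) (h : ∀ᵐ x ∂ν, x ∈ s) :
    ∀ᵐ w ∂freeMeasure ν, ∀ x ∈ w, x ∈ s := by
  have hm : MeasurableSet {w : List X | ∀ x ∈ w, x ∈ s} := 
    measurableSet_list_forall_mem hs
  rw [freeMeasure, Measure.ae_sum_iff' hm]
  intro k
  induction k with
  | zero => 
    rw [powMeasure, ae_dirac_iff hm]; simp
  | succ k ih =>
    rw [powMeasure, ae_map_iff (by fun_prop) hm]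
    filter_upwards [Measure.quasiMeasurePreserving_snd.ae ih,
      Measure.quasiMeasurePreserving_fst.ae h] with p h1 h2
    simpa using ⟨h2, h1⟩

/-- A change of variables for single letters induces one for words. -/
theorem lintegral_freeMeasure_map {s : Set X} (hs : MeasurableSet s) {φ : X → X}
    (hφ : Measurable φ)
    (h : ∀ f : X → ℝ≥0∞, Measurable f → ∫⁻ x, s.indicator (fun x => f (φ x)) x ∂ν = ∫⁻ x, f x ∂ν)
    {F : List X → ℝ≥0∞} (hF : Measurable F) :
    ∫⁻ w, {w : List X | ∀ x ∈ w, x ∈ s}.indicator (fun w => F (w.map φ)) w ∂freeMeasure ν =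
      ∫⁻ w, F w ∂freeMeasure ν := by
  classical
  have hm : MeasurableSet {w : List X | ∀ x ∈ w, x ∈ s} := 
    measurableSet_list_forall_mem hs
  have hmap : Measurable fun w : List X => w.map φ :=
    Measurable.list_map (f := fun _ => φ) (by fun_prop) measurable_id
  have hI {F : List X → ℝ≥0∞} (hF : Measurable F) : Measurable fun w : List X =>
      {w : List X | ∀ x ∈ w, x ∈ s}.indicator (fun w => F (w.map φ)) w :=
    (hF.comp hmap).indicator hm
  rw [lintegral_freeMeasure, lintegral_freeMeasure]
  congr 1
  ext k
  induction k generalizing F with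
  | zero =>
    simp only [powMeasure]
    rw [lintegral_dirac' _ hF, lintegral_dirac' _ (hI hF)]
    simp
  | succ k ih =>
    rw [lintegral_powMeasure_succ _ _ hF,
      lintegral_powMeasure_succ _ _ (hI hF)]
    have hc : Measurable fun p : X × List X => F (p.1 :: p.2) := by fun_prop
    rw [← h _ hc.lintegral_prod_right']
    congr 1
    ext a
    by_cases ha : a ∈ s
    · rw [Set.indicator_of_mem ha, ← ih (F := fun w => F (φ a :: w)) (by fun_prop)]
      congr 1
      ext w
      simp [Set.indicator_apply, ha]
    · rw [Set.indicator_of_notMem ha]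
      simp [ha]

end FreeMeasure

/-! ### Splitting a word at its lowest letter -/

section MinSplit

/-- A letter consists of a level and of a table size. -/
abbrev Letter : Type := ℝ × ℕ

/-- A word over the letters. -/
abbrev Word : Type := List Letter

/-- The first letter of minimal level, with the words in front of it and behind it. -/
noncomputable def minSplit : Word → Word × Letter × Word
  | [] => ([], (0, 0), [])
  | x :: w =>
    if w = [] ∨ x.1 ≤ (minSplit w).2.1.1 then ([], x, w)
    else (x :: (minSplit w).1, (minSplit w).2.1, (minSplit w).2.2)

/-- The letter in the middle is the first one of minimal level. -/
def MinAt (t : Word × Letter × Word) : Prop :=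
  (∀ x ∈ t.1, t.2.1.1 < x.1) ∧ ∀ x ∈ t.2.2, t.2.1.1 ≤ x.1

theorem minSplit_spec {w : Word} (hw : w ≠ []) :
    w = (minSplit w).1 ++ (minSplit w).2.1 :: (minSplit w).2.2 ∧ MinAt (minSplit w) := by
  induction w with
  | nil => exact absurd rfl hw
  | cons x w ih =>
    by_cases h0 : w = []
    · subst h0; simp [minSplit, MinAt]
    obtain ⟨h1, h2, h3⟩ := ih h0
    by_cases h : x.1 ≤ (minSplit w).2.1.1
    · rw [minSplit, if_pos (Or.inr h)]
      refine ⟨rfl, by simp, ?_⟩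
      intro y hy
      change y ∈ w at hy
      rw [h1] at hy
      simp only [List.mem_append, List.mem_cons] at hy
      rcases hy with hy | rfl | hy
      · exact h.trans (h2 y hy).le
      · exact h
      · exact h.trans (h3 y hy)
    · rw [minSplit, if_neg (by tauto)]
      push Not at h
      refine ⟨by simpa using h1, ?_, h3⟩
      simp only [List.mem_cons, forall_eq_or_imp]
      exact ⟨h, h2⟩

theorem minSplit_mem {w : Word} (hw : w ≠ []) : (minSplit w).2.1 ∈ w := by
  have h : (minSplit w).2.1 ∈ (minSplit w).1 ++ (minSplit w).2.1 :: (minSplit w).2.2 := by simp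
  rwa [← (minSplit_spec hw).1] at h

theorem measurable_minSplit : Measurable minSplit := by
  have hc : MeasurableSet {q : Unit × Letter × Word × (Word × Letter × Word) |
      q.2.2.1 = [] ∨ q.2.1.1 ≤ q.2.2.2.2.1.1} := by
    have : Measurable fun q : Unit × Letter × Word × (Word × Letter × Word) => q.2.2.1 := by
      fun_prop
    refine MeasurableSet.union ?_ (measurableSet_le
      (f := fun q : Unit × Letter × Word × (Word × Letter × Word) => q.2.1.1)
      (g := fun q => q.2.2.2.2.1.1) (by fun_prop) (by fun_prop))
    exact this measurableSet_list_nil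
  have := measurable_list_rec (β := Unit) (F := fun _ => minSplit) (fun b _ => b)
    (fun q => if q.2.2.1 = [] ∨ q.2.1.1 ≤ q.2.2.2.2.1.1 then ([], q.2.1, q.2.2.1)
      else (q.2.1 :: q.2.2.2.1, q.2.2.2.2.1, q.2.2.2.2.2)) (by fun_prop)
    (Measurable.ite hc (by fun_prop) (by fun_prop)) (by fun_prop) (by simp [minSplit])
  exact this.comp (measurable_const.prodMk measurable_id : Measurable fun w : Word => ((), w))

theorem measurableSet_minAt : MeasurableSet {t | MinAt t} := by
  have h1 := measurableSet_list_forall (measurableSet_lt (f := fun p : Letter × Letter => p.1.1)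
    (g := fun p => p.2.1) (by fun_prop) (by fun_prop))
  have h2 := measurableSet_list_forall (measurableSet_le (f := fun p : Letter × Letter => p.1.1)
    (g := fun p => p.2.1) (by fun_prop) (by fun_prop))
  have m1 : Measurable fun t : Word × Letter × Word => (t.2.1, t.1) := by fun_prop
  have m2 : Measurable fun t : Word × Letter × Word => (t.2.1, t.2.2) := by fun_prop
  exact (m1 h1).inter (m2 h2)

variable (ν : Measure Letter) [SFinite ν]

/-- The powers of `ν` live on disjoint sets of words. This passes between integrals over words of
fixed length and integrals over all words, which are the convenient ones for the two sides of a cut.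
-/
theorem lintegral_freeMeasure_length (k : ℕ) (F : Word → ℝ≥0∞) :
    ∫⁻ w, {w | w.length = k}.indicator F w ∂freeMeasure ν = ∫⁻ w, F w ∂powMeasure ν k := by
  rw [lintegral_freeMeasure, tsum_eq_single k]
  · refine lintegral_congr_ae ?_
    filter_upwards [ae_powMeasure_length ν k] with w hw
    rw [Set.indicator_of_mem (by exact hw)]
  · intro j hj
    rw [← lintegral_zero]
    refine lintegral_congr_ae ?_
    filter_upwards [ae_powMeasure_length ν j] with w hw
    rw [Set.indicator_of_notMem]
    simp [hw, hj]

/-- Each nonempty word has exactly one first letter of minimal level, so the triples with `MinAt`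
parametrise the words. The induction compares the leading letter with the minimum of the remaining
word. -/
theorem lintegral_powMeasure_minSplit (k : ℕ) {Φ : Word × Letter × Word → ℝ≥0∞}
    (hΦ : Measurable Φ) :
    ∫⁻ w, Φ (minSplit w) ∂powMeasure ν (k + 1) =
      ∫⁻ u, ∫⁻ a, ∫⁻ v, ({t | MinAt t} ∩ {t | t.1.length + t.2.2.length = k}).indicator Φ (u, a, v)
        ∂freeMeasure ν ∂ν ∂freeMeasure ν := by
  classical
  have hL (k : ℕ) : MeasurableSet
      ({t : Word × Letter × Word | MinAt t} ∩ {t | t.1.length + t.2.2.length = k}) := by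
    refine measurableSet_minAt.inter ?_
    exact measurableSet_eq_fun ((measurable_list_length.comp measurable_fst).add
      (measurable_list_length.comp (measurable_snd.comp measurable_snd))) measurable_const
  have hm (k : ℕ) {Φ : Word × Letter × Word → ℝ≥0∞} (hΦ : Measurable Φ) :
      Measurable fun u => ∫⁻ a, ∫⁻ v,
        ({t | MinAt t} ∩ {t | t.1.length + t.2.2.length = k}).indicator Φ (u, a, v)
          ∂freeMeasure ν ∂ν := by
    have h1 : Measurable fun p : (Word × Letter) × Word =>
        ({t | MinAt t} ∩ {t | t.1.length + t.2.2.length = k}).indicator Φ (p.1.1, p.1.2, p.2) :=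
      (hΦ.indicator (hL k)).comp (by fun_prop)
    exact h1.lintegral_prod_right'.lintegral_prod_right'
  have hle : MeasurableSet {p : Letter × Word | ∀ y ∈ p.2, p.1.1 ≤ y.1} :=
    measurableSet_list_forall (s := {p : Letter × Letter | p.1.1 ≤ p.2.1})
      (measurableSet_le (by fun_prop) (by fun_prop))
  induction k generalizing Φ with
  | zero =>
    have : Measurable fun w => Φ (minSplit w) := hΦ.comp measurable_minSplit
    rw [lintegral_powMeasure_succ _ _ this, lintegral_freeMeasure_cons ν (hm 0 hΦ)]
    have h0 : ∀ x u, ∫⁻ a, ∫⁻ v, ({t | MinAt t} ∩ {t | t.1.length + t.2.2.length = 0}).indicator Φ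
        (x :: u, a, v) ∂freeMeasure ν ∂ν = 0 := by
      intro x u
      simp
    simp only [h0, lintegral_zero, add_zero]
    congr 1; ext x
    have h1 : Measurable fun w => Φ (minSplit (x :: w)) := this.comp (by fun_prop)
    have h2 : Measurable fun v => ({t | MinAt t} ∩ {t | t.1.length + t.2.2.length = 0}).indicator Φ
        (([] : Word), x, v) := (hΦ.indicator (hL 0)).comp (by fun_prop)
    rw [powMeasure, lintegral_dirac' _ h1, lintegral_freeMeasure_cons ν h2]
    simp [minSplit, MinAt]
  | succ k ih =>
    have : Measurable fun w => Φ (minSplit w) := hΦ.comp measurable_minSplit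
    rw [lintegral_powMeasure_succ _ _ this, lintegral_freeMeasure_cons ν (hm (k + 1) hΦ)]
    have hA (x : Letter) : Measurable fun t : Word × Letter × Word =>
        {t : Word × Letter × Word | x.1 ≤ t.2.1.1}.indicator
          (fun t => Φ ([], x, t.1 ++ t.2.1 :: t.2.2)) t :=
      (hΦ.comp (by fun_prop)).indicator (measurableSet_le (by fun_prop) (by fun_prop))
    have hB (x : Letter) : Measurable fun t : Word × Letter × Word =>
        {t : Word × Letter × Word | t.2.1.1 < x.1}.indicator
          (fun t => Φ (x :: t.1, t.2.1, t.2.2)) t :=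
      (hΦ.comp (by fun_prop)).indicator (measurableSet_lt (by fun_prop) (by fun_prop))
    -- Either `x` is at most the minimum of the rest and is itself the first minimum, or it joins
    -- the word in front of that minimum. Ties go to the earlier letter.
    have key (x : Letter) : ∫⁻ w, Φ (minSplit (x :: w)) ∂powMeasure ν (k + 1) =
        (∫⁻ w, {t : Word × Letter × Word | x.1 ≤ t.2.1.1}.indicator
          (fun t => Φ ([], x, t.1 ++ t.2.1 :: t.2.2)) (minSplit w) ∂powMeasure ν (k + 1)) +
        ∫⁻ w, {t : Word × Letter × Word | t.2.1.1 < x.1}.indicator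
          (fun t => Φ (x :: t.1, t.2.1, t.2.2)) (minSplit w) ∂powMeasure ν (k + 1) := by
      have hA' : Measurable fun w => {t : Word × Letter × Word | x.1 ≤ t.2.1.1}.indicator
          (fun t => Φ ([], x, t.1 ++ t.2.1 :: t.2.2)) (minSplit w) :=
        (hA x).comp measurable_minSplit
      rw [← lintegral_add_left hA']
      refine lintegral_congr_ae ?_
      filter_upwards [ae_powMeasure_length ν (k + 1)] with w hw
      have hw0 : w ≠ [] := by rintro rfl; simp at hw
      have hs := (minSplit_spec hw0).1
      rw [minSplit]
      by_cases h : x.1 ≤ (minSplit w).2.1.1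
      · simp only [hw0, h, or_true, if_true, Set.indicator_apply, Set.mem_ofPred_eq, not_lt.2 h,
          if_false, add_zero]
        rw [← hs]
      · simp only [hw0, h, or_false, if_false, Set.indicator_apply, Set.mem_ofPred_eq,
          not_le.1 h, if_true, zero_add]
    have hc : Measurable fun x : Letter => ∫⁻ w, {t : Word × Letter × Word | x.1 ≤ t.2.1.1}.indicator
          (fun t => Φ ([], x, t.1 ++ t.2.1 :: t.2.2)) (minSplit w) ∂powMeasure ν (k + 1) := by
      have : Measurable fun q : Letter × Word =>
          {p : Letter × (Word × Letter × Word) | p.1.1 ≤ p.2.2.1.1}.indicator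
            (fun p => Φ ([], p.1, p.2.1 ++ p.2.2.1 :: p.2.2.2)) (q.1, minSplit q.2) :=
        ((hΦ.comp (by fun_prop)).indicator (measurableSet_le (by fun_prop) (by fun_prop))).comp
          (measurable_fst.prodMk (measurable_minSplit.comp measurable_snd))
      exact this.lintegral_prod_right'
    simp_rw [key]
    rw [lintegral_add_left hc]
    congr 1
    · congr 1; ext x
      have e1 : ∀ v, ({t | MinAt t} ∩ {t | t.1.length + t.2.2.length = k + 1}).indicator Φ
          (([] : Word), x, v) = {w : Word | w.length = k + 1}.indicator
            (fun v => {v : Word | ∀ y ∈ v, x.1 ≤ y.1}.indicator (fun v => Φ ([], x, v)) v) v := by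
        intro v
        simp only [Set.indicator_apply, MinAt, Set.mem_inter_iff, Set.mem_ofPred_eq,
          List.not_mem_nil, false_imp_iff, implies_true, true_and, List.length_nil, zero_add]
        by_cases h : v.length = k + 1 <;> by_cases h' : ∀ y ∈ v, x.1 ≤ y.1 <;> simp [h]
      simp_rw [e1]
      rw [lintegral_freeMeasure_length]
      refine lintegral_congr_ae ?_
      filter_upwards [ae_powMeasure_length ν (k + 1)] with w hw
      have hw0 : w ≠ [] := by rintro rfl; simp at hw
      obtain ⟨hs, hs1, hs2⟩ := minSplit_spec hw0
      simp only [Set.indicator_apply, Set.mem_ofPred_eq]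
      rw [← hs]
      congr 1
      refine propext ⟨fun h y hy => ?_, fun h => h _ ?_⟩
      · rw [hs] at hy
        simp only [List.mem_append, List.mem_cons] at hy
        rcases hy with hy | rfl | hy
        · exact h.trans (hs1 y hy).le
        · exact h
        · exact h.trans (hs2 y hy)
      · exact minSplit_mem hw0
    · congr 1; ext x
      rw [ih (hB x)]
      congr 1; ext u; congr 1; ext a; congr 1; ext v
      have : (MinAt (u, a, v) ∧ a.1 < x.1 ∧ u.length + v.length = k) ↔
          (MinAt (x :: u, a, v) ∧ u.length + 1 + v.length = k + 1) := by
        simp only [MinAt, List.mem_cons, forall_eq_or_imp]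
        constructor
        · rintro ⟨⟨h1, h2⟩, h3, h4⟩; exact ⟨⟨⟨h3, h1⟩, h2⟩, by omega⟩
        · rintro ⟨⟨⟨h3, h1⟩, h2⟩, h4⟩; exact ⟨⟨h1, h2⟩, h3, by omega⟩
      simp only [Set.indicator_apply, Set.mem_inter_iff, Set.mem_ofPred_eq, List.length_cons,
        ← this]
      by_cases h1 : MinAt (u, a, v) <;> by_cases h2 : a.1 < x.1 <;>
        by_cases h3 : u.length + v.length = k <;> simp [h1, h2, h3]

/-- Putting a letter between two words carries the product of the three measures to words with a
marked position, and `MinAt` selects one position in each nonempty word. The version for fixed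
length is summed over the lengths. -/
theorem lintegral_freeMeasure_minSplit {Φ : Word × Letter × Word → ℝ≥0∞} (hΦ : Measurable Φ) :
    ∫⁻ w, {w | w ≠ []}.indicator (fun w => Φ (minSplit w)) w ∂freeMeasure ν =
      ∫⁻ u, ∫⁻ a, ∫⁻ v, {t | MinAt t}.indicator Φ (u, a, v) ∂freeMeasure ν ∂ν ∂freeMeasure ν := by
  classical
  have hL (k : ℕ) : MeasurableSet
      ({t : Word × Letter × Word | MinAt t} ∩ {t | t.1.length + t.2.2.length = k}) := by
    refine measurableSet_minAt.inter ?_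
    exact measurableSet_eq_fun ((measurable_list_length.comp measurable_fst).add
      (measurable_list_length.comp (measurable_snd.comp measurable_snd))) measurable_const
  have h3 (k : ℕ) : Measurable fun p : (Word × Letter) × Word =>
        ({t | MinAt t} ∩ {t | t.1.length + t.2.2.length = k}).indicator Φ (p.1.1, p.1.2, p.2) :=
      (hΦ.indicator (hL k)).comp (by fun_prop)
  have h1 : ∀ t, {t | MinAt t}.indicator Φ t =
      ∑' k, ({t | MinAt t} ∩ {t | t.1.length + t.2.2.length = k}).indicator Φ t := by
    intro t
    rw [tsum_eq_single (t.1.length + t.2.2.length)]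
    · simp [Set.indicator_apply]
    · intro k hk
      rw [Set.indicator_of_notMem]
      simp [hk.symm]
  simp_rw [h1]
  rw [lintegral_freeMeasure, tsum_eq_zero_add' ENNReal.summable]
  have h0 : ∫⁻ w, {w | w ≠ []}.indicator (fun w => Φ (minSplit w)) w ∂powMeasure ν 0 = 0 := by
    have : Measurable fun w : Word => {w : Word | w ≠ []}.indicator (fun w => Φ (minSplit w)) w :=
      (hΦ.comp measurable_minSplit).indicator measurableSet_list_nil.compl
    rw [powMeasure, lintegral_dirac' _ this]
    simp
  have h2 : ∀ k, ∫⁻ w, {w | w ≠ []}.indicator (fun w => Φ (minSplit w)) w ∂powMeasure ν (k + 1) =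
      ∫⁻ w, Φ (minSplit w) ∂powMeasure ν (k + 1) := by
    intro k
    refine lintegral_congr_ae ?_
    filter_upwards [ae_powMeasure_length ν (k + 1)] with w hw
    rw [Set.indicator_of_mem]
    rintro rfl; simp at hw
  simp_rw [h0, h2, lintegral_powMeasure_minSplit ν _ hΦ, zero_add]
  rw [← lintegral_tsum fun k => (h3 k).lintegral_prod_right'.lintegral_prod_right'.aemeasurable]
  congr 1; ext u
  have h4 (k : ℕ) : Measurable fun p : Letter × Word =>
      ({t | MinAt t} ∩ {t | t.1.length + t.2.2.length = k}).indicator Φ (u, p.1, p.2) :=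
    (hΦ.indicator (hL k)).comp (by fun_prop)
  rw [← lintegral_tsum fun k => (h4 k).lintegral_prod_right'.aemeasurable]
  congr 1; ext a
  have h5 (k : ℕ) : Measurable fun v : Word =>
      ({t | MinAt t} ∩ {t | t.1.length + t.2.2.length = k}).indicator Φ (u, a, v) :=
    (hΦ.indicator (hL k)).comp (by fun_prop)
  rw [← lintegral_tsum fun k => (h5 k).aemeasurable]

end MinSplit

/-! ### The density of an excursion

An excursion is encoded by a word: table by table, from left to right, the letter `(l, m)` records
that the table size becomes `m` at level `l`; after the size `0` has been reached, the next letter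
is `(l, 1)`, where `l` is the birth level of the next table. -/

section Weight

/-- Lowering all letters of a word by `t`. -/
def shiftWord (t : ℝ) (w : Word) : Word := w.map fun x => (x.1 - t, x.2)

/-- The product of Lebesgue measure on positive levels and of counting measure on sizes. -/
noncomputable def letterMeasure : Measure Letter :=
  (volume.restrict (Set.Ioi 0)).prod Measure.count

instance : SFinite letterMeasure := by unfold letterMeasure; infer_instance

theorem lintegral_letterMeasure {f : Letter → ℝ≥0∞} (hf : Measurable f) :
    ∫⁻ a, f a ∂letterMeasure = ∫⁻ t in Set.Ioi 0, ∑' m, f (t, m) := by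
  rw [letterMeasure, lintegral_prod _ hf.aemeasurable]
  simp_rw [lintegral_count]

theorem measurable_shiftWord : Measurable fun p : ℝ × Word => shiftWord p.1 p.2 :=
  Measurable.list_map (f := fun (p : ℝ × Word) (x : Letter) => (x.1 - p.1, x.2)) (by fun_prop)
    measurable_snd

@[fun_prop]
theorem Measurable.shiftWord {β : Type*} [MeasurableSpace β] {f : β → ℝ} {g : β → Word}
    (hf : Measurable f) (hg : Measurable g) : Measurable fun b => shiftWord (f b) (g b) :=
  measurable_shiftWord.comp (hf.prodMk hg)

@[simp] theorem shiftWord_nil (t : ℝ) : shiftWord t [] = [] := rfl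

@[simp] theorem shiftWord_cons (t : ℝ) (x : Letter) (w : Word) :
    shiftWord t (x :: w) = (x.1 - t, x.2) :: shiftWord t w := rfl

theorem measurableSet_forall_lt (t : ℝ) : MeasurableSet {w : Word | ∀ x ∈ w, t < x.1} :=
  measurableSet_list_forall_mem (s := {x : Letter | t < x.1})
    (measurableSet_lt measurable_const measurable_fst)

theorem measurableSet_forall_le (t : ℝ) : MeasurableSet {w : Word | ∀ x ∈ w, t ≤ x.1} :=
  measurableSet_list_forall_mem (s := {x : Letter | t ≤ x.1})
    (measurableSet_le measurable_const measurable_fst)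

theorem lintegral_Ioi_shift {t : ℝ} (f : ℝ → ℝ≥0∞) :
    ∫⁻ x in Set.Ioi t, f (x - t) = ∫⁻ x in Set.Ioi 0, f x := by
  rw [← lintegral_indicator measurableSet_Ioi, ← lintegral_indicator measurableSet_Ioi,
    ← lintegral_sub_right_eq_self ((Set.Ioi 0).indicator f) t]
  congr 1; ext x
  simp [Set.indicator_apply]

/-- Lebesgue measure on levels above `t` becomes Lebesgue measure on positive levels after
translation; this is applied letter by letter. -/
theorem lintegral_shiftWord {t : ℝ} (ht : 0 ≤ t) {F : Word → ℝ≥0∞} (hF : Measurable F) :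
    ∫⁻ w, {w : Word | ∀ x ∈ w, t < x.1}.indicator (fun w => F (shiftWord t w)) w
      ∂freeMeasure letterMeasure = ∫⁻ w, F w ∂freeMeasure letterMeasure := by
  have hs : MeasurableSet {x : Letter | t < x.1} := measurableSet_lt measurable_const measurable_fst
  refine lintegral_freeMeasure_map letterMeasure hs (φ := fun x => (x.1 - t, x.2)) (by fun_prop)
    (fun f hf => ?_) hF
  have hf' : Measurable fun x : Letter =>
      {x : Letter | t < x.1}.indicator (fun x => f (x.1 - t, x.2)) x :=
    (hf.comp (by fun_prop)).indicator hs
  rw [lintegral_letterMeasure hf, lintegral_letterMeasure hf', 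
    ← lintegral_Ioi_shift (t := t) (fun s => ∑' m, f (s, m)),
    ← lintegral_indicator measurableSet_Ioi, ← lintegral_indicator measurableSet_Ioi]
  congr 1; ext x
  by_cases hx : t < x
  · have : 0 < x := ht.trans_lt hx
    simp [Set.indicator_apply, hx, this]
  · simp [Set.indicator_apply, hx]

theorem ae_forall_ne (t : ℝ) :
    ∀ᵐ w ∂freeMeasure letterMeasure, ∀ x ∈ w, x.1 ≠ t := by
  refine ae_freeMeasure_forall letterMeasure (s := {x : Letter | x.1 ≠ t}) ?_ ?_
  · exact (measurableSet_eq_fun measurable_fst measurable_const).compl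
  · have h : ∀ᵐ x : ℝ ∂volume.restrict (Set.Ioi 0), x ≠ t := ae_restrict_of_ae (by simp [ae_iff])
    exact Measure.quasiMeasurePreserving_fst.ae h

theorem ae_forall_pos : ∀ᵐ w ∂freeMeasure letterMeasure, ∀ x ∈ w, 0 < x.1 := by
  refine ae_freeMeasure_forall letterMeasure (s := {x : Letter | 0 < x.1}) ?_ ?_
  · exact measurableSet_lt measurable_const measurable_fst
  · have h : ∀ᵐ x : ℝ ∂volume.restrict (Set.Ioi 0), 0 < x := ae_restrict_mem measurableSet_Ioi
    exact Measure.quasiMeasurePreserving_fst.ae h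

/-- Letters at the exact level `t` form a null set. The weak inequality is the one that `MinAt`
imposes on the word behind the minimum. -/
theorem lintegral_shiftWord' {t : ℝ} (ht : 0 ≤ t) {F : Word → ℝ≥0∞} (hF : Measurable F) :
    ∫⁻ w, {w : Word | ∀ x ∈ w, t ≤ x.1}.indicator (fun w => F (shiftWord t w)) w
      ∂freeMeasure letterMeasure = ∫⁻ w, F w ∂freeMeasure letterMeasure := by
  classical
  rw [← lintegral_shiftWord ht hF]
  refine lintegral_congr_ae ?_
  filter_upwards [ae_forall_ne t] with w hw
  have : (∀ x ∈ w, t ≤ x.1) ↔ ∀ x ∈ w, t < x.1 :=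
    ⟨fun h x hx => (h x hx).lt_of_ne (hw x hx).symm, fun h x hx => (h x hx).le⟩
  simp only [Set.indicator_apply, Set.mem_ofPred_eq, this]

variable (α : ℝ)

/-- The contribution of the letter `(l, m)` to the density, after size `n` at level `s`. -/
noncomputable def stepWeight (n : ℕ) (s : ℝ) (l : ℝ) (m : ℕ) : ℝ≥0∞ :=
  if n = 0 then (if m = 1 ∧ l < s then ENNReal.ofReal α else 0)
  -- The exponent has `2 * n` where the total rate of the table is `2 * n - α`. The extra `α` is
  -- borrowed from the descents, whose total length equals that of the ascents.
  else if s < l then ENNReal.ofReal (Real.exp (-(2 * n * (l - s)))) *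
    ENNReal.ofReal (tableRate α n m) else 0

/-- The density of the word of an excursion, starting with table size `n` at level `s`. -/
noncomputable def weight : ℕ → ℝ → Word → ℝ≥0∞
  | n, _, [] => if n = 0 then 1 else 0
  | n, s, x :: w => stepWeight α n s x.1 x.2 * weight x.2 x.1 w

theorem measurable_stepWeight :
    Measurable fun q : (ℕ × ℝ) × Letter => stepWeight α q.1.1 q.1.2 q.2.1 q.2.2 := by
  have h : ∀ n m : ℕ, Measurable fun p : ℝ × ℝ => stepWeight α n p.1 p.2 m := by
    intro n m
    unfold stepWeight
    refine Measurable.ite (.const _) (Measurable.ite ?_ (by fun_prop) (by fun_prop))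
      (Measurable.ite ?_ (by fun_prop) (by fun_prop))
    · exact (MeasurableSet.const _).inter (measurableSet_lt measurable_snd measurable_fst)
    · exact measurableSet_lt measurable_fst measurable_snd
  have h1 : Measurable fun p : (ℝ × ℝ) × (ℕ × ℕ) => stepWeight α p.2.1 p.1.1 p.1.2 p.2.2 :=
    measurable_from_prod_countable_left fun q => h q.1 q.2
  exact h1.comp (f := fun q : (ℕ × ℝ) × Letter => ((q.1.2, q.2.1), (q.1.1, q.2.2))) (by fun_prop)

theorem measurable_weight : Measurable fun p : (ℕ × ℝ) × Word => weight α p.1.1 p.1.2 p.2 := by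
  refine measurable_list_rec (F := fun b w => weight α b.1 b.2 w) (fun _ x => (x.2, x.1))
    (fun q => stepWeight α q.1.1 q.1.2 q.2.1.1 q.2.1.2 * q.2.2.2) (by fun_prop) ?_ ?_ ?_
  · refine Measurable.mul ?_ (by fun_prop)
    exact (measurable_stepWeight α).comp
      (f := fun q : (ℕ × ℝ) × Letter × Word × ℝ≥0∞ => (q.1, q.2.1)) (by fun_prop)
  · have : Measurable fun n : ℕ => (if n = 0 then 1 else 0 : ℝ≥0∞) := measurable_of_countable _
    simp only [weight]
    exact this.comp measurable_fst
  · intro b a l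
    rfl

@[fun_prop]
theorem Measurable.weight {β : Type*} [MeasurableSpace β] {f : β → ℕ} {g : β → ℝ} {h : β → Word}
    (hf : Measurable f) (hg : Measurable g) (hh : Measurable h) :
    Measurable fun b => weight α (f b) (g b) (h b) :=
  (measurable_weight α).comp ((hf.prodMk hg).prodMk hh)

theorem stepWeight_shift (n : ℕ) (s l b : ℝ) (m : ℕ) :
    stepWeight α n (s - b) (l - b) m = stepWeight α n s l m := by
  simp [stepWeight]

theorem weight_shift (n : ℕ) (s b : ℝ) (w : Word) :
    weight α n (s - b) (shiftWord b w) = weight α n s w := by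
  induction w generalizing n s with
  | nil => rfl
  | cons x w ih => simp [weight, stepWeight_shift, ih]

/-- Only the first step sees the starting level. Raising that level from `0` to `b` changes its
exponential factor alone, which is the loss of memory of the density. -/
theorem weight_zero_shift {n : ℕ} (hn : n ≠ 0) {b : ℝ} (hb : 0 ≤ b) {w : Word}
    (hw : ∀ x ∈ w, b < x.1) :
    weight α n 0 w = ENNReal.ofReal (Real.exp (-(2 * n * b))) * weight α n 0 (shiftWord b w) := by
  cases w with
  | nil => simp [weight, hn]
  | cons x w =>
    have hx := hw x (by simp)
    rw [shiftWord_cons, weight, weight, weight_shift, ← mul_assoc]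
    congr 1
    simp only [stepWeight, hn, if_false, hb.trans_lt hx, sub_pos, hx, if_true, ← mul_assoc]
    congr 1
    rw [← ENNReal.ofReal_mul (Real.exp_pos _).le, ← Real.exp_add]
    congr 2
    ring

/-- The letter `(b, m)` is below everything in front of it. It can therefore only be reached from
size `0`, by a birth with `m = 1` and factor `α`; the letters in front must form a completed
excursion, which is what the final factor of their own weight tests. -/
theorem weight_append (n : ℕ) {s b : ℝ} (hs : b < s) {u : Word} (hu : ∀ x ∈ u, b < x.1) (m : ℕ)
    (v : Word) : weight α n s (u ++ (b, m) :: v) =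
      weight α n s u * ((if m = 1 then ENNReal.ofReal α else 0) * weight α 1 b v) := by
  induction u generalizing n s with
  | nil =>
    by_cases hn : n = 0
    · by_cases hm : m = 1
      · subst hm; simp [weight, stepWeight, hn, hs]
      · simp [weight, stepWeight, hn, hm]
    · simp [weight, stepWeight, hn, hs.not_gt]
  | cons x u ih =>
    rw [List.cons_append, weight, weight, ih _ (hu x (by simp)) fun y hy => hu y (by simp [hy]),
      mul_assoc]

/-- The starting level `0` lies below `b`, so `weight_append` does not apply directly; it applies
after the first letter, which is above `b`. -/
theorem weight_append_root (n : ℕ) {b : ℝ} {u : Word} (hu0 : u ≠ [])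
    (hu : ∀ x ∈ u, b < x.1) (m : ℕ)
    (v : Word) : weight α n 0 (u ++ (b, m) :: v) =
      weight α n 0 u * ((if m = 1 then ENNReal.ofReal α else 0) * weight α 1 b v) := by
  cases u with
  | nil => exact absurd rfl hu0
  | cons x u =>
    rw [List.cons_append, weight, weight, weight_append α _ (hu x (by simp))
      fun y hy => hu y (by simp [hy]), mul_assoc]

/-- The lowest level, the part of the word to the left of the lowest letter, its size and the part
to the right, where levels are taken relative to the lowest one. -/
noncomputable def relSplit (t : Word × Letter × Word) : ℝ × Word × ℕ × Word :=
  (t.2.1.1, shiftWord t.2.1.1 t.1, t.2.1.2, shiftWord t.2.1.1 t.2.2)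

theorem measurable_relSplit : Measurable relSplit := by unfold relSplit; fun_prop

/-- Decomposition of the excursion measure at the lowest letter. -/
theorem lintegral_relSplit {n : ℕ} (hn : n ≠ 0) {Ψ : ℝ × Word × ℕ × Word → ℝ≥0∞}
    (hΨ : Measurable Ψ) :
    ∫⁻ w, Ψ (relSplit (minSplit w)) * weight α n 0 w ∂freeMeasure letterMeasure =
      ∫⁻ b in Set.Ioi 0, ENNReal.ofReal (Real.exp (-(2 * n * b))) *
        ((∑' m, ENNReal.ofReal (tableRate α n m) *
          ∫⁻ v, Ψ (b, [], m, v) * weight α m 0 v ∂freeMeasure letterMeasure) +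
        ENNReal.ofReal α * ∫⁻ u, (∫⁻ v, Ψ (b, u, 1, v) * weight α 1 0 v ∂freeMeasure letterMeasure) *
          weight α n 0 u ∂freeMeasure letterMeasure) := by
  classical
  set N := freeMeasure letterMeasure with hN
  set Φ : Word × Letter × Word → ℝ≥0∞ := fun t =>
    Ψ (relSplit t) * weight α n 0 (t.1 ++ t.2.1 :: t.2.2) with hΦ
  have hΦm : Measurable Φ := (hΨ.comp measurable_relSplit).mul (by fun_prop)
  have e1 : ∀ w, Ψ (relSplit (minSplit w)) * weight α n 0 w =
      {w | w ≠ []}.indicator (fun w => Φ (minSplit w)) w := by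
    intro w
    by_cases hw : w = []
    · simp [hw, weight, hn]
    · rw [Set.indicator_of_mem hw, hΦ]
      simp only
      rw [← (minSplit_spec hw).1]
  simp_rw [e1]
  rw [lintegral_freeMeasure_minSplit _ hΦm]
  -- `T1` collects the case that the lowest letter is the first jump of the root table, `T2` the
  -- case of a birth. In `T2` the empty front word need not be excluded, since its weight is zero
  -- for `n ≠ 0`.
  set T1 : Word × Letter × Word → ℝ≥0∞ := fun t => {t | t.1 = []}.indicator
    ({t | MinAt t}.indicator Φ) t with hT1
  set T2 : Word × Letter × Word → ℝ≥0∞ := fun t => {t | MinAt t}.indicator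
    (fun t => Ψ (relSplit t) * (weight α n 0 t.1 *
      ((if t.2.1.2 = 1 then ENNReal.ofReal α else 0) * weight α 1 t.2.1.1 t.2.2))) t with hT2
  have hT1m : Measurable T1 := (hΦm.indicator measurableSet_minAt).indicator
    (measurable_fst measurableSet_list_nil)
  have hif : Measurable fun m : ℕ => (if m = 1 then ENNReal.ofReal α else 0) :=
    measurable_of_countable _
  have hT2m : Measurable T2 := by
    refine Measurable.indicator ?_ measurableSet_minAt
    exact (hΨ.comp measurable_relSplit).mul ((by fun_prop : Measurable _).mul
      ((hif.comp (by fun_prop)).mul (by fun_prop)))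
  have e2 : ∀ t, {t | MinAt t}.indicator Φ t = T1 t + T2 t := by
    rintro ⟨u, ⟨b, m⟩, v⟩
    by_cases hm : MinAt (u, (b, m), v)
    · by_cases hu : u = []
      · subst hu
        simp [hT1, hT2, hm, weight, hn, Set.indicator_apply]
      · have := weight_append_root α n hu hm.1 m v
        simp only at this
        simp [hT1, hT2, hm, Set.indicator_apply, hu, hΦ, this]
    · simp [hT1, hT2, hm, Set.indicator_apply]
  have hswap : Measurable fun p : Letter × Word => ∫⁻ v, T2 (p.2, p.1, v) ∂N := by
    have : Measurable fun p : (Letter × Word) × Word => T2 (p.1.2, p.1.1, p.2) :=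
      hT2m.comp (by fun_prop)
    exact this.lintegral_prod_right'
  have hT1' (u : Word) (a : Letter) : Measurable fun v => T1 (u, a, v) :=
    hT1m.comp (by fun_prop)
  have hT1'' : Measurable fun p : Word × Letter => ∫⁻ v, T1 (p.1, p.2, v) ∂N := by
    have : Measurable fun p : (Word × Letter) × Word => T1 (p.1.1, p.1.2, p.2) :=
      hT1m.comp (by fun_prop)
    exact this.lintegral_prod_right'
  have e3 : ∫⁻ u, ∫⁻ a, ∫⁻ v, {t | MinAt t}.indicator Φ (u, a, v) ∂N ∂letterMeasure ∂N =
      (∫⁻ a, ∫⁻ v, T1 ([], a, v) ∂N ∂letterMeasure) +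
        ∫⁻ a, ∫⁻ u, ∫⁻ v, T2 (u, a, v) ∂N ∂N ∂letterMeasure := by
    simp_rw [e2]
    rw [lintegral_lintegral_swap (f := fun a u => ∫⁻ v, T2 (u, a, v) ∂N) hswap.aemeasurable]
    have : ∀ u, ∫⁻ a, ∫⁻ v, T1 (u, a, v) + T2 (u, a, v) ∂N ∂letterMeasure =
        (∫⁻ a, ∫⁻ v, T1 (u, a, v) ∂N ∂letterMeasure) +
          ∫⁻ a, ∫⁻ v, T2 (u, a, v) ∂N ∂letterMeasure := by
      intro u
      simp_rw [fun a => lintegral_add_left (μ := N) (hT1' u a) fun v => T2 (u, a, v)]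
      rw [lintegral_add_left]
      exact hT1''.comp (measurable_prodMk_left)
    simp_rw [this]
    rw [lintegral_add_left hT1''.lintegral_prod_right',
      lintegral_freeMeasure_cons _ hT1''.lintegral_prod_right']
    have z : ∀ x u a v, T1 (x :: u, a, v) = 0 := by
      intro x u a v
      simp [hT1]
    simp [z]
  have hT1n : Measurable fun a => ∫⁻ v, T1 ([], a, v) ∂N := hT1''.comp measurable_prodMk_left
  rw [e3, lintegral_letterMeasure hT1n, lintegral_letterMeasure hswap.lintegral_prod_right', ← lintegral_add_left]
  swap
  · exact Measurable.tsum fun m => hT1n.comp (by fun_prop)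
  refine setLIntegral_congr_fun measurableSet_Ioi fun b hb => ?_
  have hb : (0 : ℝ) < b := hb
  simp only
  rw [mul_add]
  congr 1
  · rw [← ENNReal.tsum_mul_left]
    congr 1; ext m
    have hF : Measurable fun v => Ψ (b, [], m, v) * weight α m 0 v :=
      (hΨ.comp (by fun_prop)).mul (by fun_prop)
    rw [← mul_assoc, ← lintegral_shiftWord' hb.le hF, ← lintegral_const_mul]
    · congr 1; ext v
      simp only [hT1, hΦ, Set.indicator_apply, MinAt, Set.mem_ofPred_eq, List.not_mem_nil,
        false_imp_iff, implies_true, true_and, if_true, relSplit, shiftWord_nil, List.nil_append]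
      split_ifs with h
      · rw [weight, stepWeight, if_neg hn, if_pos hb, ← weight_shift α m b b, sub_self, sub_zero]
        ring
      · simp
    · have : Measurable fun w => Ψ (b, [], m, shiftWord b w) * weight α m 0 (shiftWord b w) :=
        hF.comp (by fun_prop)
      exact this.indicator (measurableSet_forall_le b)
  -- Tables are born with size one, so the sum over sizes has a single term.
  · rw [tsum_eq_single 1]
    · have hG : Measurable fun p : Word × Word => Ψ (b, p.1, 1, p.2) * weight α 1 0 p.2 :=
        (hΨ.comp (by fun_prop)).mul (by fun_prop)
      have hG' : Measurable fun u => ∫⁻ v, Ψ (b, u, 1, v) * weight α 1 0 v ∂N :=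
        hG.lintegral_prod_right'
      have hH : Measurable fun u => (∫⁻ v, Ψ (b, u, 1, v) * weight α 1 0 v ∂N) *
          weight α n 0 u := hG'.mul (by fun_prop)
      rw [← mul_assoc, ← lintegral_shiftWord hb.le hH, ← lintegral_const_mul]
      · congr 1; ext u
        by_cases hu : ∀ x ∈ u, b < x.1
        · have hu' : u ∈ {w : Word | ∀ x ∈ w, b < x.1} := hu
          have hG2 : Measurable fun v => Ψ (b, shiftWord b u, 1, v) * weight α 1 0 v :=
            hG.comp measurable_prodMk_left
          have hG3 : Measurable fun v =>
              Ψ (b, shiftWord b u, 1, shiftWord b v) * weight α 1 0 (shiftWord b v) :=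
            hG2.comp (by fun_prop)
          rw [Set.indicator_of_mem hu', ← lintegral_shiftWord' hb.le hG2, ← lintegral_mul_const, ← lintegral_const_mul]
          · congr 1; ext v
            simp only [hT2, Set.indicator_apply, MinAt, Set.mem_ofPred_eq, relSplit, if_true]
            have : (∀ x ∈ u, b < x.1) ∧ (∀ x ∈ v, b ≤ x.1) ↔ (∀ x ∈ v, b ≤ x.1) := by tauto
            simp only [this]
            split_ifs with h
            · rw [weight_zero_shift α hn hb.le hu, ← weight_shift α 1 b b, sub_self]
              ring
            · simp
          · exact (hG3.indicator (measurableSet_forall_le b)).mul_const _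
          · exact hG3.indicator (measurableSet_forall_le b)
        · have hu' : u ∉ {w : Word | ∀ x ∈ w, b < x.1} := hu
          have z : ∀ v, T2 (u, (b, 1), v) = 0 := fun v =>
            Set.indicator_of_notMem (fun h => hu h.1) _
          rw [Set.indicator_of_notMem hu']
          simp only [z, lintegral_zero, mul_zero]
      · have : Measurable fun w => (∫⁻ v, Ψ (b, shiftWord b w, 1, v) * weight α 1 0 v ∂N) *
          weight α n 0 (shiftWord b w) := hH.comp (by fun_prop)
        exact this.indicator (measurableSet_forall_lt b)
    · intro m hm
      have z : ∀ u v, T2 (u, (b, m), v) = 0 := by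
        intro u v
        simp [hT2, Set.indicator_apply, hm]
      simp [z]

end Weight

/-! ### The excursion law and its loss of memory -/

section ExcursionLaw

/-- The law of the word of an excursion that starts with table size `n`. -/
noncomputable def excursionLaw (α : ℝ) (n : ℕ) : Measure Word :=
  (freeMeasure letterMeasure).withDensity (weight α n 0)

variable {α : ℝ}

theorem measurable_weight_word (n : ℕ) (s : ℝ) : Measurable (weight α n s) := by
  have : Measurable fun w => weight α n s w := by fun_prop
  exact this

theorem lintegral_excursionLaw (n : ℕ) {F : Word → ℝ≥0∞} (hF : Measurable F) :
    ∫⁻ w, F w ∂excursionLaw α n = ∫⁻ w, F w * weight α n 0 w ∂freeMeasure letterMeasure := by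
  rw [excursionLaw, lintegral_withDensity_eq_lintegral_mul _ (measurable_weight_word n 0) hF]
  simp [mul_comm]

theorem ae_excursionLaw_of_ae {n : ℕ} {p : Word → Prop}
    (h : ∀ᵐ w ∂freeMeasure letterMeasure, p w) : ∀ᵐ w ∂excursionLaw α n, p w :=
  (withDensity_absolutelyContinuous _ _).ae_le h

theorem ae_excursionLaw_weight_ne_zero (n : ℕ) : ∀ᵐ w ∂excursionLaw α n, weight α n 0 w ≠ 0 := by
  have hm := measurable_weight_word (α := α) n 0
  rw [excursionLaw, ae_withDensity_iff hm]
  exact Filter.Eventually.of_forall fun w hw => hw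

/-- After size `0` at level `0` the next birth would have to take place at a negative level, so
every nonempty word has weight zero almost everywhere. -/
theorem excursionLaw_zero : excursionLaw α 0 = Measure.dirac [] := by
  ext s hs
  have hm : Measurable (s.indicator (1 : Word → ℝ≥0∞)) := measurable_one.indicator hs
  rw [← lintegral_indicator_one hs, lintegral_excursionLaw _ hm, ← lintegral_indicator_one hs,
    lintegral_dirac' _ hm, lintegral_freeMeasure_cons _ (by fun_prop)]
  have : ∀ᵐ a ∂letterMeasure, ∫⁻ w, s.indicator (1 : Word → ℝ≥0∞) (a :: w) * weight α 0 0 (a :: w)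
      ∂freeMeasure letterMeasure = 0 := by
    have h : ∀ᵐ x : ℝ ∂volume.restrict (Set.Ioi 0), 0 < x := ae_restrict_mem measurableSet_Ioi
    filter_upwards [(Measure.quasiMeasurePreserving_fst.ae h : ∀ᵐ a ∂letterMeasure, 0 < a.1)]
      with a ha
    simp [weight, stepWeight, ha.not_gt]
  rw [lintegral_congr_ae this]
  simp [weight]

/-- The lowest level of a word. -/
noncomputable def wordClock (w : Word) : ℝ≥0∞ :=
  if w = [] then ∞ else ENNReal.ofReal (minSplit w).2.1.1

theorem measurable_wordClock : Measurable wordClock := by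
  refine Measurable.ite measurableSet_list_nil measurable_const ?_
  have := measurable_minSplit
  fun_prop

theorem ofReal_lt_wordClock {t : ℝ} (ht : 0 ≤ t) (w : Word) :
    ENNReal.ofReal t < wordClock w ↔ ∀ x ∈ w, t < x.1 := by
  unfold wordClock
  split_ifs with hw
  · simp [hw]
  · obtain ⟨h1, h2, h3⟩ := minSplit_spec hw
    rw [ENNReal.ofReal_lt_ofReal_iff_of_nonneg ht]
    refine ⟨fun h x hx => ?_, fun h => h _ (minSplit_mem hw)⟩
    rw [h1] at hx
    simp only [List.mem_append, List.mem_cons] at hx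
    rcases hx with hx | rfl | hx
    · exact h.trans (h2 x hx)
    · exact h
    · exact h.trans_le (h3 x hx)

theorem ofReal_le_wordClock {t : ℝ} {w : Word} (hw0 : ∀ x ∈ w, 0 < x.1) :
    ENNReal.ofReal t ≤ wordClock w ↔ ∀ x ∈ w, t ≤ x.1 := by
  unfold wordClock
  split_ifs with hw
  · simp [hw]
  · obtain ⟨h1, h2, h3⟩ := minSplit_spec hw
    rw [ENNReal.ofReal_le_ofReal_iff (hw0 _ (minSplit_mem hw)).le]
    refine ⟨fun h x hx => ?_, fun h => h _ (minSplit_mem hw)⟩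
    rw [h1] at hx
    simp only [List.mem_append, List.mem_cons] at hx
    rcases hx with hx | rfl | hx
    · exact h.trans (h2 x hx).le
    · exact h
    · exact h.trans (h3 x hx)

/-- Loss of memory: without an event up to level `t`, what lies above `t` is again an excursion from
the same size. The two ingredients are translation invariance of the levels and `weight_zero_shift`.
-/
theorem lintegral_excursionLaw_lt_clock {n : ℕ} (hn : n ≠ 0) {t : ℝ} (ht : 0 ≤ t)
    {F : Word → ℝ≥0∞} (hF : Measurable F) :
    ∫⁻ w, {w | ENNReal.ofReal t < wordClock w}.indicator (fun w => F (shiftWord t w)) w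
      ∂excursionLaw α n = ENNReal.ofReal (Real.exp (-(2 * n * t))) * ∫⁻ w, F w ∂excursionLaw α n := by
  have hF' : Measurable fun w => F (shiftWord t w) := hF.comp (by fun_prop)
  have hm := measurableSet_lt (measurable_const (a := ENNReal.ofReal t)) measurable_wordClock
  have hFw : Measurable fun w => F w * weight α n 0 w := hF.mul (by fun_prop)
  have hFw' : Measurable fun w => F (shiftWord t w) * weight α n 0 (shiftWord t w) :=
    hF'.mul (by fun_prop)
  rw [lintegral_excursionLaw _ (hF'.indicator hm), lintegral_excursionLaw _ hF,
    ← lintegral_shiftWord ht hFw, ← lintegral_const_mul _ (hFw'.indicator (measurableSet_forall_lt t))]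
  congr 1; ext w
  by_cases h : ∀ x ∈ w, t < x.1
  · have h1 : w ∈ {w | ENNReal.ofReal t < wordClock w} := (ofReal_lt_wordClock ht w).2 h
    have h2 : w ∈ {w : Word | ∀ x ∈ w, t < x.1} := h
    rw [Set.indicator_of_mem h1, Set.indicator_of_mem h2, weight_zero_shift α hn ht h]
    ring
  · have h1 : w ∉ {w | ENNReal.ofReal t < wordClock w} := fun h' => h ((ofReal_lt_wordClock ht w).1 h')
    have h2 : w ∉ {w : Word | ∀ x ∈ w, t < x.1} := h
    rw [Set.indicator_of_notMem h1, Set.indicator_of_notMem h2]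
    simp

/-- It differs from the strict version by a null event. The weak form is needed because `forestNext`
resolves a tie in favour of the later trees. -/
theorem lintegral_excursionLaw_le_clock {n : ℕ} (hn : n ≠ 0) {t : ℝ} (ht : 0 ≤ t)
    {F : Word → ℝ≥0∞} (hF : Measurable F) :
    ∫⁻ w, {w | ENNReal.ofReal t ≤ wordClock w}.indicator (fun w => F (shiftWord t w)) w
      ∂excursionLaw α n = ENNReal.ofReal (Real.exp (-(2 * n * t))) * ∫⁻ w, F w ∂excursionLaw α n := by
  classical
  rw [← lintegral_excursionLaw_lt_clock hn ht hF]
  refine lintegral_congr_ae ?_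
  filter_upwards [ae_excursionLaw_of_ae (ae_forall_ne t), ae_excursionLaw_of_ae ae_forall_pos]
    with w hw hw0
  have : ENNReal.ofReal t ≤ wordClock w ↔ ENNReal.ofReal t < wordClock w := by
    rw [ofReal_lt_wordClock ht, ofReal_le_wordClock hw0]
    exact ⟨fun h x hx => (h x hx).lt_of_ne (hw x hx).symm, fun h x hx => (h x hx).le⟩
  simp only [Set.indicator_apply, Set.mem_ofPred_eq, this]

end ExcursionLaw

/-! ### Transitions of compositions -/

section Transitions

/-- The transitions of a single table of size `n` and its children, as pairs of rates and targets. -/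
noncomputable def tableTransitions (α : ℝ) (n : ℕ+) : List (ℝ≥0∞ × List ℕ+) :=
  [(ENNReal.ofReal ((n : ℕ) - α), [n + 1]),
    (ENNReal.ofReal (n : ℕ), if n = 1 then [] else [n - 1]), (ENNReal.ofReal α, [n, 1])]

/-- The transitions of a composition, without immigration. -/
noncomputable def transitions (α : ℝ) : List ℕ+ → List (ℝ≥0∞ × List ℕ+)
  | [] => []
  | n :: c => (tableTransitions α n).map (fun p => (p.1, p.2 ++ c)) ++
      (transitions α c).map fun p => (p.1, n :: p.2)

/-- Summation of a function of the targets of a list of transitions against the rates. -/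
noncomputable def sumOver (L : List (ℝ≥0∞ × List ℕ+)) (g : List ℕ+ → ℝ≥0∞) : ℝ≥0∞ :=
  (L.map fun p => p.1 * g p.2).sum

@[simp] theorem sumOver_nil (g : List ℕ+ → ℝ≥0∞) : sumOver [] g = 0 := rfl

@[simp] theorem sumOver_cons (p : ℝ≥0∞ × List ℕ+) (L : List (ℝ≥0∞ × List ℕ+))
    (g : List ℕ+ → ℝ≥0∞) : sumOver (p :: L) g = p.1 * g p.2 + sumOver L g := by simp [sumOver]

@[simp] theorem sumOver_append (L L' : List (ℝ≥0∞ × List ℕ+)) (g : List ℕ+ → ℝ≥0∞) :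
    sumOver (L ++ L') g = sumOver L g + sumOver L' g := by simp [sumOver]

@[simp] theorem sumOver_map (L : List (ℝ≥0∞ × List ℕ+)) (φ : List ℕ+ → List ℕ+)
    (g : List ℕ+ → ℝ≥0∞) :
    sumOver (L.map fun p => (p.1, φ p.2)) g = sumOver L fun c => g (φ c) := by
  simp [sumOver, Function.comp_def]

theorem sumOver_const_mul (L : List (ℝ≥0∞ × List ℕ+)) (r : ℝ≥0∞) (g : List ℕ+ → ℝ≥0∞) :
    sumOver L (fun c => r * g c) = r * sumOver L g := by
  induction L with
  | nil => simp
  | cons p L ih => simp only [sumOver_cons, ih]; ring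

theorem sumOver_mono {L : List (ℝ≥0∞ × List ℕ+)} {g g' : List ℕ+ → ℝ≥0∞}
    (h : ∀ p ∈ L, g p.2 ≤ g' p.2) : sumOver L g ≤ sumOver L g' := by
  induction L with
  | nil => simp
  | cons p L ih =>
    simp only [sumOver_cons]
    gcongr
    · exact h p (by simp)
    · exact ih fun q hq => h q (by simp [hq])

theorem measurable_sumOver {β : Type*} [MeasurableSpace β] (L : List (ℝ≥0∞ × List ℕ+))
    {g : β → List ℕ+ → ℝ≥0∞} (hg : ∀ c, Measurable fun b => g b c) :
    Measurable fun b => sumOver L (g b) := by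
  induction L with
  | nil => simp
  | cons p L ih =>
    simp only [sumOver_cons]
    exact ((hg p.2).const_mul p.1).add ih

theorem lintegral_sumOver {β : Type*} [MeasurableSpace β] (μ : Measure β)
    (L : List (ℝ≥0∞ × List ℕ+)) {g : β → List ℕ+ → ℝ≥0∞} (hg : ∀ c, Measurable fun b => g b c) :
    ∫⁻ b, sumOver L (g b) ∂μ = sumOver L fun c => ∫⁻ b, g b c ∂μ := by
  induction L with
  | nil => simp
  | cons p L ih =>
    simp only [sumOver_cons]
    rw [lintegral_add_left ((hg p.2).const_mul p.1), lintegral_const_mul _ (hg p.2), ih]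

end Transitions

/-! ### Forests of excursions -/

section Forest

instance : MeasurableSpace ℕ+ := ⊤

instance : DiscreteMeasurableSpace ℕ+ := ⟨fun _ => trivial⟩

/-- The initial table size of an excursion and the word of the excursion. -/
abbrev Block : Type := ℕ+ × Word

instance (α : ℝ) (n : ℕ) : SFinite (excursionLaw α n) := by unfold excursionLaw; infer_instance

/-- The law of a list of independent excursions with initial table sizes given by a composition. -/
noncomputable def forestLaw (α : ℝ) : List ℕ+ → Measure (List Block)
  | [] => Measure.dirac []
  | n :: c => ((excursionLaw α n).prod (forestLaw α c)).map fun p => (n, p.1) :: p.2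

variable {α : ℝ}

instance (c : List ℕ+) : SFinite (forestLaw α c) := by
  induction c with
  | nil => unfold forestLaw; infer_instance
  | cons n c ih => unfold forestLaw; infer_instance

theorem lintegral_forestLaw_nil {F : List Block → ℝ≥0∞} (hF : Measurable F) :
    ∫⁻ x, F x ∂forestLaw α [] = F [] := by
  rw [forestLaw, lintegral_dirac' _ hF]

theorem lintegral_forestLaw_cons (n : ℕ+) (c : List ℕ+) {F : List Block → ℝ≥0∞}
    (hF : Measurable F) : ∫⁻ x, F x ∂forestLaw α (n :: c) =
      ∫⁻ w, ∫⁻ x, F ((n, w) :: x) ∂forestLaw α c ∂excursionLaw α n := by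
  rw [forestLaw, lintegral_map hF (by fun_prop), lintegral_prod _ (by fun_prop)]

theorem lintegral_forestLaw_append (c c' : List ℕ+) {F : List Block → ℝ≥0∞}
    (hF : Measurable F) : ∫⁻ x, F x ∂forestLaw α (c ++ c') =
      ∫⁻ x, ∫⁻ x', F (x ++ x') ∂forestLaw α c' ∂forestLaw α c := by
  induction c generalizing F with
  | nil =>
    rw [lintegral_forestLaw_nil]
    · simp
    · have : Measurable fun p : List Block × List Block => F (p.1 ++ p.2) := by fun_prop
      exact this.lintegral_prod_right'
  | cons n c ih =>
    have : Measurable fun p : List Block × List Block => F (p.1 ++ p.2) := by fun_prop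
    rw [List.cons_append, lintegral_forestLaw_cons _ _ hF,
      lintegral_forestLaw_cons _ _ this.lintegral_prod_right']
    congr 1; ext w
    rw [ih (by fun_prop)]
    simp

/-- The blocks that replace an excursion at its lowest letter. -/
noncomputable def splitBlocks (n : ℕ+) (t : Word × ℕ × Word) : List Block :=
  if t.1 = [] then (if t.2.1 = 0 then [] else [(t.2.1.toPNat', t.2.2)]) else [(n, t.1), (1, t.2.2)]

/-- The blocks that replace a block at its lowest letter. -/
noncomputable def blockNext (p : Block) : List Block :=
  splitBlocks p.1 (relSplit (minSplit p.2)).2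

theorem measurable_splitBlocks : Measurable fun q : ℕ+ × Word × ℕ × Word =>
    splitBlocks q.1 q.2 := by
  have hp : Measurable Nat.toPNat' := measurable_of_countable _
  unfold splitBlocks
  refine Measurable.ite ?_ (Measurable.ite ?_ (by fun_prop) ?_) (by fun_prop)
  · exact (by fun_prop : Measurable fun q : ℕ+ × Word × ℕ × Word => q.2.1) measurableSet_list_nil
  · exact (by fun_prop : Measurable fun q : ℕ+ × Word × ℕ × Word => q.2.2.1)
      (measurableSet_singleton 0)
  · exact Measurable.list_cons (Measurable.prodMk (hp.comp (by fun_prop)) (by fun_prop))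
      measurable_const

theorem measurable_blockNext : Measurable blockNext := by
  unfold blockNext
  exact measurable_splitBlocks.comp (measurable_fst.prodMk
    (measurable_snd.comp ((measurable_relSplit.comp measurable_minSplit).comp measurable_snd)))

theorem lintegral_excursionLaw_zero {F : Word → ℝ≥0∞} (hF : Measurable F) :
    ∫⁻ v, F v * weight α 0 0 v ∂freeMeasure letterMeasure = F [] := by
  rw [← lintegral_excursionLaw 0 hF, excursionLaw_zero, lintegral_dirac' _ hF]

theorem lintegral_forestLaw_singleton (n : ℕ+) {F : List Block → ℝ≥0∞} (hF : Measurable F) :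
    ∫⁻ x, F x ∂forestLaw α [n] = ∫⁻ w, F [(n, w)] ∂excursionLaw α n := by
  rw [lintegral_forestLaw_cons _ _ hF]
  congr 1; ext w
  exact lintegral_forestLaw_nil (F := fun x => F ((n, w) :: x)) (by fun_prop)

/-- This is `lintegral_relSplit` read as a Markov step: the common exponential factor is the clock
of rate `2 * n`, a jump of the root gives one block or none, and a birth separates the block `n`
from a new block `1`. -/
theorem lintegral_blockNext (n : ℕ+) {f : ℝ × List Block → ℝ≥0∞} (hf : Measurable f) :
    ∫⁻ w, {w | wordClock w < ∞}.indicator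
      (fun w => f ((wordClock w).toReal, blockNext (n, w))) w ∂excursionLaw α n =
    ∫⁻ t in Set.Ioi 0, ENNReal.ofReal (Real.exp (-(2 * (n : ℕ) * t))) *
      sumOver (tableTransitions α n) fun c => ∫⁻ x, f (t, x) ∂forestLaw α c := by
  have hn : (n : ℕ) ≠ 0 := n.ne_zero
  set Ψ : ℝ × Word × ℕ × Word → ℝ≥0∞ := fun q => f (q.1, splitBlocks n q.2) with hΨ
  have hΨm : Measurable Ψ :=
    hf.comp (measurable_fst.prodMk (measurable_splitBlocks.comp
      (f := fun q : ℝ × Word × ℕ × Word => (n, q.2)) (by fun_prop)))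
  have e1 : ∫⁻ w, {w | wordClock w < ∞}.indicator
      (fun w => f ((wordClock w).toReal, blockNext (n, w))) w ∂excursionLaw α n =
      ∫⁻ w, Ψ (relSplit (minSplit w)) ∂excursionLaw α n := by
    refine lintegral_congr_ae ?_
    filter_upwards [ae_excursionLaw_of_ae ae_forall_pos, ae_excursionLaw_weight_ne_zero (n : ℕ)]
      with w hw hw'
    have hw0 : w ≠ [] := by rintro rfl; simp [weight] at hw'
    have h1 : wordClock w = ENNReal.ofReal (minSplit w).2.1.1 := by simp [wordClock, hw0]
    have h2 : w ∈ {w | wordClock w < ∞} := by simp [h1]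
    rw [Set.indicator_of_mem h2, h1, ENNReal.toReal_ofReal (hw _ (minSplit_mem hw0)).le]
    rfl
  have hΨ' : Measurable fun w => Ψ (relSplit (minSplit w)) :=
    hΨm.comp (measurable_relSplit.comp measurable_minSplit)
  rw [e1, lintegral_excursionLaw _ hΨ',
    lintegral_relSplit α hn hΨm]
  refine setLIntegral_congr_fun measurableSet_Ioi fun b hb => ?_
  congr 1
  have hfb (c : List ℕ+) : Measurable fun x => f (b, x) := by fun_prop
  simp only [tableTransitions, sumOver_cons, sumOver_nil, add_zero]
  rw [← add_assoc]
  congr 1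
  -- Table sizes change by one. As `n ≥ 1`, the two targets are distinct and the natural subtraction
  -- is exact.
  · rw [tsum_eq_sum (s := {(n : ℕ) + 1, (n : ℕ) - 1}) , Finset.sum_pair (by omega)]
    · congr 2
      · simp [tableRate]
      · rw [lintegral_forestLaw_singleton _ (hfb [])]
        rw [lintegral_excursionLaw _ (by fun_prop)]
        congr 1
      · have h1 : (n : ℕ) - 1 ≠ n + 1 := by omega
        have h2 : (n : ℕ) - 1 + 1 = n := Nat.succ_pred_eq_of_pos n.pos
        simp [tableRate, h1, h2]
      · split_ifs with h1
        · subst h1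
          rw [lintegral_forestLaw_nil (hfb [])]
          rw [PNat.one_coe, Nat.sub_self]
          have hm : Measurable fun v => Ψ (b, [], 0, v) := hΨm.comp (by fun_prop)
          rw [lintegral_excursionLaw_zero hm]
          simp [hΨ, splitBlocks]
        · have h2 : ((n - 1 : ℕ+) : ℕ) = n - 1 := by
            rw [PNat.sub_coe, if_pos]
            · rfl
            · exact lt_of_le_of_ne one_le (Ne.symm h1)
          rw [lintegral_forestLaw_singleton _ (hfb []), lintegral_excursionLaw _ (by fun_prop), h2]
          congr 1; ext v
          congr 2
          have h3 : 0 < (n : ℕ) - 1 := by rw [← h2]; exact PNat.pos _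
          have h4 : ((n : ℕ) - 1).toPNat' = n - 1 := by
            apply PNat.eq
            rw [Nat.toPNat'_coe, if_pos h3, h2]
          simp [hΨ, splitBlocks, h3.ne', h4]
    · intro m hm
      simp only [Finset.mem_insert, Finset.mem_singleton, not_or] at hm
      have : m + 1 ≠ (n : ℕ) := by omega
      simp [tableRate, hm.1, this]
  · congr 1
    rw [lintegral_forestLaw_cons _ _ (hfb [])]
    have hm : Measurable fun u => ∫⁻ x, f (b, (n, u) :: x) ∂forestLaw α [1] := by
      have : Measurable fun p : Word × List Block => f (b, (n, p.1) :: p.2) := by fun_prop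
      exact this.lintegral_prod_right'
    rw [lintegral_excursionLaw _ hm]
    congr 1; ext u
    -- With an empty front word `splitBlocks` would report a jump of the root instead of a birth,
    -- but that word has weight zero.
    by_cases hu : u = []
    · simp [hu, weight]
    · congr 1
      rw [lintegral_forestLaw_singleton _ (by fun_prop), lintegral_excursionLaw _ (by fun_prop)]
      simp [hΨ, splitBlocks, hu]

end Forest

/-! ### Excursions are almost surely finite -/

section Mass

theorem lintegral_exp_neg_Ioi {r : ℝ} (hr : 0 < r) (s : ℝ) :
    ∫⁻ t in Set.Ioi s, ENNReal.ofReal (Real.exp (-(r * t))) =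
      ENNReal.ofReal (Real.exp (-(r * s)) / r) := by
  have h1 : ∀ t, Real.exp (-(r * t)) = Real.exp ((-r) * t) := fun t => by rw [neg_mul]
  simp_rw [h1]
  rw [← ofReal_integral_eq_lintegral_ofReal (integrableOn_exp_mul_Ioi (by linarith) s)
    (Filter.Eventually.of_forall fun t => (Real.exp_pos _).le),
    integral_exp_mul_Ioi (by linarith), neg_div_neg_eq]

/-- The extinction probabilities are determined by their recursion. -/
theorem eq_one_of_extinction_recursion {α : ℝ} (hα₀ : 0 ≤ α) (hα₁ : α ≤ 1) {q : ℕ → ℝ}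
    (hq0 : ∀ n, 0 ≤ q n) (hq1 : ∀ n, q n ≤ 1) (h0 : q 0 = 1)
    (h : ∀ n : ℕ, n ≠ 0 → 2 * n * q n = (n - α) * q (n + 1) + n * q (n - 1) + α * q n * q 1)
    (n : ℕ) : q n = 1 := by
  -- The recursion in terms of the decrements `q n - q (n + 1)`. Its last term disappears once `q 1
  -- = 1`.
  have hrec (n : ℕ) : (n + 1 - α) * (q (n + 1) - q (n + 2)) =
      (n + 1) * (q n - q (n + 1)) - α * (1 - q 1) * q (n + 1) := by
    have := h (n + 1) (by omega)
    push_cast at this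
    linarith
  have hα (n : ℕ) : 0 ≤ (n : ℝ) + 1 - α := by
    have : (0 : ℝ) ≤ n := n.cast_nonneg
    linarith
  have hpos : ∀ n, 0 < q n := by
    intro n
    induction n with
    | zero => rw [h0]; norm_num
    | succ n ih =>
      have h1 := h (n + 1) (by omega)
      push_cast at h1
      have h2 : 0 ≤ ((n : ℝ) + 1 - α) * q (n + 1 + 1) := mul_nonneg (hα n) (hq0 _)
      have h3 : 0 ≤ α * q (n + 1) * q 1 := mul_nonneg (mul_nonneg hα₀ (hq0 _)) (hq0 _)
      have h4 : 0 < ((n : ℝ) + 1) * q n := by positivity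
      have h5 : 0 < 2 * ((n : ℝ) + 1) * q (n + 1) := by linarith
      exact pos_of_mul_pos_right h5 (by positivity)
  have hq1' : q 1 = 1 := by
    by_contra hne
    set δ := 1 - q 1 with hδ
    have hδ0 : 0 < δ := by
      have := lt_of_le_of_ne (hq1 1) hne
      linarith
    -- If `q 1 < 1`, the relative decrements grow linearly. Indeed, a decrement of at least `r * q
    -- n` is at least `(r + r ^ 2) * q (n + 1)`, and the recursion hands this bound on to the next
    -- decrement because `δ ≤ r + r ^ 2`. As soon as `n * δ ^ 2 > 1`, the next value of `q` would be
    -- negative.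
    have claim : ∀ n : ℕ, (δ + n * δ ^ 2) * q n ≤ q n - q (n + 1) := by
      intro n
      induction n with
      | zero => simp [h0, hδ]
      | succ n ih =>
        set r := δ + n * δ ^ 2 with hr
        have hrδ : δ ≤ r := by
          have : 0 ≤ (n : ℝ) * δ ^ 2 := by positivity
          linarith
        have hr0 : 0 < r := hδ0.trans_le hrδ
        have h1 : 0 ≤ q n - q (n + 1) := (mul_nonneg hr0.le (hq0 n)).trans ih
        have h2 : (r + r ^ 2) * q (n + 1) ≤ q n - q (n + 1) := by nlinarith [hq0 (n + 1)]
        have h3 : δ ^ 2 ≤ r ^ 2 := by gcongr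
        have h4 : α * δ * q (n + 1) ≤ α * (r + r ^ 2) * q (n + 1) := by
          have : δ ≤ r + r ^ 2 := by nlinarith
          gcongr
          exact hq0 _
        have h5 : ((n : ℝ) + 1 - α) * ((r + r ^ 2) * q (n + 1)) ≤
            ((n : ℝ) + 1 - α) * (q (n + 1) - q (n + 2)) := by
          rw [hrec n]
          nlinarith [n.cast_nonneg (α := ℝ)]
        have h6 : r + r ^ 2 ≥ δ + ((n + 1 : ℕ) : ℝ) * δ ^ 2 := by
          push_cast
          linarith
        -- The factor `n + 1 - α` vanishes only for `n = 0` and `α = 1`, where the recursion forces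
        -- `δ ^ 2 = 0`.
        rcases (hα n).eq_or_lt with h7 | h7
        · exfalso
          have hn : (n : ℝ) = 0 := by
            have : (0 : ℝ) ≤ n := n.cast_nonneg
            linarith
          have hn' : n = 0 := by exact_mod_cast hn
          subst hn'
          have h8 := hrec 0
          rw [← h7] at h8
          simp only [Nat.cast_zero, zero_mul, zero_add, h0] at h8
          have : α = 1 := by simp at h7; linarith
          rw [this] at h8
          have : q 1 = 1 - δ := by rw [hδ]; ring
          rw [this] at h8
          nlinarith
        · exact (mul_le_mul_of_nonneg_right h6 (hq0 _)).trans (le_of_mul_le_mul_left h5 h7)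
    obtain ⟨n, hn⟩ := exists_nat_gt (1 / δ ^ 2)
    have h1 : 1 < n * δ ^ 2 := by rwa [div_lt_iff₀ (by positivity)] at hn
    have h2 := claim n
    nlinarith [hpos n, hpos (n + 1)]
  have hrec' (n : ℕ) : (n + 2 - α) * (q (n + 2) - q (n + 3)) = (n + 2) * (q (n + 1) - q (n + 2)) := by
    have := hrec (n + 1)
    rw [hq1'] at this
    push_cast at this
    linarith
  have hα' (n : ℕ) : 0 < (n : ℝ) + 2 - α := by linarith [hα n]
  -- With `q 1 = 1` the decrements are nondecreasing, so a positive first one would push `q` below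
  -- zero at linear speed.
  have hd (n : ℕ) : q 1 - q 2 ≤ q (n + 1) - q (n + 2) := by
    induction n with
    | zero => rfl
    | succ n ih =>
      have h1 : 0 ≤ q 1 - q 2 := by linarith [hq1 2]
      refine le_of_mul_le_mul_left ?_ (hα' n)
      rw [hrec' n]
      nlinarith [n.cast_nonneg (α := ℝ)]
  have hsum (n : ℕ) : n * (q 1 - q 2) ≤ q 1 - q (n + 1) := by
    induction n with
    | zero => simp
    | succ n ih => push_cast; linarith [hd n]
  have h2 : q 1 - q 2 = 0 := by
    by_contra hne
    have hp : 0 < q 1 - q 2 := lt_of_le_of_ne (by linarith [hq1 2]) (Ne.symm hne)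
    obtain ⟨n, hn⟩ := exists_nat_gt (1 / (q 1 - q 2))
    rw [div_lt_iff₀ hp] at hn
    linarith [hsum n, hq0 (n + 1)]
  have h3 (n : ℕ) : q (n + 1) - q (n + 2) = 0 := by
    induction n with
    | zero => exact h2
    | succ n ih =>
      have := hrec' n
      rw [ih, mul_zero] at this
      exact (mul_eq_zero.1 this).resolve_left (hα' n).ne'
  cases n with
  | zero => exact h0
  | succ n =>
    induction n with
    | zero => exact hq1'
    | succ n ih => linarith [h3 n]

variable {α : ℝ}

theorem ae_wordClock_lt_top {n : ℕ} (hn : n ≠ 0) : ∀ᵐ w ∂excursionLaw α n, wordClock w < ∞ := by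
  filter_upwards [ae_excursionLaw_weight_ne_zero n] with w hw
  have hw0 : w ≠ [] := by rintro rfl; simp [weight, hn] at hw
  simp [wordClock, hw0]

theorem forestLaw_univ_cons (n : ℕ+) (c : List ℕ+) : forestLaw α (n :: c) Set.univ =
    excursionLaw α n Set.univ * forestLaw α c Set.univ := by
  rw [forestLaw, Measure.map_apply (by fun_prop) .univ, Set.preimage_univ, Measure.prod_apply .univ]
  simp [mul_comm]

theorem forestLaw_univ_nil : forestLaw α [] Set.univ = 1 := by simp [forestLaw]

/-- The first event decomposition, applied to the constant function one, yields the extinction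
recursion for the masses. The bound by one, supplied later by the machine, places them in the range
where the solution is unique. -/
theorem excursionLaw_univ (hα₀ : 0 ≤ α) (hα₁ : α ≤ 1) (h : ∀ n, excursionLaw α n Set.univ ≤ 1)
    (n : ℕ) : excursionLaw α n Set.univ = 1 := by
  set q : ℕ → ℝ := fun n => (excursionLaw α n Set.univ).toReal with hq
  have hq' (n : ℕ) : excursionLaw α n Set.univ = ENNReal.ofReal (q n) :=
    (ENNReal.ofReal_toReal ((h n).trans_lt ENNReal.one_lt_top).ne).symm
  have hq0 (n : ℕ) : 0 ≤ q n := ENNReal.toReal_nonneg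
  have h0 : q 0 = 1 := by simp [hq, excursionLaw_zero]
  have key := eq_one_of_extinction_recursion hα₀ hα₁ (q := q) hq0
    (fun n => by simpa using ENNReal.toReal_mono ENNReal.one_ne_top (h n)) h0 ?_ n
  · rw [hq', key, ENNReal.ofReal_one]
  intro n hn
  obtain ⟨m, rfl⟩ : ∃ m : ℕ+, (m : ℕ) = n := ⟨⟨n, Nat.pos_of_ne_zero hn⟩, rfl⟩
  have h1 := lintegral_blockNext (α := α) m (f := fun _ => 1) measurable_const
  have h2 : ∫⁻ w, {w | wordClock w < ∞}.indicator (fun _ => (1 : ℝ≥0∞)) w ∂excursionLaw α m =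
      excursionLaw α m Set.univ := by
    rw [← setLIntegral_univ, setLIntegral_univ, ← lintegral_one]
    refine lintegral_congr_ae ?_
    filter_upwards [ae_wordClock_lt_top (α := α) hn] with w hw
    rw [Set.indicator_of_mem (by exact hw)]
  have hm : (1 : ℝ) ≤ (m : ℕ) := by exact_mod_cast m.pos
  rw [h2, lintegral_mul_const _ (by fun_prop), lintegral_exp_neg_Ioi (by positivity)] at h1
  simp only [tableTransitions, sumOver_cons, sumOver_nil, lintegral_one, forestLaw_univ_cons,
    forestLaw_univ_nil, mul_one, add_zero] at h1
  have h3 : forestLaw α (if m = 1 then [] else [m - 1]) Set.univ = ENNReal.ofReal (q (m - 1 : ℕ)) := by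
    split_ifs with h4
    · subst h4
      simp [forestLaw_univ_nil, h0]
    · rw [forestLaw_univ_cons, forestLaw_univ_nil, mul_one, hq', PNat.sub_coe,
        if_pos (lt_of_le_of_ne one_le (Ne.symm h4))]
      rfl
  rw [h3] at h1
  simp only [hq'] at h1
  have h5 : 0 ≤ (m : ℕ) - α := by linarith
  rw [← ENNReal.ofReal_mul h5, ← ENNReal.ofReal_mul (by positivity),
    ← ENNReal.ofReal_mul (hq0 _), ← ENNReal.ofReal_mul hα₀,
    ← ENNReal.ofReal_add (mul_nonneg (by positivity) (hq0 _))
      (mul_nonneg hα₀ (mul_nonneg (hq0 _) (hq0 _))),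
    ← ENNReal.ofReal_add (mul_nonneg h5 (hq0 _)) (add_nonneg (mul_nonneg (by positivity) (hq0 _))
      (mul_nonneg hα₀ (mul_nonneg (hq0 _) (hq0 _)))),
    ← ENNReal.ofReal_mul (by positivity), ENNReal.ofReal_eq_ofReal_iff (hq0 _)] at h1
  · rw [mul_zero, neg_zero, Real.exp_zero] at h1
    simp only [PNat.add_coe, PNat.one_coe] at h1
    field_simp at h1
    linarith
  · have a1 := mul_nonneg h5 (hq0 ((m + 1 : ℕ+) : ℕ))
    have a2 : 0 ≤ ((m : ℕ) : ℝ) * q ((m : ℕ) - 1) := mul_nonneg (by positivity) (hq0 _)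
    have a3 : 0 ≤ α * (q m * q (1 : ℕ+)) := mul_nonneg hα₀ (mul_nonneg (hq0 _) (hq0 _))
    positivity

end Mass

/-! ### The first event of a forest -/

section ForestStep

variable {α : ℝ}

/-- The initial table sizes. -/
def blockSizes (x : List Block) : List ℕ+ := x.map Prod.fst

/-- The sum of the entries of a composition. -/
def compSize (c : List ℕ+) : ℕ := (c.map PNat.val).sum

/-- Lowering all words of a forest by `t`. -/
def forestShift (t : ℝ) (x : List Block) : List Block := x.map fun p => (p.1, shiftWord t p.2)

/-- The level of the first event of a forest. -/
noncomputable def forestClock : List Block → ℝ≥0∞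
  | [] => ∞
  | p :: x => min (wordClock p.2) (forestClock x)

/-- The forest above the level of its first event. -/
noncomputable def forestNext : List Block → List Block
  | [] => []
  | p :: x =>
    if wordClock p.2 < forestClock x then
      blockNext p ++ forestShift (wordClock p.2).toReal x
    else (p.1, shiftWord (forestClock x).toReal p.2) :: forestNext x

theorem compSize_cons (n : ℕ+) (c : List ℕ+) : compSize (n :: c) = n + compSize c := by
  simp [compSize]

theorem measurable_blockSizes : Measurable blockSizes :=
  Measurable.list_map (f := fun (_ : List Block) (p : Block) => p.1) (by fun_prop) measurable_id

theorem measurable_forestShift : Measurable fun p : ℝ × List Block => forestShift p.1 p.2 :=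
  Measurable.list_map (f := fun (p : ℝ × List Block) (q : Block) => (q.1, shiftWord p.1 q.2))
    (by fun_prop) measurable_snd

@[fun_prop]
theorem Measurable.forestShift {β : Type*} [MeasurableSpace β] {f : β → ℝ} {g : β → List Block}
    (hf : Measurable f) (hg : Measurable g) : Measurable fun b => forestShift (f b) (g b) :=
  measurable_forestShift.comp (hf.prodMk hg)

@[fun_prop]
theorem Measurable.wordClock {β : Type*} [MeasurableSpace β] {g : β → Word}
    (hg : Measurable g) : Measurable fun b => wordClock (g b) := measurable_wordClock.comp hg

theorem measurable_forestClock : Measurable forestClock := by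
  have := measurable_list_rec (X := Block) (β := Unit) (F := fun _ => forestClock) (fun b _ => b)
    (fun q => min (wordClock q.2.1.2) q.2.2.2) (by fun_prop)
    (Measurable.min (by fun_prop) (by fun_prop)) measurable_const (fun _ _ _ => rfl)
  exact this.comp (measurable_const.prodMk measurable_id : Measurable fun x : List Block => ((), x))

@[fun_prop]
theorem Measurable.forestClock {β : Type*} [MeasurableSpace β] {g : β → List Block}
    (hg : Measurable g) : Measurable fun b => forestClock (g b) := measurable_forestClock.comp hg

theorem measurable_forestNext : Measurable forestNext := by
  have := measurable_list_rec (X := Block) (β := Unit) (F := fun _ => forestNext) (fun b _ => b)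
    (fun q => if wordClock q.2.1.2 < forestClock q.2.2.1 then
      blockNext q.2.1 ++ forestShift (wordClock q.2.1.2).toReal q.2.2.1
      else (q.2.1.1, shiftWord (forestClock q.2.2.1).toReal q.2.1.2) :: q.2.2.2) (by fun_prop)
    ?_ measurable_const (fun _ _ _ => rfl)
  · exact this.comp
      (measurable_const.prodMk measurable_id : Measurable fun x : List Block => ((), x))
  · refine Measurable.ite (measurableSet_lt (by fun_prop) (by fun_prop)) ?_ (by fun_prop)
    exact Measurable.list_append (measurable_blockNext.comp (by fun_prop)) (by fun_prop)

@[fun_prop]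
theorem Measurable.forestNext {β : Type*} [MeasurableSpace β] {g : β → List Block}
    (hg : Measurable g) : Measurable fun b => forestNext (g b) := measurable_forestNext.comp hg

/-- The trees are independent, so their survival probabilities up to `t` multiply, and each
surviving tree starts afresh above `t`. -/
theorem lintegral_forestLaw_lt_clock (c : List ℕ+) {t : ℝ} (ht : 0 ≤ t)
    {F : List Block → ℝ≥0∞} (hF : Measurable F) :
    ∫⁻ x, {x | ENNReal.ofReal t < forestClock x}.indicator (fun x => F (forestShift t x)) x
      ∂forestLaw α c =
      ENNReal.ofReal (Real.exp (-(2 * compSize c * t))) * ∫⁻ x, F x ∂forestLaw α c := by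
  have hm {F : List Block → ℝ≥0∞} (hF : Measurable F) : Measurable fun x =>
      {x | ENNReal.ofReal t < forestClock x}.indicator (fun x => F (forestShift t x)) x :=
    (hF.comp (by fun_prop)).indicator
      (measurableSet_lt (measurable_const (a := ENNReal.ofReal t)) measurable_forestClock)
  induction c generalizing F with
  | nil =>
    have h0 : ([] : List Block) ∈ {x | ENNReal.ofReal t < forestClock x} := by simp [forestClock]
    rw [lintegral_forestLaw_nil hF, lintegral_forestLaw_nil (hm hF), Set.indicator_of_mem h0]
    simp [compSize, forestShift]
  | cons n c ih =>
    have hFc : Measurable fun p : Word × List Block => F ((n, p.1) :: p.2) := by fun_prop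
    have hI : Measurable fun w => ∫⁻ x, F ((n, w) :: x) ∂forestLaw α c := hFc.lintegral_prod_right'
    rw [lintegral_forestLaw_cons _ _ hF, lintegral_forestLaw_cons _ _ (hm hF), compSize_cons]
    have e : Real.exp (-(2 * ((n : ℕ) + compSize c : ℕ) * t)) =
        Real.exp (-(2 * compSize c * t)) * Real.exp (-(2 * (n : ℕ) * t)) := by
      rw [← Real.exp_add]; congr 1; push_cast; ring
    rw [e, ENNReal.ofReal_mul (Real.exp_pos _).le, mul_assoc,
      ← lintegral_excursionLaw_lt_clock n.ne_zero ht hI, ← lintegral_const_mul]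
    · congr 1; ext w
      by_cases hw : ENNReal.ofReal t < wordClock w
      · have hw' : w ∈ {w | ENNReal.ofReal t < wordClock w} := hw
        rw [Set.indicator_of_mem hw', ← ih (F := fun x => F ((n, shiftWord t w) :: x)) (by fun_prop)]
        congr 1; ext x
        simp [Set.indicator_apply, forestClock, hw, forestShift]
      · have hw' : w ∉ {w | ENNReal.ofReal t < wordClock w} := hw
        rw [Set.indicator_of_notMem hw']
        simp [forestClock, hw]
    · exact Measurable.indicator (hI.comp (by fun_prop))
        (measurableSet_lt measurable_const measurable_wordClock)

/-- A competition of exponential clocks: the tree that rings first makes its step, and all the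
others lose their memory. The induction separates the first tree from the remaining ones. -/
theorem lintegral_forestNext (c : List ℕ+) {f : ℝ × List Block → ℝ≥0∞} (hf : Measurable f) :
    ∫⁻ x, {x | forestClock x < ∞}.indicator
      (fun x => f ((forestClock x).toReal, forestNext x)) x ∂forestLaw α c =
    ∫⁻ t in Set.Ioi 0, ENNReal.ofReal (Real.exp (-(2 * compSize c * t))) *
      sumOver (transitions α c) fun c' => ∫⁻ x, f (t, x) ∂forestLaw α c' := by
  classical
  have hm {f : ℝ × List Block → ℝ≥0∞} (hf : Measurable f) : Measurable fun x =>
      {x | forestClock x < ∞}.indicator (fun x => f ((forestClock x).toReal, forestNext x)) x :=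
    (hf.comp (by fun_prop)).indicator (measurableSet_lt measurable_forestClock measurable_const)
  have hint {f : ℝ × List Block → ℝ≥0∞} (hf : Measurable f) (c : List ℕ+) :
      Measurable fun t => ∫⁻ x, f (t, x) ∂forestLaw α c := hf.lintegral_prod_right'
  induction c generalizing f with
  | nil =>
    rw [lintegral_forestLaw_nil (hm hf)]
    simp [forestClock, transitions]
  | cons n c ih =>
    rw [lintegral_forestLaw_cons _ _ (hm hf)]
    -- the first event happens in the first tree
    set A : Word × List Block → ℝ≥0∞ := fun p => {p | wordClock p.1 < forestClock p.2}.indicator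
      (fun p => f ((wordClock p.1).toReal,
        blockNext (n, p.1) ++ forestShift (wordClock p.1).toReal p.2)) p with hA
    -- the first event happens in another tree
    set B : Word × List Block → ℝ≥0∞ := fun p =>
      {p | forestClock p.2 ≤ wordClock p.1 ∧ forestClock p.2 < ∞}.indicator
      (fun p => f ((forestClock p.2).toReal,
        (n, shiftWord (forestClock p.2).toReal p.1) :: forestNext p.2)) p with hB
    have hAm : Measurable A := by
      refine Measurable.indicator ?_ (measurableSet_lt (by fun_prop) (by fun_prop))
      refine hf.comp (Measurable.prodMk (by fun_prop) ?_)
      exact Measurable.list_append (measurable_blockNext.comp (by fun_prop)) (by fun_prop)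
    have hBm : Measurable B := by
      refine Measurable.indicator (hf.comp (by fun_prop)) ?_
      exact (measurableSet_le (f := fun p : Word × List Block => forestClock p.2)
        (g := fun p => wordClock p.1) (by fun_prop) (by fun_prop)).inter
        (measurableSet_lt (f := fun p : Word × List Block => forestClock p.2) (by fun_prop)
          measurable_const)
    have e1 : ∀ w x, {x | forestClock x < ∞}.indicator
        (fun x => f ((forestClock x).toReal, forestNext x)) ((n, w) :: x) = A (w, x) + B (w, x) := by
      intro w x
      simp only [hA, hB, Set.indicator_apply, Set.mem_ofPred_eq, forestClock, forestNext]
      by_cases h : wordClock w < forestClock x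
      · have h1 : wordClock w < ∞ := h.trans_le le_top
        simp [h, h1, h.le, h.not_ge]
      · push Not at h
        by_cases h2 : forestClock x < ∞
        · simp [h, h2, h.not_gt]
        · simp only [not_lt, top_le_iff] at h2
          have h3 : wordClock w = ∞ := top_le_iff.1 (h2 ▸ h)
          simp [h2, h3]
    simp_rw [e1]
    have e2 : ∀ w, ∫⁻ x, A (w, x) + B (w, x) ∂forestLaw α c =
        (∫⁻ x, A (w, x) ∂forestLaw α c) + ∫⁻ x, B (w, x) ∂forestLaw α c := fun w =>
      lintegral_add_left (hAm.comp measurable_prodMk_left) _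
    simp_rw [e2]
    rw [lintegral_add_left hAm.lintegral_prod_right']
    have hexp : ∀ t, ENNReal.ofReal (Real.exp (-(2 * compSize (n :: c) * t))) =
        ENNReal.ofReal (Real.exp (-(2 * (n : ℕ) * t))) *
          ENNReal.ofReal (Real.exp (-(2 * compSize c * t))) := by
      intro t
      rw [← ENNReal.ofReal_mul (Real.exp_pos _).le, ← Real.exp_add, compSize_cons]
      congr 2; push_cast; ring
    simp only [transitions, sumOver_append, sumOver_map, hexp, mul_add]
    rw [lintegral_add_left]
    swap
    · refine Measurable.mul (by fun_prop) ?_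
      rw [show (fun a => sumOver (List.map (fun p => (p.1, p.2 ++ c)) (tableTransitions α n))
        fun c' => ∫⁻ x, f (a, x) ∂forestLaw α c') = _ from rfl]
      exact measurable_sumOver _ fun c' => hint hf c'
    congr 1
    · have hfs : Measurable fun q : List Block × (ℝ × List Block) =>
          {q : List Block × (ℝ × List Block) | ENNReal.ofReal q.2.1 < forestClock q.1}.indicator
            (fun q => f (q.2.1, q.2.2 ++ forestShift q.2.1 q.1)) q :=
        (hf.comp (by fun_prop)).indicator (measurableSet_lt (by fun_prop) (by fun_prop))
      have hfx (x : List Block) : Measurable fun q : ℝ × List Block =>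
          {q : List Block × (ℝ × List Block) | ENNReal.ofReal q.2.1 < forestClock q.1}.indicator
            (fun q => f (q.2.1, q.2.2 ++ forestShift q.2.1 q.1)) (x, q) :=
        hfs.comp measurable_prodMk_left
      -- The remaining trees are held fixed while the first tree makes its step; their clock enters
      -- as a parameter of the integrand.
      rw [lintegral_lintegral_swap (f := fun w x => A (w, x)) hAm.aemeasurable]
      have s1 : ∀ x, ∫⁻ w, A (w, x) ∂excursionLaw α n = ∫⁻ t in Set.Ioi 0,
          ENNReal.ofReal (Real.exp (-(2 * (n : ℕ) * t))) *
            sumOver (tableTransitions α n) fun c' => ∫⁻ x',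
              {q : List Block × (ℝ × List Block) | ENNReal.ofReal q.2.1 < forestClock q.1}.indicator
                (fun q => f (q.2.1, q.2.2 ++ forestShift q.2.1 q.1)) (x, (t, x'))
                ∂forestLaw α c' := by
        intro x
        rw [← lintegral_blockNext n (hfx x)]
        congr 1; ext w
        simp only [hA, Set.indicator_apply, Set.mem_ofPred_eq]
        by_cases h : wordClock w < ∞
        · simp [h, ENNReal.ofReal_toReal h.ne]
        · have : wordClock w = ∞ := by simpa using h
          simp [this]
      simp_rw [s1]
      have hq (c' : List ℕ+) : Measurable fun p : List Block × ℝ => ∫⁻ x',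
              {q : List Block × (ℝ × List Block) | ENNReal.ofReal q.2.1 < forestClock q.1}.indicator
                (fun q => f (q.2.1, q.2.2 ++ forestShift q.2.1 q.1)) (p.1, (p.2, x'))
                ∂forestLaw α c' := by
        have := hfs.comp (f := fun p : (List Block × ℝ) × List Block => (p.1.1, (p.1.2, p.2)))
          (by fun_prop)
        exact this.lintegral_prod_right'
      rw [lintegral_lintegral_swap]
      swap
      · exact (Measurable.mul (by fun_prop) (measurable_sumOver _ fun c' => hq c')).aemeasurable
      refine setLIntegral_congr_fun measurableSet_Ioi fun t ht => ?_
      have ht : (0 : ℝ) < t := ht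
      have hq' (c' : List ℕ+) : Measurable fun x : List Block => ∫⁻ x',
              {q : List Block × (ℝ × List Block) | ENNReal.ofReal q.2.1 < forestClock q.1}.indicator
                (fun q => f (q.2.1, q.2.2 ++ forestShift q.2.1 q.1)) (x, (t, x'))
                ∂forestLaw α c' := (hq c').comp measurable_prodMk_right
      rw [lintegral_const_mul _ (measurable_sumOver _ hq'),
        lintegral_sumOver _ _ hq', mul_assoc (ENNReal.ofReal _)]
      congr 1
      rw [← sumOver_const_mul, sumOver_map _ fun d => d ++ c]
      congr 1; ext c'
      rw [lintegral_lintegral_swap, lintegral_forestLaw_append _ _ (by fun_prop),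
        ← lintegral_const_mul]
      · congr 1; ext x'
        -- The remaining trees have survived up to `t`. Loss of memory restores their law and
        -- produces their survival probability.
        rw [← lintegral_forestLaw_lt_clock c ht.le (F := fun x => f (t, x' ++ x)) (by fun_prop)]
        rfl
      · have : Measurable fun p : List Block × List Block => f (t, p.1 ++ p.2) := by fun_prop
        exact this.lintegral_prod_right'
      · exact (hfs.comp (f := fun p : List Block × List Block => (p.1, (t, p.2)))
          (by fun_prop)).aemeasurable
    · have hfs : Measurable fun q : Word × (ℝ × List Block) =>
          {q : Word × (ℝ × List Block) | ENNReal.ofReal q.2.1 ≤ wordClock q.1}.indicator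
            (fun q => f (q.2.1, (n, shiftWord q.2.1 q.1) :: q.2.2)) q :=
        (hf.comp (by fun_prop)).indicator (measurableSet_le (by fun_prop) (by fun_prop))
      have hfx (w : Word) : Measurable fun q : ℝ × List Block =>
          {q : Word × (ℝ × List Block) | ENNReal.ofReal q.2.1 ≤ wordClock q.1}.indicator
            (fun q => f (q.2.1, (n, shiftWord q.2.1 q.1) :: q.2.2)) (w, q) :=
        hfs.comp measurable_prodMk_left
      have s1 : ∀ w, ∫⁻ x, B (w, x) ∂forestLaw α c = ∫⁻ t in Set.Ioi 0,
          ENNReal.ofReal (Real.exp (-(2 * compSize c * t))) *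
            sumOver (transitions α c) fun c' => ∫⁻ x,
              {q : Word × (ℝ × List Block) | ENNReal.ofReal q.2.1 ≤ wordClock q.1}.indicator
                (fun q => f (q.2.1, (n, shiftWord q.2.1 q.1) :: q.2.2)) (w, (t, x))
                ∂forestLaw α c' := by
        intro w
        -- Here the word of the first tree is the parameter, and the induction hypothesis performs
        -- the step of the remaining trees.
        rw [← ih (hfx w)]
        congr 1; ext x
        simp only [hB, Set.indicator_apply, Set.mem_ofPred_eq]
        by_cases h : forestClock x < ∞
        · simp [h, ENNReal.ofReal_toReal h.ne]
        · simp [h]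
      simp_rw [s1]
      have hq (c' : List ℕ+) : Measurable fun p : Word × ℝ => ∫⁻ x,
              {q : Word × (ℝ × List Block) | ENNReal.ofReal q.2.1 ≤ wordClock q.1}.indicator
                (fun q => f (q.2.1, (n, shiftWord q.2.1 q.1) :: q.2.2)) (p.1, (p.2, x))
                ∂forestLaw α c' := by
        have := hfs.comp (f := fun p : (Word × ℝ) × List Block => (p.1.1, (p.1.2, p.2)))
          (by fun_prop)
        exact this.lintegral_prod_right'
      rw [lintegral_lintegral_swap]
      swap
      · exact (Measurable.mul (by fun_prop) (measurable_sumOver _ fun c' => hq c')).aemeasurable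
      refine setLIntegral_congr_fun measurableSet_Ioi fun t ht => ?_
      have ht : (0 : ℝ) < t := ht
      have hq' (c' : List ℕ+) : Measurable fun w : Word => ∫⁻ x,
              {q : Word × (ℝ × List Block) | ENNReal.ofReal q.2.1 ≤ wordClock q.1}.indicator
                (fun q => f (q.2.1, (n, shiftWord q.2.1 q.1) :: q.2.2)) (w, (t, x))
                ∂forestLaw α c' := (hq c').comp measurable_prodMk_right
      rw [lintegral_const_mul _ (measurable_sumOver _ hq'),
        lintegral_sumOver _ _ hq',
        mul_comm (ENNReal.ofReal (Real.exp (-(2 * (n : ℕ) * t)))),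
        mul_assoc (ENNReal.ofReal _)]
      congr 1
      rw [← sumOver_const_mul]
      congr 1; ext c'
      have hfc : Measurable fun p : Word × List Block => f (t, (n, p.1) :: p.2) := by fun_prop
      rw [lintegral_forestLaw_cons _ _ (by fun_prop),
        lintegral_lintegral_swap (f := fun w x => f (t, (n, w) :: x)) hfc.aemeasurable,
        lintegral_lintegral_swap, ← lintegral_const_mul]
      · congr 1; ext x
        rw [← lintegral_excursionLaw_le_clock n.ne_zero ht.le (F := fun w => f (t, (n, w) :: x))
          (by fun_prop)]
        rfl
      · exact (hfc.comp measurable_swap).lintegral_prod_right'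
      · exact (hfs.comp (f := fun p : Word × List Block => (p.1, (t, p.2)))
          (by fun_prop)).aemeasurable

end ForestStep

/-! ### Exponential laws on `[0, ∞]` -/

section Exponential

/-- The exponential law of rate `r`, the unit mass at `∞` for `r ≤ 0`. -/
noncomputable def expLaw (r : ℝ) : Measure ℝ≥0∞ :=
  ((volume.restrict (Set.Ioi (0 : ℝ))).withDensity fun t =>
    ENNReal.ofReal r * ENNReal.ofReal (Real.exp (-(r * t)))).map ENNReal.ofReal +
  if r ≤ 0 then Measure.dirac ∞ else 0

theorem lintegral_expLaw (r : ℝ) {f : ℝ≥0∞ → ℝ≥0∞} (hf : Measurable f) :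
    ∫⁻ h, f h ∂expLaw r = (∫⁻ t in Set.Ioi 0, ENNReal.ofReal r *
      ENNReal.ofReal (Real.exp (-(r * t))) * f (ENNReal.ofReal t)) + if r ≤ 0 then f ∞ else 0 := by
  rw [expLaw, lintegral_add_measure, lintegral_map hf (by fun_prop),
    lintegral_withDensity_eq_lintegral_mul _ (by fun_prop) (by fun_prop)]
  congr 1
  split_ifs
  · rw [lintegral_dirac' _ hf]
  · simp

theorem lintegral_expLaw_of_pos {r : ℝ} (hr : 0 < r) {f : ℝ≥0∞ → ℝ≥0∞} (hf : Measurable f) :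
    ∫⁻ h, f h ∂expLaw r = ∫⁻ t in Set.Ioi 0, ENNReal.ofReal r *
      ENNReal.ofReal (Real.exp (-(r * t))) * f (ENNReal.ofReal t) := by
  rw [lintegral_expLaw r hf, if_neg hr.not_ge, add_zero]

theorem expLaw_of_nonpos {r : ℝ} (hr : r ≤ 0) : expLaw r = Measure.dirac ∞ := by
  ext s hs
  have hm : Measurable (s.indicator (1 : ℝ≥0∞ → ℝ≥0∞)) := measurable_one.indicator hs
  rw [← lintegral_indicator_one hs, ← lintegral_indicator_one hs, lintegral_expLaw r hm,
    lintegral_dirac' _ hm, ENNReal.ofReal_eq_zero.2 hr, if_pos hr]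
  simp

theorem expLaw_Ioi {r : ℝ} (hr : 0 ≤ r) (t : ℝ≥0) :
    expLaw r (Set.Ioi t) = ENNReal.ofReal (Real.exp (-(r * t))) := by
  rcases hr.eq_or_lt with rfl | hr
  · rw [expLaw_of_nonpos le_rfl]
    simp
  · have hm : Measurable ((Set.Ioi (t : ℝ≥0∞)).indicator (1 : ℝ≥0∞ → ℝ≥0∞)) :=
      measurable_one.indicator measurableSet_Ioi
    rw [← lintegral_indicator_one measurableSet_Ioi, lintegral_expLaw_of_pos hr hm]
    have : ∀ s : ℝ, ENNReal.ofReal r * ENNReal.ofReal (Real.exp (-(r * s))) *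
        (Set.Ioi (t : ℝ≥0∞)).indicator (1 : ℝ≥0∞ → ℝ≥0∞) (ENNReal.ofReal s) =
        (Set.Ioi (t : ℝ)).indicator (fun s => ENNReal.ofReal r *
          ENNReal.ofReal (Real.exp (-(r * s)))) s := by
      intro s
      have h : (t : ℝ≥0∞) < ENNReal.ofReal s ↔ (t : ℝ) < s := by
        rw [← ENNReal.ofReal_coe_nnreal, ENNReal.ofReal_lt_ofReal_iff_of_nonneg t.coe_nonneg]
      by_cases hs : (t : ℝ) < s
      · simp [h, hs]
      · simp [h, hs]
    simp_rw [this]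
    rw [setLIntegral_indicator measurableSet_Ioi,
      Set.inter_eq_left.2 (Set.Ioi_subset_Ioi t.coe_nonneg),
      lintegral_const_mul _ (by fun_prop), lintegral_exp_neg_Ioi hr,
      ← ENNReal.ofReal_mul hr.le]
    congr 1; field_simp

instance (r : ℝ) : IsProbabilityMeasure (expLaw r) := by
  rcases le_or_gt r 0 with hr | hr
  · rw [expLaw_of_nonpos hr]; infer_instance
  · refine ⟨?_⟩
    rw [← lintegral_one, lintegral_expLaw_of_pos hr measurable_const]
    simp only [mul_one]
    rw [lintegral_const_mul _ (by fun_prop), lintegral_exp_neg_Ioi hr,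
      ← ENNReal.ofReal_mul hr.le, ← ENNReal.ofReal_one]
    congr 1; simp [hr.ne']

theorem ae_expLaw_pos (r : ℝ) : ∀ᵐ h ∂expLaw r, 0 < h := by
  rcases le_or_gt r 0 with hr | hr
  · rw [expLaw_of_nonpos hr, ae_dirac_iff measurableSet_Ioi]; simp
  · have := expLaw_Ioi hr.le 0
    simp only [ENNReal.coe_zero, NNReal.coe_zero, mul_zero, neg_zero, Real.exp_zero,
      ENNReal.ofReal_one] at this
    exact (prob_compl_eq_zero_iff measurableSet_Ioi).2 this

theorem ae_expLaw_lt_top {r : ℝ} (hr : 0 < r) : ∀ᵐ h ∂expLaw r, h < ∞ := by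
  have hm : MeasurableSet {h : ℝ≥0∞ | ¬ h < ∞} := measurableSet_Iio.compl
  rw [ae_iff, ← lintegral_indicator_one hm,
    lintegral_expLaw_of_pos hr (measurable_one.indicator hm)]
  simp

/-- Loss of memory. -/
theorem lintegral_expLaw_le {r : ℝ} (hr : 0 < r) {t : ℝ} (ht : 0 ≤ t) {f : ℝ≥0∞ → ℝ≥0∞}
    (hf : Measurable f) :
    ∫⁻ h, {h | ENNReal.ofReal t ≤ h}.indicator (fun h => f (h - ENNReal.ofReal t)) h ∂expLaw r =
      ENNReal.ofReal (Real.exp (-(r * t))) * ∫⁻ h, f h ∂expLaw r := by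
  have hm : Measurable fun h : ℝ≥0∞ =>
      {h | ENNReal.ofReal t ≤ h}.indicator (fun h => f (h - ENNReal.ofReal t)) h :=
    (hf.comp (by fun_prop)).indicator (measurableSet_le measurable_const measurable_id)
  rw [lintegral_expLaw_of_pos hr hf, lintegral_expLaw_of_pos hr hm,
    ← lintegral_Ioi_shift (t := t) (fun s => ENNReal.ofReal r *
      ENNReal.ofReal (Real.exp (-(r * s))) * f (ENNReal.ofReal s)), ← lintegral_const_mul' _ _ (by simp),
    ← lintegral_indicator measurableSet_Ioi, ← lintegral_indicator measurableSet_Ioi]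
  have hne : ∀ᵐ s : ℝ, s ≠ t := by simp [ae_iff]
  refine lintegral_congr_ae ?_
  filter_upwards [hne] with s hs
  by_cases h : t < s
  · have h0 : 0 < s := ht.trans_lt h
    have h1 : ENNReal.ofReal t ≤ ENNReal.ofReal s := ENNReal.ofReal_le_ofReal h.le
    have e : Real.exp (-(r * s)) = Real.exp (-(r * t)) * Real.exp (-(r * (s - t))) := by
      rw [← Real.exp_add]; congr 1; ring
    simp only [Set.indicator_apply, Set.mem_Ioi, h, h0, Set.mem_ofPred_eq, h1, if_true, e,
      ENNReal.ofReal_mul (Real.exp_pos _).le, ENNReal.ofReal_sub _ ht]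
    ring
  · have h1 : s < t := lt_of_le_of_ne (not_lt.1 h) hs
    by_cases h0 : 0 < s
    · have : ¬ ENNReal.ofReal t ≤ ENNReal.ofReal s := by
        rw [not_le, ENNReal.ofReal_lt_ofReal_iff_of_nonneg h0.le]; exact h1
      simp [Set.indicator_apply, h, this]
    · simp [Set.indicator_apply, h, h0]

end Exponential

/-! ### Streams of independent variables -/

section Stream

variable {X : Type*} [MeasurableSpace X]

/-- The sequence with first entry `a`, followed by `x`. -/
def consStream (a : X) (x : ℕ → X) : ℕ → X
  | 0 => a
  | k + 1 => x k

@[simp] theorem consStream_zero (a : X) (x : ℕ → X) : consStream a x 0 = a := rfl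
@[simp] theorem consStream_succ (a : X) (x : ℕ → X) (k : ℕ) : consStream a x (k + 1) = x k := rfl

/-- The sequence without its first entry. -/
def tailStream (x : ℕ → X) : ℕ → X := fun k => x (k + 1)

@[simp] theorem tailStream_consStream (a : X) (x : ℕ → X) : tailStream (consStream a x) = x := rfl

@[fun_prop]
theorem Measurable.consStream {β : Type*} [MeasurableSpace β] {f : β → X} {g : β → ℕ → X}
    (hf : Measurable f) (hg : Measurable g) : Measurable fun b => consStream (f b) (g b) := by
  refine measurable_pi_lambda _ fun k => ?_
  cases k
  · exact hf
  · exact (measurable_pi_apply _).comp hg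

@[fun_prop]
theorem Measurable.tailStream {β : Type*} [MeasurableSpace β] {g : β → ℕ → X}
    (hg : Measurable g) : Measurable fun b => tailStream (g b) :=
  measurable_pi_lambda _ fun _ => (measurable_pi_apply _).comp hg

/-- The law of a sequence of independent variables with common law `ν`. -/
noncomputable def streamLaw (ν : Measure X) : Measure (ℕ → X) := Measure.infinitePi fun _ => ν

/-- A product measure is determined by finite boxes. Under `consStream` a box becomes the product of
its side at index `0` and of a box with shifted indices. -/
theorem map_consStream_infinitePi (ν : ℕ → Measure X) [∀ k, IsProbabilityMeasure (ν k)] :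
    ((ν 0).prod (Measure.infinitePi fun k => ν (k + 1))).map (fun p => consStream p.1 p.2) =
      Measure.infinitePi ν := by
  classical
  refine Measure.eq_infinitePi _ fun s t ht => ?_
  have hpre : (fun p : X × (ℕ → X) => consStream p.1 p.2) ⁻¹' (Set.pi s t) =
      (if 0 ∈ s then t 0 else Set.univ) ×ˢ
        Set.pi ((s.preimage Nat.succ Nat.succ_injective.injOn : Finset ℕ) : Set ℕ)
          (fun k => t (k + 1)) := by
    ext ⟨a, x⟩
    simp only [Set.mem_preimage, Set.mem_pi, Set.mem_prod, Finset.coe_preimage, Finset.mem_coe]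
    constructor
    · intro h
      refine ⟨?_, fun k hk => h (k + 1) hk⟩
      split_ifs with h0
      · exact h 0 h0
      · trivial
    · rintro ⟨h1, h2⟩ k hk
      cases k with
      | zero => simpa [hk] using h1
      | succ k => exact h2 k hk
  rw [Measure.map_apply (by fun_prop) (MeasurableSet.pi s.countable_toSet fun i _ => ht i), hpre,
    Measure.prod_prod, Measure.infinitePi_pi _ fun i _ => ht (i + 1)]
  have h1 : ∏ i ∈ s.preimage Nat.succ Nat.succ_injective.injOn, ν (i + 1) (t (i + 1)) =
      ∏ i ∈ s.erase 0, ν i (t i) := by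
    have := Finset.prod_preimage' Nat.succ s Nat.succ_injective.injOn (fun i => ν i (t i))
    simp only [Nat.succ_eq_add_one] at this
    rw [this]
    refine Finset.prod_congr ?_ fun _ _ => rfl
    ext i
    simp only [Finset.mem_filter, Set.mem_range, Finset.mem_erase]
    constructor
    · rintro ⟨h, j, rfl⟩; exact ⟨by omega, h⟩
    · rintro ⟨h, h'⟩; exact ⟨h', i - 1, by omega⟩
  rw [h1]
  split_ifs with h0
  · rw [Finset.mul_prod_erase s (fun i => ν i (t i)) h0]
  · rw [measure_univ, one_mul, Finset.erase_eq_of_notMem h0]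

variable (ν : Measure X) [IsProbabilityMeasure ν]

instance : IsProbabilityMeasure (streamLaw ν) := by unfold streamLaw; infer_instance

theorem map_consStream_streamLaw :
    (ν.prod (streamLaw ν)).map (fun p => consStream p.1 p.2) = streamLaw ν :=
  map_consStream_infinitePi fun _ => ν

theorem lintegral_streamLaw_cons {F : (ℕ → X) → ℝ≥0∞} (hF : Measurable F) :
    ∫⁻ x, F x ∂streamLaw ν = ∫⁻ a, ∫⁻ x, F (consStream a x) ∂streamLaw ν ∂ν := by
  conv_lhs => rw [← map_consStream_streamLaw]
  rw [lintegral_map hF (by fun_prop), lintegral_prod _ (by fun_prop)]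

end Stream

/-! ### Forests with immigration -/

/-- Gaps between the levels of immigration with the words of the immigrants, and the words of the
tables that are present. -/
abbrev Config : Type := (ℕ → ℝ≥0∞ × Word) × List Block

/-- The level of the first event. -/
noncomputable def configClock (d : Config) : ℝ≥0∞ := min (d.1 0).1 (forestClock d.2)

/-- The configuration above the level of the first event. -/
noncomputable def configNext (d : Config) : Config :=
  if (d.1 0).1 < forestClock d.2 then
    (tailStream d.1, (1, (d.1 0).2) :: forestShift (d.1 0).1.toReal d.2)
  else (consStream ((d.1 0).1 - forestClock d.2, (d.1 0).2) (tailStream d.1), forestNext d.2)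

theorem measurable_configClock : Measurable configClock := by unfold configClock; fun_prop

@[fun_prop]
theorem Measurable.configClock {β : Type*} [MeasurableSpace β] {g : β → Config}
    (hg : Measurable g) : Measurable fun b => configClock (g b) := measurable_configClock.comp hg

theorem measurable_configNext : Measurable configNext :=
  Measurable.ite (measurableSet_lt (f := fun d : Config => (d.1 0).1)
    (g := fun d => forestClock d.2) (by fun_prop) (by fun_prop)) (by fun_prop) (by fun_prop)

@[fun_prop]
theorem Measurable.configNext {β : Type*} [MeasurableSpace β] {g : β → Config}
    (hg : Measurable g) : Measurable fun b => configNext (g b) := measurable_configNext.comp hg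

/-- The law of a forest above the composition `c`, with immigration at rate `θ`. -/
noncomputable def configLaw (α θ : ℝ) (c : List ℕ+) : Measure Config :=
  (streamLaw ((expLaw θ).prod (excursionLaw α 1))).prod (forestLaw α c)

/-! ### The first event of a forest with immigration -/

section ConfigStep

variable {α θ : ℝ} [∀ n, IsProbabilityMeasure (excursionLaw α n)]

theorem lintegral_stream_cons {F : (ℕ → ℝ≥0∞ × Word) → ℝ≥0∞} (hF : Measurable F) :
    ∫⁻ g, F g ∂streamLaw ((expLaw θ).prod (excursionLaw α 1)) =
      ∫⁻ h, ∫⁻ w, ∫⁻ g, F (consStream (h, w) g)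
        ∂streamLaw ((expLaw θ).prod (excursionLaw α 1)) ∂excursionLaw α 1 ∂expLaw θ := by
  rw [lintegral_streamLaw_cons _ hF, lintegral_prod]
  have : Measurable fun p : (ℝ≥0∞ × Word) × (ℕ → ℝ≥0∞ × Word) => F (consStream p.1 p.2) := by
    fun_prop
  exact this.lintegral_prod_right'.aemeasurable

/-- A race between the first gap, of rate `θ`, and the clock of the forest. If the gap wins, an
excursion from size one is placed leftmost and the forest loses its memory; otherwise the forest
makes its step and the rest of the gap is again exponential. -/
theorem lintegral_configNext (hθ : 0 < θ) (c : List ℕ+) {f : ℝ × Config → ℝ≥0∞}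
    (hf : Measurable f) :
    ∫⁻ d, {d | configClock d < ∞}.indicator
      (fun d => f ((configClock d).toReal, configNext d)) d ∂configLaw α θ c =
    ∫⁻ t in Set.Ioi 0, ENNReal.ofReal (Real.exp (-((2 * compSize c + θ) * t))) *
      (ENNReal.ofReal θ * ∫⁻ d, f (t, d) ∂configLaw α θ (1 :: c) +
        sumOver (transitions α c) fun c' => ∫⁻ d, f (t, d) ∂configLaw α θ c') := by
  classical
  set S := streamLaw ((expLaw θ).prod (excursionLaw α 1)) with hS
  set A : Config → ℝ≥0∞ := fun d => {d : Config | (d.1 0).1 < forestClock d.2}.indicator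
    (fun d => f ((d.1 0).1.toReal,
      (tailStream d.1, (1, (d.1 0).2) :: forestShift (d.1 0).1.toReal d.2))) d with hA
  set B : Config → ℝ≥0∞ := fun d =>
    {d : Config | forestClock d.2 ≤ (d.1 0).1 ∧ forestClock d.2 < ∞}.indicator
    (fun d => f ((forestClock d.2).toReal,
      (consStream ((d.1 0).1 - forestClock d.2, (d.1 0).2) (tailStream d.1), forestNext d.2))) d
    with hB
  have hAm : Measurable A := by
    refine Measurable.indicator ?_ (measurableSet_lt (by fun_prop) (by fun_prop))
    fun_prop
  have hBm : Measurable B := by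
    refine Measurable.indicator (by fun_prop) ?_
    exact (measurableSet_le (f := fun d : Config => forestClock d.2)
      (g := fun d => (d.1 0).1) (by fun_prop) (by fun_prop)).inter
      (measurableSet_lt (f := fun d : Config => forestClock d.2) (by fun_prop) measurable_const)
  have e1 : ∀ d, {d | configClock d < ∞}.indicator
      (fun d => f ((configClock d).toReal, configNext d)) d = A d + B d := by
    intro d
    simp only [hA, hB, Set.indicator_apply, Set.mem_ofPred_eq, configClock, configNext]
    by_cases h : (d.1 0).1 < forestClock d.2
    · have h1 : (d.1 0).1 < ∞ := h.trans_le le_top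
      simp [h, h1, h.le, h.not_ge]
    · push Not at h
      by_cases h2 : forestClock d.2 < ∞
      · simp [h, h2, h.not_gt]
      · simp only [not_lt, top_le_iff] at h2
        have h3 : (d.1 0).1 = ∞ := top_le_iff.1 (h2 ▸ h)
        simp [h2, h3]
  have hcfg (t : ℝ) (c : List ℕ+) : ∫⁻ d, f (t, d) ∂configLaw α θ c =
      ∫⁻ x, ∫⁻ g, f (t, (g, x)) ∂S ∂forestLaw α c := by
    rw [configLaw, lintegral_prod_symm' _ (by fun_prop)]
  simp_rw [e1]
  rw [lintegral_add_left hAm]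
  simp only [mul_add]
  have hint (c : List ℕ+) : Measurable fun t => ∫⁻ d, f (t, d) ∂configLaw α θ c := by
    have : SFinite (configLaw α θ c) := by unfold configLaw; infer_instance
    exact hf.lintegral_prod_right'
  have hadd : Measurable fun t => ENNReal.ofReal (Real.exp (-((2 * compSize c + θ) * t))) *
      (ENNReal.ofReal θ * ∫⁻ d, f (t, d) ∂configLaw α θ (1 :: c)) :=
    Measurable.mul (by fun_prop) ((hint _).const_mul _)
  rw [lintegral_add_left hadd]
  congr 1
  · have m1 : Measurable fun g : ℕ → ℝ≥0∞ × Word => ∫⁻ x, A (g, x) ∂forestLaw α c :=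
      hAm.lintegral_prod_right'
    have m2 : Measurable fun q : (ℝ≥0∞ × Word) × (ℕ → ℝ≥0∞ × Word) =>
        ∫⁻ x, A (consStream q.1 q.2, x) ∂forestLaw α c := by
      have : Measurable fun q : ((ℝ≥0∞ × Word) × (ℕ → ℝ≥0∞ × Word)) × List Block =>
        A (consStream q.1.1 q.1.2, q.2) := hAm.comp (by fun_prop)
      exact this.lintegral_prod_right'
    have m3 : Measurable fun h : ℝ≥0∞ => ∫⁻ w, ∫⁻ g, ∫⁻ x, A (consStream (h, w) g, x)
        ∂forestLaw α c ∂S ∂excursionLaw α 1 :=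
      (Measurable.lintegral_prod_right' (f := fun p : ℝ≥0∞ × Word =>
        ∫⁻ g, ∫⁻ x, A (consStream p g, x) ∂forestLaw α c ∂S) m2.lintegral_prod_right')
    rw [configLaw, lintegral_prod _ hAm.aemeasurable, lintegral_stream_cons m1,
      lintegral_expLaw_of_pos hθ m3]
    refine setLIntegral_congr_fun measurableSet_Ioi fun t ht => ?_
    have ht : (0 : ℝ) < t := ht
    have e : Real.exp (-((2 * compSize c + θ) * t)) =
        Real.exp (-(θ * t)) * Real.exp (-(2 * compSize c * t)) := by
      rw [← Real.exp_add]; congr 1; ring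
    rw [e, ENNReal.ofReal_mul (Real.exp_pos _).le, hcfg, lintegral_forestLaw_cons]
    swap
    · have : Measurable fun q : List Block × (ℕ → ℝ≥0∞ × Word) => f (t, (q.2, q.1)) := by fun_prop
      exact this.lintegral_prod_right'
    have hm3 : Measurable fun q : Word × List Block =>
        ∫⁻ g, f (t, (g, ((1 : ℕ+), q.1) :: q.2)) ∂S := by
      have : Measurable fun q : (Word × List Block) × (ℕ → ℝ≥0∞ × Word) =>
        f (t, (q.2, ((1 : ℕ+), q.1.1) :: q.1.2)) := by fun_prop
      exact this.lintegral_prod_right'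
    have key : ∀ w, ∫⁻ g, ∫⁻ x, A (consStream (ENNReal.ofReal t, w) g, x) ∂forestLaw α c ∂S =
        ENNReal.ofReal (Real.exp (-(2 * compSize c * t))) *
          ∫⁻ x, ∫⁻ g, f (t, (g, ((1 : ℕ+), w) :: x)) ∂S ∂forestLaw α c := by
      intro w
      have hfw : Measurable fun q : (ℕ → ℝ≥0∞ × Word) × List Block =>
        f (t, (q.1, ((1 : ℕ+), w) :: q.2)) := by fun_prop
      rw [lintegral_lintegral_swap (f := fun x g => f (t, (g, ((1 : ℕ+), w) :: x)))
        (hfw.comp measurable_swap).aemeasurable,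
        ← lintegral_const_mul _ hfw.lintegral_prod_right']
      congr 1; ext g
      rw [← lintegral_forestLaw_lt_clock c ht.le
        (F := fun x => f (t, (g, ((1 : ℕ+), w) :: x))) (by fun_prop)]
      congr 1; ext x
      simp [hA, Set.indicator_apply, ENNReal.toReal_ofReal ht.le]
    simp_rw [key]
    rw [lintegral_const_mul _ hm3.lintegral_prod_right']
    simp only [PNat.val_ofNat]
    ring
  · rw [configLaw, lintegral_prod_symm' _ hBm]
    -- `f'` has the immigration integrated out, given that the first gap outlasts the forest event:
    -- the survival probability of the gap remains as a factor, and the stream beyond it is fresh.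
    set f' : ℝ × List Block → ℝ≥0∞ := fun q => ENNReal.ofReal (Real.exp (-(θ * q.1))) *
      ∫⁻ g, f (q.1, (g, q.2)) ∂S with hf'
    have hf'm : Measurable f' := by
      refine Measurable.mul (by fun_prop) ?_
      have : Measurable fun q : (ℝ × List Block) × (ℕ → ℝ≥0∞ × Word) =>
        f (q.1.1, (q.2, q.1.2)) := by fun_prop
      exact this.lintegral_prod_right'
    have key : ∀ x, ∫⁻ g, B (g, x) ∂S = {x | forestClock x < ∞}.indicator
        (fun x => f' ((forestClock x).toReal, forestNext x)) x := by
      intro x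
      by_cases hx : forestClock x < ∞
      swap
      · simp [hB, hx]
      have hx' : x ∈ {x | forestClock x < ∞} := hx
      rw [Set.indicator_of_mem hx']
      set t := (forestClock x).toReal with ht
      have hft : forestClock x = ENNReal.ofReal t := by rw [ht, ENNReal.ofReal_toReal hx.ne]
      have hff : Measurable fun g : ℕ → ℝ≥0∞ × Word => f (t, (g, forestNext x)) := by fun_prop
      have hm1 : Measurable fun q : (ℝ≥0∞ × Word) × (ℕ → ℝ≥0∞ × Word) =>
          f (t, (consStream q.1 q.2, forestNext x)) := by fun_prop
      have hm2 : Measurable fun h : ℝ≥0∞ => ∫⁻ w, ∫⁻ g,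
          f (t, (consStream (h, w) g, forestNext x)) ∂S ∂excursionLaw α 1 :=
        Measurable.lintegral_prod_right' (f := fun p : ℝ≥0∞ × Word =>
          ∫⁻ g, f (t, (consStream p g, forestNext x)) ∂S) hm1.lintegral_prod_right'
      have hBx : Measurable fun g => B (g, x) := hBm.comp measurable_prodMk_right
      rw [lintegral_stream_cons hBx]
      simp only [hf']
      rw [lintegral_stream_cons hff, ← lintegral_expLaw_le hθ ENNReal.toReal_nonneg hm2]
      congr 1; ext h
      by_cases hh : ENNReal.ofReal t ≤ h
      · have hh' : h ∈ {h | ENNReal.ofReal t ≤ h} := hh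
        rw [Set.indicator_of_mem hh']
        congr 1; ext w; congr 1; ext g
        have hmem : (consStream (h, w) g, x) ∈
            {d : Config | forestClock d.2 ≤ (d.1 0).1 ∧ forestClock d.2 < ∞} :=
          ⟨hft.trans_le hh, hx⟩
        simp only [hB]
        rw [Set.indicator_of_mem hmem, ← ht, ← hft]
        rfl
      · have hh' : h ∉ {h | ENNReal.ofReal t ≤ h} := hh
        rw [Set.indicator_of_notMem hh']
        have hz : ∀ w g, B (consStream (h, w) g, x) = 0 := fun w g => by
          simp only [hB]
          exact Set.indicator_of_notMem (fun hm => hh (hft.symm.trans_le hm.1)) _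
        simp [hz]
    simp_rw [← hS, key]
    rw [lintegral_forestNext c hf'm]
    refine setLIntegral_congr_fun measurableSet_Ioi fun t ht => ?_
    have e : Real.exp (-((2 * compSize c + θ) * t)) =
        Real.exp (-(2 * compSize c * t)) * Real.exp (-(θ * t)) := by
      rw [← Real.exp_add]; congr 1; ring
    rw [e, ENNReal.ofReal_mul (Real.exp_pos _).le, mul_assoc (ENNReal.ofReal _),
      ← sumOver_const_mul _ (ENNReal.ofReal (Real.exp (-(θ * t))))]
    congr 1; refine congrArg _ (funext fun c' => ?_)
    rw [hcfg, ← lintegral_const_mul]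
    have : Measurable fun q : List Block × (ℕ → ℝ≥0∞ × Word) => f (t, (q.2, q.1)) := by fun_prop
    exact this.lintegral_prod_right'

end ConfigStep

/-! ### Cylinder probabilities from a one-step description -/

section Cylinder

variable {S E : Type*} [MeasurableSpace E] {q : S → S → ℝ}

theorem measurableSet_cylinder {state : E → S} {clock : E → ℝ≥0∞} {next : E → E}
    (hstate : ∀ y, MeasurableSet {d | state d = y}) (hclock : Measurable clock)
    (hnext : Measurable next) (n : ℕ) (y : ℕ → S) (t : ℕ → ℝ≥0) :
    MeasurableSet {d | ∀ m ≤ n, state (next^[m] d) = y m ∧ (t m : ℝ≥0∞) < clock (next^[m] d)} := by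
  have : {d | ∀ m ≤ n, state (next^[m] d) = y m ∧ (t m : ℝ≥0∞) < clock (next^[m] d)} =
      ⋂ m ≤ n, ((next^[m]) ⁻¹' {d | state d = y m}) ∩ {d | (t m : ℝ≥0∞) < clock (next^[m] d)} := by
    ext d; simp
  rw [this]
  refine MeasurableSet.iInter fun m => MeasurableSet.iInter fun _ => ?_
  exact (hnext.iterate m (hstate _)).inter
    (measurableSet_lt measurable_const (hclock.comp (hnext.iterate m)))

/-- Induction on the number of jumps. The hypothesis `step` removes the first holding time and the
first jump, and what remains is a shorter cylinder under the law started from the next state. -/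
theorem measure_cylinder {law : S → Measure E}
    {state : E → S} {clock : E → ℝ≥0∞} {next : E → E}
    (hstate : ∀ y, MeasurableSet {d | state d = y}) (hclock : Measurable clock)
    (hnext : Measurable next) [∀ c, IsProbabilityMeasure (law c)]
    (hae : ∀ c, ∀ᵐ d ∂law c, state d = c) (hnn : ∀ c c', 0 ≤ jumpProb q c c')
    (hsum : ∀ c, ∑' c', ENNReal.ofReal (jumpProb q c c') = 1)
    (step : ∀ c (t : ℝ≥0) (A : Set E), MeasurableSet A →
      law c {d | (t : ℝ≥0∞) < clock d ∧ next d ∈ A} =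
        ENNReal.ofReal (Real.exp (-(totalRate q c * t))) *
          ∑' c', ENNReal.ofReal (jumpProb q c c') * law c' A)
    (n : ℕ) (y : ℕ → S) (t : ℕ → ℝ≥0) :
    law (y 0) {d | ∀ m ≤ n, state (next^[m] d) = y m ∧ (t m : ℝ≥0∞) < clock (next^[m] d)} =
      ENNReal.ofReal ((∏ m ∈ Finset.range n, jumpProb q (y m) (y (m + 1))) *
        ∏ m ∈ Finset.range (n + 1), Real.exp (-(totalRate q (y m) * t m))) := by
  induction n generalizing y t with
  | zero =>
    have h := step (y 0) (t 0) Set.univ MeasurableSet.univ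
    simp only [measure_univ, mul_one, hsum, Set.mem_univ, and_true] at h
    simp only [Finset.range_zero, Finset.prod_empty, one_mul, zero_add, Finset.range_one,
      Finset.prod_singleton]
    rw [← h]
    refine measure_congr ?_
    filter_upwards [hae (y 0)] with d hd
    refine propext ⟨fun h => (h 0 le_rfl).2, fun h m hm => ?_⟩
    obtain rfl : m = 0 := by omega
    exact ⟨hd, h⟩
  | succ n ih =>
    set A : Set E := {d | ∀ m ≤ n, state (next^[m] d) = y (m + 1) ∧
      (t (m + 1) : ℝ≥0∞) < clock (next^[m] d)} with hA
    have hAm : MeasurableSet A :=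
      measurableSet_cylinder hstate hclock hnext n (fun m => y (m + 1)) fun m => t (m + 1)
    have h := step (y 0) (t 0) A hAm
    -- The law started from `c'` has initial state `c'`, so only the prescribed next state `y 1`
    -- survives in the sum.
    have h0 : ∀ c', c' ≠ y 1 → law c' A = 0 := by
      intro c' hc'
      refine measure_mono_null (t := {d | ¬ state d = c'}) (fun d hd hd' => hc' ?_) (hae c')
      have := (hd 0 (Nat.zero_le _)).1
      simp only [Function.iterate_zero, id, zero_add] at this
      rw [← hd', this]
    rw [tsum_eq_single (y 1) fun c' hc' => by rw [h0 c' hc', mul_zero],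
      ih (fun m => y (m + 1)) fun m => t (m + 1)] at h
    have e : (∏ m ∈ Finset.range (n + 1), jumpProb q (y m) (y (m + 1))) *
        ∏ m ∈ Finset.range (n + 1 + 1), Real.exp (-(totalRate q (y m) * t m)) =
        Real.exp (-(totalRate q (y 0) * t 0)) * (jumpProb q (y 0) (y 1) *
          ((∏ m ∈ Finset.range n, jumpProb q (y (m + 1)) (y (m + 1 + 1))) *
            ∏ m ∈ Finset.range (n + 1), Real.exp (-(totalRate q (y (m + 1)) * t (m + 1))))) := by
      rw [Finset.prod_range_succ', Finset.prod_range_succ' _ (n + 1)]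
      ring
    rw [e, ENNReal.ofReal_mul (Real.exp_pos _).le, ENNReal.ofReal_mul (hnn _ _), ← h]
    refine measure_congr ?_
    filter_upwards [hae (y 0)] with d hd
    refine propext ⟨fun h => ⟨(h 0 (Nat.zero_le _)).2, fun m hm => ?_⟩, fun h m hm => ?_⟩
    · exact h (m + 1) (by omega)
    · cases m with
      | zero => exact ⟨hd, h.1⟩
      | succ m => exact h.2 m (by omega)

end Cylinder

/-! ### The rates of the up-down chain -/

section Rates

variable {α θ : ℝ}

/-- `transitions` is recursive in the composition, as the splitting of a forest requires, whereas
`upDownRate` sums over positions. This identifies the two. -/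
theorem sumOver_transitions (c : List ℕ+) (g : List ℕ+ → ℝ≥0∞) :
    sumOver (transitions α c) g =
      ∑ i : Fin c.length, (ENNReal.ofReal (((c.get i : ℕ) : ℝ) - α) * g (c.set i (c.get i + 1)) +
        ENNReal.ofReal (c.get i : ℕ) *
          g (if c.get i = 1 then c.eraseIdx i else c.set i (c.get i - 1)) +
        ENNReal.ofReal α * g (c.insertIdx ((i : ℕ) + 1) 1)) := by
  induction c generalizing g with
  | nil => simp [transitions]
  | cons n c ih =>
    rw [transitions, sumOver_append, sumOver_map _ fun d => d ++ c, sumOver_map _ fun d => n :: d,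
      ih]
    refine Eq.trans ?_ (Fin.sum_univ_succ (n := c.length) _).symm
    congr 1
    · simp only [tableTransitions, sumOver_cons, sumOver_nil, add_zero]
      by_cases h : n = 1 <;> simp [h, add_assoc]
    · refine Finset.sum_congr rfl fun i _ => ?_
      by_cases h : c.get i = 1 <;> simp_all

/-- Each transition changes the total size by exactly one. Hence none of them is a loop, so that the
diagonal ignored by `totalRate` is really zero, and rates grow slowly enough to prevent explosion.
-/
theorem compSize_transitions {c : List ℕ+} : ∀ p ∈ transitions α c,
    compSize p.2 = compSize c + 1 ∨ compSize p.2 + 1 = compSize c := by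
  induction c with
  | nil => simp [transitions]
  | cons n c ih =>
    intro p hp
    rw [transitions, List.mem_append, List.mem_map, List.mem_map] at hp
    rcases hp with ⟨p', hp', rfl⟩ | ⟨p', hp', rfl⟩
    · simp only [tableTransitions, List.mem_cons, List.not_mem_nil, or_false] at hp'
      rcases hp' with rfl | rfl | rfl
      · left; simp [compSize]; ring
      · right
        by_cases h : n = 1
        · simp [h, compSize]; ring
        · have h1 : 1 < n := lt_of_le_of_ne one_le (Ne.symm h)
          have h2 : 1 < (n : ℕ) := h1
          simp [h, compSize, PNat.sub_coe, h1]; omega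
      · left; simp [compSize]; ring
    · have := ih p' hp'
      simp only [compSize_cons]
      omega

/-- A table of size `n` contributes `(n - α) + n + α = 2 * n`, so `α` cancels from the total rate.
-/
theorem sumOver_transitions_one (hα₀ : 0 ≤ α) (hα₁ : α ≤ 1) (c : List ℕ+) :
    sumOver (transitions α c) (fun _ => 1) = ENNReal.ofReal (2 * compSize c) := by
  induction c with
  | nil => simp [transitions, compSize]
  | cons n c ih =>
    have hn : (1 : ℝ) ≤ (n : ℕ) := by exact_mod_cast n.pos
    rw [transitions, sumOver_append, sumOver_map _ fun d => d ++ c, sumOver_map _ fun d => n :: d,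
      ih, compSize_cons]
    simp only [tableTransitions, sumOver_cons, sumOver_nil, add_zero, mul_one]
    rw [← ENNReal.ofReal_add (by positivity) hα₀, ← ENNReal.ofReal_add (by linarith) (by positivity),
      ← ENNReal.ofReal_add (by linarith) (by positivity)]
    congr 1; push_cast; ring

theorem upDownRate_nonneg (hα₀ : 0 ≤ α) (hα₁ : α ≤ 1) (hθ : 0 ≤ θ) (c c' : List ℕ+) :
    0 ≤ upDownRate α θ c c' := by
  have hn (n : ℕ+) : (1 : ℝ) ≤ (n : ℕ) := by exact_mod_cast n.pos
  unfold upDownRate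
  refine add_nonneg (add_nonneg (add_nonneg ?_ ?_) ?_) ?_
  · exact Finset.sum_nonneg fun i _ => by split_ifs <;> linarith [hn (c.get i)]
  · exact Finset.sum_nonneg fun i _ => by split_ifs <;> linarith
  · split_ifs <;> linarith
  · exact Finset.sum_nonneg fun i _ => by split_ifs <;> linarith [hn (c.get i)]

theorem ofReal_upDownRate (hα₀ : 0 ≤ α) (hα₁ : α ≤ 1) (hθ : 0 ≤ θ) (c c' : List ℕ+) :
    ENNReal.ofReal (upDownRate α θ c c') =
      ENNReal.ofReal θ * (if c' = 1 :: c then 1 else 0) +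
        sumOver (transitions α c) fun d => if c' = d then 1 else 0 := by
  have hn (n : ℕ+) : (1 : ℝ) ≤ (n : ℕ) := by exact_mod_cast n.pos
  have h1 : ∀ i ∈ Finset.univ, (0 : ℝ) ≤ if c' = c.set (i : Fin c.length) (c.get i + 1)
      then ((c.get i : ℕ) : ℝ) - α else 0 := fun i _ => by split_ifs <;> linarith [hn (c.get i)]
  have h2 : ∀ i ∈ Finset.univ, (0 : ℝ) ≤ if c' = c.insertIdx (((i : Fin c.length) : ℕ) + 1) 1
      then α else 0 := fun i _ => by split_ifs <;> linarith
  have h3 : (0 : ℝ) ≤ if c' = 1 :: c then θ else 0 := by split_ifs <;> linarith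
  have h4 : ∀ i ∈ Finset.univ, (0 : ℝ) ≤
      if c' = (if c.get (i : Fin c.length) = 1 then c.eraseIdx i else c.set i (c.get i - 1))
      then ((c.get i : ℕ) : ℝ) else 0 := fun i _ => by split_ifs <;> linarith [hn (c.get i)]
  rw [upDownRate, ENNReal.ofReal_add (add_nonneg (add_nonneg (Finset.sum_nonneg h1)
    (Finset.sum_nonneg h2)) h3) (Finset.sum_nonneg h4), ENNReal.ofReal_add
    (add_nonneg (Finset.sum_nonneg h1) (Finset.sum_nonneg h2)) h3,
    ENNReal.ofReal_add (Finset.sum_nonneg h1) (Finset.sum_nonneg h2),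
    ENNReal.ofReal_sum_of_nonneg h1, ENNReal.ofReal_sum_of_nonneg h2,
    ENNReal.ofReal_sum_of_nonneg h4, sumOver_transitions, Finset.sum_add_distrib,
    Finset.sum_add_distrib]
  have e (p : Prop) [Decidable p] (r : ℝ) : ENNReal.ofReal (if p then r else 0) =
    ENNReal.ofReal r * (if p then 1 else 0) := by split_ifs <;> simp
  simp only [e]
  ring

theorem tsum_upDownRate (hα₀ : 0 ≤ α) (hα₁ : α ≤ 1) (hθ : 0 ≤ θ) (c : List ℕ+)
    (g : List ℕ+ → ℝ≥0∞) :
    ∑' c', ENNReal.ofReal (upDownRate α θ c c') * g c' =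
      ENNReal.ofReal θ * g (1 :: c) + sumOver (transitions α c) g := by
  simp_rw [ofReal_upDownRate hα₀ hα₁ hθ, add_mul]
  rw [ENNReal.tsum_add]
  congr 1
  · rw [tsum_eq_single (1 :: c)]
    · simp
    · intro c' hc'; simp [hc']
  · generalize transitions α c = L
    induction L with
    | nil => simp
    | cons p L ih =>
      simp only [sumOver_cons, add_mul]
      rw [ENNReal.tsum_add, ih, tsum_eq_single p.2]
      · simp
      · intro c' hc'; simp [hc']

theorem upDownRate_self (hα₀ : 0 ≤ α) (hα₁ : α ≤ 1) (hθ : 0 ≤ θ) (c : List ℕ+) :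
    upDownRate α θ c c = 0 := by
  refine le_antisymm (ENNReal.ofReal_eq_zero.1 ?_) (upDownRate_nonneg hα₀ hα₁ hθ c c)
  rw [ofReal_upDownRate hα₀ hα₁ hθ]
  have h1 : c ≠ 1 :: c := fun h => by simpa using congrArg List.length h
  rw [if_neg h1, mul_zero, zero_add, ← le_zero_iff]
  calc _ ≤ sumOver (transitions α c) fun _ => 0 := sumOver_mono fun p hp => by
        rw [if_neg]
        rintro h
        have := compSize_transitions p hp
        rw [← h] at this
        omega
    _ = 0 := by simp [sumOver]

theorem tsum_ofReal_upDownRate (hα₀ : 0 ≤ α) (hα₁ : α ≤ 1) (hθ : 0 ≤ θ) (c : List ℕ+) :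
    ∑' c', ENNReal.ofReal (upDownRate α θ c c') = ENNReal.ofReal (2 * compSize c + θ) := by
  have := tsum_upDownRate hα₀ hα₁ hθ c fun _ => 1
  simp only [mul_one] at this
  rw [this, sumOver_transitions_one hα₀ hα₁, ← ENNReal.ofReal_add hθ (by positivity), add_comm]

theorem totalRate_upDownRate (hα₀ : 0 ≤ α) (hα₁ : α ≤ 1) (hθ : 0 ≤ θ) (c : List ℕ+) :
    totalRate (upDownRate α θ) c = 2 * compSize c + θ := by
  classical
  have h1 : totalRate (upDownRate α θ) c = ∑' c', upDownRate α θ c c' := by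
    unfold totalRate
    refine tsum_congr fun c' => ?_
    split_ifs with h
    · rw [h, upDownRate_self hα₀ hα₁ hθ]
    · rfl
  have h2 := congrArg ENNReal.toReal (tsum_ofReal_upDownRate hα₀ hα₁ hθ c)
  rw [ENNReal.tsum_toReal_eq fun _ => ENNReal.ofReal_ne_top,
    ENNReal.toReal_ofReal (by positivity)] at h2
  rw [h1, ← h2]
  exact tsum_congr fun c' => (ENNReal.toReal_ofReal (upDownRate_nonneg hα₀ hα₁ hθ c c')).symm

theorem jumpProb_upDownRate (hα₀ : 0 ≤ α) (hα₁ : α ≤ 1) (hθ : 0 < θ) (c c' : List ℕ+) :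
    jumpProb (upDownRate α θ) c c' = upDownRate α θ c c' / (2 * compSize c + θ) := by
  have h : totalRate (upDownRate α θ) c ≠ 0 := by
    rw [totalRate_upDownRate hα₀ hα₁ hθ.le]; positivity
  unfold jumpProb
  rw [if_neg h, totalRate_upDownRate hα₀ hα₁ hθ.le]
  split_ifs with h1
  · rw [h1, upDownRate_self hα₀ hα₁ hθ.le, zero_div]
  · rfl

end Rates

/-! ### The chain of table sizes in a forest with immigration -/

section ConfigChain

variable {α θ : ℝ} [∀ n, IsProbabilityMeasure (excursionLaw α n)]

instance (c : List ℕ+) : IsProbabilityMeasure (forestLaw α c) := by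
  induction c with
  | nil => unfold forestLaw; infer_instance
  | cons n c ih => exact ⟨by rw [forestLaw_univ_cons, measure_univ, measure_univ, one_mul]⟩

instance (c : List ℕ+) : IsProbabilityMeasure (configLaw α θ c) := by
  unfold configLaw; infer_instance

/-- The composition of the sizes of the tables that are present. -/
def configSizes (d : Config) : List ℕ+ := blockSizes d.2

theorem measurable_configSizes : Measurable configSizes :=
  measurable_blockSizes.comp measurable_snd

theorem ae_forestLaw_blockSizes (c : List ℕ+) : ∀ᵐ x ∂forestLaw α c, blockSizes x = c := by
  induction c with
  | nil =>
    have hm : MeasurableSet {x : List Block | blockSizes x = []} :=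
      measurable_blockSizes (measurableSet_singleton _)
    rw [forestLaw, ae_dirac_iff hm]
    rfl
  | cons n c ih =>
    have hm : MeasurableSet {x : List Block | blockSizes x = n :: c} :=
      measurable_blockSizes (measurableSet_singleton _)
    rw [forestLaw, ae_map_iff (by fun_prop) hm]
    filter_upwards [Measure.quasiMeasurePreserving_snd.ae ih] with p hp
    simpa [blockSizes] using hp

theorem ae_configLaw_configSizes (c : List ℕ+) : ∀ᵐ d ∂configLaw α θ c, configSizes d = c :=
  Measure.quasiMeasurePreserving_snd.ae (ae_forestLaw_blockSizes c)

/-- Words in the support of the law of an excursion. -/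
def GoodWord (α : ℝ) (n : ℕ) (w : Word) : Prop := weight α n 0 w ≠ 0 ∧ ∀ x ∈ w, 0 < x.1

theorem measurableSet_goodWord : MeasurableSet {p : ℕ × Word | GoodWord α p.1 p.2} := by
  refine MeasurableSet.inter (measurableSet_eq_fun ?_ measurable_const).compl ?_
  · fun_prop
  · exact (measurableSet_list_forall_mem (s := {x : Letter | 0 < x.1})
      (measurableSet_lt measurable_const measurable_fst)).preimage measurable_snd

theorem ae_goodWord (n : ℕ) : ∀ᵐ w ∂excursionLaw α n, GoodWord α n w := by
  filter_upwards [ae_excursionLaw_weight_ne_zero n, ae_excursionLaw_of_ae ae_forall_pos]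
    with w h1 h2 using ⟨h1, h2⟩

/-- Configurations in the support of their law. -/
def GoodConfig (α : ℝ) (d : Config) : Prop :=
  (∀ k, 0 < (d.1 k).1 ∧ (d.1 k).1 < ∞ ∧ GoodWord α 1 (d.1 k).2) ∧
    ∀ p ∈ d.2, GoodWord α (p.1 : ℕ) p.2

theorem measurableSet_goodBlocks :
    MeasurableSet {x : List Block | ∀ p ∈ x, GoodWord α (p.1 : ℕ) p.2} := by
  refine measurableSet_list_forall_mem (s := {p : Block | GoodWord α (p.1 : ℕ) p.2}) ?_
  exact measurableSet_goodWord.preimage (f := fun p : Block => ((p.1 : ℕ), p.2))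
    ((measurable_of_countable _ |>.comp measurable_fst).prodMk measurable_snd)

theorem measurableSet_goodConfig : MeasurableSet {d : Config | GoodConfig α d} := by
  have h1 : {d : Config | GoodConfig α d} =
      (⋂ k, {d : Config | 0 < (d.1 k).1} ∩ ({d : Config | (d.1 k).1 < ∞} ∩
        {d : Config | GoodWord α 1 (d.1 k).2})) ∩
      {d : Config | ∀ p ∈ d.2, GoodWord α (p.1 : ℕ) p.2} := by
    ext d; simp [GoodConfig]
  rw [h1]
  refine MeasurableSet.inter (MeasurableSet.iInter fun k => MeasurableSet.inter ?_
    (MeasurableSet.inter ?_ ?_)) ?_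
  · exact measurableSet_lt measurable_const (by fun_prop)
  · exact measurableSet_lt (by fun_prop) measurable_const
  · exact measurableSet_goodWord.preimage (f := fun d : Config => ((1 : ℕ), (d.1 k).2)) (by fun_prop)
  · exact measurableSet_goodBlocks.preimage measurable_snd

theorem ae_forestLaw_good (c : List ℕ+) :
    ∀ᵐ x ∂forestLaw α c, ∀ p ∈ x, GoodWord α (p.1 : ℕ) p.2 := by
  induction c with
  | nil =>
    rw [forestLaw, ae_dirac_iff measurableSet_goodBlocks]
    simp
  | cons n c ih =>
    rw [forestLaw, ae_map_iff (by fun_prop) measurableSet_goodBlocks]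
    filter_upwards [Measure.quasiMeasurePreserving_snd.ae ih,
      Measure.quasiMeasurePreserving_fst.ae (ae_goodWord (n : ℕ))] with p hp hp'
    simp only [List.mem_cons, forall_eq_or_imp]
    exact ⟨hp', hp⟩

theorem ae_goodConfig (hθ : 0 < θ) (c : List ℕ+) : ∀ᵐ d ∂configLaw α θ c, GoodConfig α d := by
  have h1 : ∀ᵐ p ∂(expLaw θ).prod (excursionLaw α 1), 0 < p.1 ∧ p.1 < ∞ ∧ GoodWord α 1 p.2 := by
    filter_upwards [Measure.quasiMeasurePreserving_fst.ae (ae_expLaw_pos θ),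
      Measure.quasiMeasurePreserving_fst.ae (ae_expLaw_lt_top hθ),
      Measure.quasiMeasurePreserving_snd.ae (ae_goodWord 1)] with p a b c using ⟨a, b, c⟩
  have h2 : ∀ᵐ g ∂streamLaw ((expLaw θ).prod (excursionLaw α 1)),
      ∀ k, 0 < (g k).1 ∧ (g k).1 < ∞ ∧ GoodWord α 1 (g k).2 := by
    rw [ae_all_iff]
    intro k
    exact (measurePreserving_eval_infinitePi
      (fun _ : ℕ => (expLaw θ).prod (excursionLaw α 1)) k).quasiMeasurePreserving.ae h1
  filter_upwards [Measure.quasiMeasurePreserving_fst.ae h2,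
    Measure.quasiMeasurePreserving_snd.ae (ae_forestLaw_good c)] with d a b using ⟨a, b⟩

theorem ae_configClock_lt_top (hθ : 0 < θ) (c : List ℕ+) :
    ∀ᵐ d ∂configLaw α θ c, configClock d < ∞ := by
  filter_upwards [ae_goodConfig hθ c] with d hd using min_lt_of_left_lt (hd.1 0).2.1

/-- In `lintegral_configNext`, applied to the indicator of the failure of `P`, every term on the
right is an integral over a null event. -/
theorem ae_configNext (hθ : 0 < θ) {P : Config → Prop} (hP : MeasurableSet {d | P d})
    (h : ∀ c, ∀ᵐ d ∂configLaw α θ c, P d) (c : List ℕ+) :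
    ∀ᵐ d ∂configLaw α θ c, P (configNext d) := by
  classical
  have hm : Measurable fun q : ℝ × Config =>
      {q : ℝ × Config | ¬ P q.2}.indicator (1 : ℝ × Config → ℝ≥0∞) q :=
    measurable_one.indicator (hP.compl.preimage measurable_snd)
  have hz (t : ℝ) (c : List ℕ+) : ∫⁻ d, {q : ℝ × Config | ¬ P q.2}.indicator (1 : ℝ × Config → ℝ≥0∞) (t, d)
      ∂configLaw α θ c = 0 := by
    rw [← lintegral_zero (μ := configLaw α θ c)]
    refine lintegral_congr_ae ?_
    filter_upwards [h c] with d hd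
    simp [hd]
  have key := lintegral_configNext (α := α) hθ c hm
  simp only [hz] at key
  have h0 : ∀ L, sumOver L (fun _ => 0) = 0 := fun L => by simp [sumOver]
  simp only [h0, mul_zero, add_zero, lintegral_zero] at key
  rw [lintegral_eq_zero_iff] at key
  · filter_upwards [key, ae_configClock_lt_top hθ c] with d hd hd'
    by_contra hn
    simp [hd', hn] at hd
  · exact (hm.comp (by fun_prop)).indicator (measurableSet_lt (by fun_prop) measurable_const)

theorem ae_iterate_configNext (hθ : 0 < θ) {P : Config → Prop} (hP : MeasurableSet {d | P d})
    (h : ∀ c, ∀ᵐ d ∂configLaw α θ c, P d) (c : List ℕ+) :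
    ∀ᵐ d ∂configLaw α θ c, ∀ m, P (configNext^[m] d) := by
  rw [ae_all_iff]
  intro m
  induction m generalizing P with
  | zero => exact h c
  | succ m ih =>
    simp only [Function.iterate_succ', Function.comp_apply]
    exact ih (P := fun d => P (configNext d)) (measurable_configNext hP) (ae_configNext hθ hP h)

/-- The time and the target of the first event separate in `lintegral_configNext`. Integrating the
exponential density over levels above `t` gives the survival probability divided by the total rate,
and this divisor turns rates into jump probabilities. -/
theorem configLaw_step (hα₀ : 0 ≤ α) (hα₁ : α ≤ 1) (hθ : 0 < θ) (c : List ℕ+) (t : ℝ≥0)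
    (A : Set Config) (hA : MeasurableSet A) :
    configLaw α θ c {d | (t : ℝ≥0∞) < configClock d ∧ configNext d ∈ A} =
      ENNReal.ofReal (Real.exp (-(totalRate (upDownRate α θ) c * t))) *
        ∑' c', ENNReal.ofReal (jumpProb (upDownRate α θ) c c') * configLaw α θ c' A := by
  classical
  set f : ℝ × Config → ℝ≥0∞ := fun q => (Set.Ioi (t : ℝ) ×ˢ A).indicator 1 q with hf
  have hfm : Measurable f := measurable_one.indicator (measurableSet_Ioi.prod hA)
  have hset : MeasurableSet {d | (t : ℝ≥0∞) < configClock d ∧ configNext d ∈ A} :=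
    (measurableSet_lt measurable_const measurable_configClock).inter (measurable_configNext hA)
  have hr : (0 : ℝ) < 2 * compSize c + θ := by positivity
  have hfi (s : ℝ) (c : List ℕ+) : ∫⁻ d, f (s, d) ∂configLaw α θ c =
      (Set.Ioi (t : ℝ)).indicator 1 s * configLaw α θ c A := by
    rw [← lintegral_indicator_one hA, ← lintegral_const_mul _ (measurable_one.indicator hA)]
    congr 1; ext d
    by_cases h1 : (t : ℝ) < s <;> by_cases h2 : d ∈ A <;> simp [hf, h1, h2]
  have key := lintegral_configNext (α := α) hθ c hfm
  have hl : ∫⁻ d, {d | configClock d < ∞}.indicator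
      (fun d => f ((configClock d).toReal, configNext d)) d ∂configLaw α θ c =
      configLaw α θ c {d | (t : ℝ≥0∞) < configClock d ∧ configNext d ∈ A} := by
    rw [← lintegral_indicator_one hset]
    refine lintegral_congr_ae ?_
    filter_upwards [ae_configClock_lt_top hθ c] with d hd
    have hd' : d ∈ {d | configClock d < ∞} := hd
    rw [Set.indicator_of_mem hd']
    have : (t : ℝ) < (configClock d).toReal ↔ (t : ℝ≥0∞) < configClock d := by
      rw [← ENNReal.coe_toReal, ENNReal.toReal_lt_toReal (by simp) hd.ne]
    by_cases h1 : (t : ℝ≥0∞) < configClock d <;> by_cases h2 : configNext d ∈ A <;>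
      simp [hf, this, h1, h2]
  rw [← hl, key]
  simp_rw [hfi, sumOver_const_mul]
  have e : ∀ s : ℝ, ENNReal.ofReal (Real.exp (-((2 * compSize c + θ) * s))) *
      (ENNReal.ofReal θ * ((Set.Ioi (t : ℝ)).indicator 1 s * configLaw α θ (1 :: c) A) +
        (Set.Ioi (t : ℝ)).indicator 1 s *
          sumOver (transitions α c) fun c' => configLaw α θ c' A) =
      (Set.Ioi (t : ℝ)).indicator
        (fun s => ENNReal.ofReal (Real.exp (-((2 * compSize c + θ) * s)))) s *
        ∑' c', ENNReal.ofReal (upDownRate α θ c c') * configLaw α θ c' A := by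
    intro s
    rw [tsum_upDownRate hα₀ hα₁ hθ.le]
    by_cases hs : (t : ℝ) < s <;> simp [hs]
  simp_rw [e]
  rw [lintegral_mul_const _ (Measurable.indicator (by fun_prop) measurableSet_Ioi),
    setLIntegral_indicator measurableSet_Ioi,
    Set.inter_eq_left.2 (Set.Ioi_subset_Ioi t.coe_nonneg), lintegral_exp_neg_Ioi hr,
    totalRate_upDownRate hα₀ hα₁ hθ.le, div_eq_mul_inv, ENNReal.ofReal_mul (Real.exp_pos _).le,
    mul_assoc, ← ENNReal.tsum_mul_left]
  congr 1
  refine tsum_congr fun c' => ?_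
  rw [jumpProb_upDownRate hα₀ hα₁ hθ, div_eq_mul_inv,
    ENNReal.ofReal_mul (upDownRate_nonneg hα₀ hα₁ hθ.le _ _)]
  ring

theorem configLaw_cylinder (hα₀ : 0 ≤ α) (hα₁ : α ≤ 1) (hθ : 0 < θ) (n : ℕ) (y : ℕ → List ℕ+)
    (t : ℕ → ℝ≥0) :
    configLaw α θ (y 0) {d | ∀ m ≤ n, configSizes (configNext^[m] d) = y m ∧
      (t m : ℝ≥0∞) < configClock (configNext^[m] d)} =
      ENNReal.ofReal ((∏ m ∈ Finset.range n, jumpProb (upDownRate α θ) (y m) (y (m + 1))) *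
        ∏ m ∈ Finset.range (n + 1), Real.exp (-(totalRate (upDownRate α θ) (y m) * t m))) := by
  refine measure_cylinder (fun y => measurable_configSizes (measurableSet_singleton y))
    measurable_configClock measurable_configNext ae_configLaw_configSizes (fun c c' => ?_)
    (fun c => ?_) (configLaw_step hα₀ hα₁ hθ) n y t
  · rw [jumpProb_upDownRate hα₀ hα₁ hθ]
    exact div_nonneg (upDownRate_nonneg hα₀ hα₁ hθ.le _ _) (by positivity)
  · have hr : (0 : ℝ) < 2 * compSize c + θ := by positivity
    simp_rw [jumpProb_upDownRate hα₀ hα₁ hθ, div_eq_mul_inv,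
      ENNReal.ofReal_mul (upDownRate_nonneg hα₀ hα₁ hθ.le _ _)]
    rw [ENNReal.tsum_mul_right, tsum_ofReal_upDownRate hα₀ hα₁ hθ.le,
      ← ENNReal.ofReal_mul hr.le, mul_inv_cancel₀ hr.ne', ENNReal.ofReal_one]

/-- The exponential of minus the level of the `n`-th event. -/
noncomputable def configDiscount : ℕ → Config → ℝ≥0∞
  | 0, _ => 1
  | n + 1, d => {d | configClock d < ∞}.indicator
      (fun d => ENNReal.ofReal (Real.exp (-(configClock d).toReal)) *
        configDiscount n (configNext d)) d

theorem measurable_configDiscount (n : ℕ) : Measurable (configDiscount n) := by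
  induction n with
  | zero => exact measurable_const
  | succ n ih =>
    refine Measurable.indicator (Measurable.mul (by fun_prop) (ih.comp measurable_configNext))
      (measurableSet_lt (by fun_prop) measurable_const)

/-- The square root is chosen so that the induction closes: `x / (x + 1) ≤ √(x / (x + 2))` follows
from `x * (x + 2) ≤ (x + 1) ^ 2`, and the quotients under the roots telescope. -/
theorem discount_step_le {x : ℝ} (hx : 0 < x) (n : ℕ) :
    x / (x + 1) * √((x + 2) / (x + 2 + 2 * n)) ≤ √(x / (x + 2 * (n + 1 : ℕ))) := by
  have h1 : x / (x + 1) ≤ √(x / (x + 2)) := by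
    apply Real.le_sqrt_of_sq_le
    rw [div_pow, div_le_div_iff₀ (by positivity) (by positivity)]
    nlinarith [hx]
  calc _ ≤ √(x / (x + 2)) * √((x + 2) / (x + 2 + 2 * n)) := by gcongr
    _ = √(x / (x + 2 * (n + 1 : ℕ))) := by
      rw [← Real.sqrt_mul (by positivity)]
      congr 1
      push_cast
      field_simp
      ring

/-- Non-explosion in quantitative form. Waiting for the first event at total rate `x` costs a factor
`x / (x + 1)`, after which the bound for one event less applies to every possible target. -/
theorem lintegral_configDiscount_le (hα₀ : 0 ≤ α) (hα₁ : α ≤ 1) (hθ : 0 < θ) (n : ℕ)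
    (c : List ℕ+) : ∫⁻ d, configDiscount n d ∂configLaw α θ c ≤
      ENNReal.ofReal √((2 * compSize c + θ) / (2 * compSize c + θ + 2 * n)) := by
  induction n generalizing c with
  | zero =>
    have hx : (2 * compSize c + θ : ℝ) ≠ 0 := by positivity
    simp [configDiscount, hx]
  | succ n ih =>
    set x : ℝ := 2 * compSize c + θ with hxdef
    have hx : 0 < x := by positivity
    have hm : Measurable fun q : ℝ × Config =>
        ENNReal.ofReal (Real.exp (-q.1)) * configDiscount n q.2 :=
      Measurable.mul (by fun_prop) ((measurable_configDiscount n).comp measurable_snd)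
    -- The total size grows by at most one, hence the total rate by at most two, and the bound is
    -- monotone in the rate.
    have hb (c' : List ℕ+) (hc' : compSize c' ≤ compSize c + 1) :
        ∫⁻ d, configDiscount n d ∂configLaw α θ c' ≤
          ENNReal.ofReal √((x + 2) / (x + 2 + 2 * n)) := by
      refine (ih c').trans (ENNReal.ofReal_le_ofReal (Real.sqrt_le_sqrt ?_))
      have h1 : (compSize c' : ℝ) ≤ compSize c + 1 := by exact_mod_cast hc'
      rw [div_le_div_iff₀ (by positivity) (by positivity)]
      nlinarith [Nat.cast_nonneg (α := ℝ) n]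
    simp only [configDiscount]
    rw [lintegral_configNext (α := α) hθ c hm]
    set K := ENNReal.ofReal √((x + 2) / (x + 2 + 2 * n)) with hK
    have hle : ∀ t : ℝ, ENNReal.ofReal (Real.exp (-(x * t))) *
        (ENNReal.ofReal θ * ∫⁻ d, ENNReal.ofReal (Real.exp (-t)) * configDiscount n d
          ∂configLaw α θ (1 :: c) + sumOver (transitions α c) fun c' =>
          ∫⁻ d, ENNReal.ofReal (Real.exp (-t)) * configDiscount n d ∂configLaw α θ c') ≤
        ENNReal.ofReal (Real.exp (-((x + 1) * t))) * (ENNReal.ofReal x * K) := by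
      intro t
      have e : Real.exp (-((x + 1) * t)) = Real.exp (-(x * t)) * Real.exp (-t) := by
        rw [← Real.exp_add]; congr 1; ring
      simp_rw [lintegral_const_mul _ (measurable_configDiscount n)]
      rw [sumOver_const_mul, e, ENNReal.ofReal_mul (Real.exp_pos _).le, mul_assoc]
      refine mul_le_mul_right ?_ _
      rw [mul_left_comm, ← mul_add]
      refine mul_le_mul_right ?_ _
      calc _ ≤ ENNReal.ofReal θ * K + sumOver (transitions α c) fun _ => K * 1 := by
            refine add_le_add (mul_le_mul_right (hb _ ?_) _) (sumOver_mono fun p hp => ?_)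
            · simp [compSize_cons, add_comm]
            · rw [mul_one]
              refine hb _ ?_
              have := compSize_transitions p hp
              omega
        _ = ENNReal.ofReal x * K := by
            rw [sumOver_const_mul, sumOver_transitions_one hα₀ hα₁, hxdef, add_comm (2 * _) θ,
              ENNReal.ofReal_add hθ.le (by positivity)]
            ring
    refine (lintegral_mono hle).trans ?_
    rw [lintegral_mul_const _ (by fun_prop), lintegral_exp_neg_Ioi (by positivity), hK,
      ← ENNReal.ofReal_mul hx.le, ← ENNReal.ofReal_mul (by positivity)]
    refine ENNReal.ofReal_le_ofReal (le_trans (le_of_eq ?_) (discount_step_le hx n))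
    simp only [mul_zero, neg_zero, Real.exp_zero]
    ring

theorem exp_neg_tsum_le_configDiscount (n : ℕ) (d : Config)
    (hd : ∑' m, configClock (configNext^[m] d) < ∞) :
    ENNReal.ofReal (Real.exp (-(∑' m, configClock (configNext^[m] d)).toReal)) ≤
      configDiscount n d := by
  induction n generalizing d with
  | zero =>
    rw [configDiscount, ← ENNReal.ofReal_one]
    exact ENNReal.ofReal_le_ofReal (Real.exp_le_one_iff.2 (by simp))
  | succ n ih =>
    have hs : ∑' m, configClock (configNext^[m] d) =
        configClock d + ∑' m, configClock (configNext^[m] (configNext d)) := by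
      rw [tsum_eq_zero_add' ENNReal.summable]
      rfl
    rw [hs, ENNReal.add_lt_top] at hd
    have hd' : d ∈ {d | configClock d < ∞} := hd.1
    rw [hs, configDiscount, Set.indicator_of_mem hd', ENNReal.toReal_add hd.1.ne hd.2.ne, neg_add,
      Real.exp_add, ENNReal.ofReal_mul (Real.exp_pos _).le]
    exact mul_le_mul_right (ih _ hd.2) _

/-- If the holding times had a finite sum, all the discounts would stay above the exponential of
minus this sum. The expectations of the discounts tend to zero, so this happens with probability
zero. -/
theorem ae_tsum_configClock (hα₀ : 0 ≤ α) (hα₁ : α ≤ 1) (hθ : 0 < θ) (c : List ℕ+) :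
    ∀ᵐ d ∂configLaw α θ c, ∑' m, configClock (configNext^[m] d) = ∞ := by
  set S : Config → ℝ≥0∞ := fun d => ∑' m, configClock (configNext^[m] d) with hS
  have hSm : Measurable S :=
    Measurable.tsum fun m => measurable_configClock.comp (measurable_configNext.iterate m)
  set g : Config → ℝ≥0∞ := fun d => {d | S d < ∞}.indicator
    (fun d => ENNReal.ofReal (Real.exp (-(S d).toReal))) d with hg
  have hgm : Measurable g :=
    Measurable.indicator (by fun_prop) (measurableSet_lt hSm measurable_const)
  have hb (n : ℕ) : ∫⁻ d, g d ∂configLaw α θ c ≤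
      ENNReal.ofReal √((2 * compSize c + θ) / (2 * compSize c + θ + 2 * n)) := by
    refine le_trans (lintegral_mono fun d => ?_) (lintegral_configDiscount_le hα₀ hα₁ hθ n c)
    by_cases hd : S d < ∞
    · have hd' : d ∈ {d | S d < ∞} := hd
      simp only [hg]
      rw [Set.indicator_of_mem hd']
      exact exp_neg_tsum_le_configDiscount n d hd
    · simp [hg, hd]
  have hlim : Filter.Tendsto (fun n : ℕ => ENNReal.ofReal
      √((2 * compSize c + θ) / (2 * compSize c + θ + 2 * n))) Filter.atTop (nhds 0) := by
    have h1 : Filter.Tendsto (fun n : ℕ => 2 * compSize c + θ + 2 * (n : ℝ)) Filter.atTop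
        Filter.atTop := Filter.tendsto_atTop_add_const_left _ _
          (tendsto_natCast_atTop_atTop.const_mul_atTop (by norm_num))
    have h2 := (Real.continuous_sqrt.tendsto 0).comp
      (h1.const_div_atTop (2 * compSize c + θ : ℝ))
    rw [Real.sqrt_zero] at h2
    simpa using ENNReal.tendsto_ofReal h2
  have h0 : ∫⁻ d, g d ∂configLaw α θ c = 0 :=
    le_antisymm (ge_of_tendsto' hlim hb) (zero_le)
  rw [lintegral_eq_zero_iff hgm] at h0
  filter_upwards [h0] with d hd
  by_contra hne
  have hlt : d ∈ {d | S d < ∞} := lt_top_iff_ne_top.2 hne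
  simp only [hg] at hd
  rw [Set.indicator_of_mem hlt] at hd
  simp at hd
  exact absurd (Real.exp_pos _) (not_lt.2 hd)

end ConfigChain

/-! ### The joint law of jump chain and holding times -/

section ChainLaw

/-- Rates on `ℕ` that are nonnegative and whose jump probabilities sum to one. -/
class ProperRates (q : ℕ → ℕ → ℝ) : Prop where
  totalRate_nonneg : ∀ x, 0 ≤ totalRate q x
  jumpProb_nonneg : ∀ x y, 0 ≤ jumpProb q x y
  tsum_jumpProb : ∀ x, ∑' y, ENNReal.ofReal (jumpProb q x y) = 1

variable (q : ℕ → ℕ → ℝ)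

/-- The law of the state after a jump. -/
noncomputable def jumpLaw (x : ℕ) : Measure ℕ :=
  Measure.sum fun y => ENNReal.ofReal (jumpProb q x y) • Measure.dirac y

theorem lintegral_jumpLaw (x : ℕ) (f : ℕ → ℝ≥0∞) :
    ∫⁻ y, f y ∂jumpLaw q x = ∑' y, ENNReal.ofReal (jumpProb q x y) * f y := by
  simp [jumpLaw, lintegral_sum_measure, lintegral_smul_measure]

variable [ProperRates q]

instance (x : ℕ) : IsProbabilityMeasure (jumpLaw q x) := by
  refine ⟨?_⟩
  rw [← lintegral_one, lintegral_jumpLaw]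
  simpa using ProperRates.tsum_jumpProb x

/-- States and holding times obtained by following instructions, one for each step and state. -/
def followInstructions : ℕ → (ℕ → ℕ → ℕ × ℝ≥0∞) → ℕ → ℕ × ℝ≥0∞
  | x, ξ, 0 => (x, (ξ 0 x).2)
  | x, ξ, k + 1 => followInstructions (ξ 0 x).1 (tailStream ξ) k

theorem followInstructions_cons (x : ℕ) (ι : ℕ → ℕ × ℝ≥0∞) (ξ : ℕ → ℕ → ℕ × ℝ≥0∞) :
    followInstructions x (consStream ι ξ) =
      consStream (x, (ι x).2) (followInstructions (ι x).1 ξ) := by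
  ext k : 1
  cases k <;> rfl

theorem measurable_followInstructions (x : ℕ) : Measurable (followInstructions x) := by
  refine measurable_pi_lambda _ fun k => ?_
  induction k generalizing x with
  | zero =>
    simp only [followInstructions]
    have : Measurable fun ξ : ℕ → ℕ → ℕ × ℝ≥0∞ => ξ 0 x :=
      (measurable_pi_apply x).comp (measurable_pi_apply 0)
    fun_prop
  | succ k ih =>
    have h1 : Measurable fun p : (ℕ → ℕ → ℕ × ℝ≥0∞) × ℕ => followInstructions p.2 p.1 k :=
      measurable_from_prod_countable_left fun x => ih x
    have h2 : Measurable fun ξ : ℕ → ℕ → ℕ × ℝ≥0∞ => (tailStream ξ, (ξ 0 x).1) :=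
      (by fun_prop : Measurable fun ξ : ℕ → ℕ → ℕ × ℝ≥0∞ => tailStream ξ).prodMk
        (measurable_fst.comp ((measurable_pi_apply x).comp (measurable_pi_apply 0)))
    exact h1.comp h2

/-- The joint law of the jump chain and the holding times of the chain with rates `q` started
from `x`. -/
noncomputable def chainLaw (x : ℕ) : Measure (ℕ → ℕ × ℝ≥0∞) :=
  (streamLaw (Measure.infinitePi fun y => (jumpLaw q y).prod (expLaw (totalRate q y)))).map
    (followInstructions x)

instance (x : ℕ) : IsProbabilityMeasure (chainLaw q x) :=
  Measure.isProbabilityMeasure_map (measurable_followInstructions x).aemeasurable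

theorem measurable_lintegral_nat {β : Type*} [MeasurableSpace β] (law : ℕ → Measure β)
    {γ : Type*} [MeasurableSpace γ] [∀ x, SFinite (law x)]
    {F : γ × β → ℝ≥0∞} (hF : Measurable F) :
    Measurable fun p : ℕ × γ => ∫⁻ z, F (p.2, z) ∂law p.1 :=
  measurable_from_prod_countable_right fun x => hF.lintegral_prod_right' (ν := law x)

/-- Of the first row of instructions only the entry of state `x` is used, and its jump and holding
time are independent. The other rows are an independent copy of all instructions, now followed from
the new state: this is the Markov property. -/
theorem lintegral_chainLaw (x : ℕ) {F : (ℕ → ℕ × ℝ≥0∞) → ℝ≥0∞} (hF : Measurable F) :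
    ∫⁻ z, F z ∂chainLaw q x = ∫⁻ h, ∑' y, ENNReal.ofReal (jumpProb q x y) *
      ∫⁻ z, F (consStream (x, h) z) ∂chainLaw q y ∂expLaw (totalRate q x) := by
  set I := Measure.infinitePi fun y => (jumpLaw q y).prod (expLaw (totalRate q y)) with hI
  have hG : Measurable fun p : ℕ × ℝ≥0∞ => ∫⁻ z, F (consStream (x, p.2) z) ∂chainLaw q p.1 := by
    refine measurable_lintegral_nat (chainLaw q)
      (F := fun p : ℝ≥0∞ × (ℕ → ℕ × ℝ≥0∞) => F (consStream (x, p.1) p.2)) ?_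
    fun_prop
  have h1 (ι : ℕ → ℕ × ℝ≥0∞) : ∫⁻ ξ, F (followInstructions x (consStream ι ξ)) ∂streamLaw I =
      ∫⁻ z, F (consStream (x, (ι x).2) z) ∂chainLaw q (ι x).1 := by
    rw [chainLaw, lintegral_map (by fun_prop) (measurable_followInstructions _)]
    simp_rw [followInstructions_cons]
    rfl
  have hFx : Measurable fun ξ => F (followInstructions x ξ) :=
    hF.comp (measurable_followInstructions x)
  rw [chainLaw, lintegral_map hF (measurable_followInstructions x), lintegral_streamLaw_cons _ hFx]
  simp_rw [← hI, h1]
  have h2 := lintegral_map hG (measurable_pi_apply (X := fun _ : ℕ => ℕ × ℝ≥0∞) x) (μ := I)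
  rw [hI, Measure.infinitePi_map_eval, ← hI] at h2
  rw [← h2, lintegral_prod_symm' _ hG]
  simp_rw [lintegral_jumpLaw]

theorem chainLaw_step (x : ℕ) (t : ℝ≥0) (A : Set (ℕ → ℕ × ℝ≥0∞)) (hA : MeasurableSet A) :
    chainLaw q x {z | (t : ℝ≥0∞) < (z 0).2 ∧ tailStream z ∈ A} =
      ENNReal.ofReal (Real.exp (-(totalRate q x * t))) *
        ∑' y, ENNReal.ofReal (jumpProb q x y) * chainLaw q y A := by
  have hm : MeasurableSet {z : ℕ → ℕ × ℝ≥0∞ | (t : ℝ≥0∞) < (z 0).2 ∧ tailStream z ∈ A} :=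
    (measurableSet_lt (g := fun z : ℕ → ℕ × ℝ≥0∞ => (z 0).2) measurable_const (by fun_prop)).inter
      ((by fun_prop : Measurable fun z : ℕ → ℕ × ℝ≥0∞ => tailStream z) hA)
  rw [← lintegral_indicator_one hm, lintegral_chainLaw _ _ (measurable_one.indicator hm)]
  have h1 (h : ℝ≥0∞) (y : ℕ) : ∫⁻ z, {z : ℕ → ℕ × ℝ≥0∞ | (t : ℝ≥0∞) < (z 0).2 ∧
      tailStream z ∈ A}.indicator 1 (consStream (x, h) z) ∂chainLaw q y =
      (Set.Ioi (t : ℝ≥0∞)).indicator 1 h * chainLaw q y A := by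
    rw [← lintegral_indicator_one hA, ← lintegral_const_mul _ (measurable_one.indicator hA)]
    congr 1; ext z
    by_cases h1 : (t : ℝ≥0∞) < h <;> by_cases h2 : z ∈ A <;> simp [h1, h2]
  simp_rw [h1]
  have h2 (h : ℝ≥0∞) : ∑' y, ENNReal.ofReal (jumpProb q x y) *
      ((Set.Ioi (t : ℝ≥0∞)).indicator 1 h * chainLaw q y A) =
      (Set.Ioi (t : ℝ≥0∞)).indicator 1 h *
        ∑' y, ENNReal.ofReal (jumpProb q x y) * chainLaw q y A := by
    rw [← ENNReal.tsum_mul_left]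
    exact tsum_congr fun y => by ring
  simp_rw [h2]
  rw [lintegral_mul_const _ (measurable_one.indicator measurableSet_Ioi),
    lintegral_indicator_one measurableSet_Ioi, expLaw_Ioi (ProperRates.totalRate_nonneg x)]

theorem ae_chainLaw_zero (x : ℕ) : ∀ᵐ z ∂chainLaw q x, (z 0).1 = x := by
  have hm : MeasurableSet {z : ℕ → ℕ × ℝ≥0∞ | (z 0).1 = x} :=
    (by fun_prop : Measurable fun z : ℕ → ℕ × ℝ≥0∞ => (z 0).1) (measurableSet_singleton x)
  rw [chainLaw, ae_map_iff (measurable_followInstructions x).aemeasurable hm]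
  exact Filter.Eventually.of_forall fun ξ => rfl

theorem ae_chainLaw_of_cons {P : (ℕ → ℕ × ℝ≥0∞) → Prop} (hP : MeasurableSet {z | P z}) (x : ℕ)
    (h : ∀ᵐ a ∂expLaw (totalRate q x), ∀ y, jumpProb q x y ≠ 0 →
      ∀ᵐ z ∂chainLaw q y, P (consStream (x, a) z)) : ∀ᵐ z ∂chainLaw q x, P z := by
  have hm : MeasurableSet {z | ¬ P z} := hP.compl
  rw [ae_iff, ← lintegral_indicator_one hm, lintegral_chainLaw _ _ (measurable_one.indicator hm),
    ← lintegral_zero (μ := expLaw (totalRate q x))]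
  refine lintegral_congr_ae ?_
  filter_upwards [h] with a ha
  rw [ENNReal.tsum_eq_zero]
  intro y
  by_cases hy : jumpProb q x y = 0
  · simp [hy]
  · rw [mul_eq_zero]; right
    rw [← lintegral_zero (μ := chainLaw q y)]
    refine lintegral_congr_ae ?_
    filter_upwards [ha y hy] with z hz
    simp [hz]

theorem ae_chainLaw_iterate {P : (ℕ → ℕ × ℝ≥0∞) → Prop} (hP : MeasurableSet {z | P z})
    (h : ∀ x, ∀ᵐ z ∂chainLaw q x, P z) (x : ℕ) :
    ∀ᵐ z ∂chainLaw q x, ∀ m, P fun k => z (k + m) := by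
  rw [ae_all_iff]
  intro m
  induction m generalizing P with
  | zero => exact h x
  | succ m ih =>
    have htail : Measurable fun z : ℕ → ℕ × ℝ≥0∞ => tailStream z := by fun_prop
    refine (ih (P := fun z => P (tailStream z)) (htail hP) fun x =>
      ae_chainLaw_of_cons q (htail hP) x (Filter.Eventually.of_forall fun a y _ => h y)).mono
      fun z hz => ?_
    have : (fun k => z (k + (m + 1))) = tailStream fun k => z (k + m) := by
      ext k : 1; simp [tailStream, add_assoc, add_comm 1 m]
    rw [this]; exact hz

theorem chainLaw_cylinder (n : ℕ) (y : ℕ → ℕ) (t : ℕ → ℝ≥0) :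
    chainLaw q (y 0) {z | ∀ m ≤ n, (z m).1 = y m ∧ (t m : ℝ≥0∞) < (z m).2} =
      ENNReal.ofReal ((∏ m ∈ Finset.range n, jumpProb q (y m) (y (m + 1))) *
        ∏ m ∈ Finset.range (n + 1), Real.exp (-(totalRate q (y m) * t m))) := by
  have hit : ∀ (m : ℕ) (z : ℕ → ℕ × ℝ≥0∞), tailStream^[m] z 0 = z m := by
    intro m
    induction m with
    | zero => intro z; rfl
    | succ m ih => intro z; rw [Function.iterate_succ_apply, ih]; rfl
  have := measure_cylinder (q := q) (law := chainLaw q) (state := fun z => (z 0).1)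
    (clock := fun z => (z 0).2) (next := tailStream)
    (fun y => (by fun_prop : Measurable fun z : ℕ → ℕ × ℝ≥0∞ => (z 0).1)
      (measurableSet_singleton y)) (by fun_prop)
    (by fun_prop : Measurable fun z : ℕ → ℕ × ℝ≥0∞ => tailStream z) (ae_chainLaw_zero q)
    ProperRates.jumpProb_nonneg ProperRates.tsum_jumpProb (chainLaw_step q) n y t
  simpa only [hit] using this

/-- If all rates agree, the holding times are independent with a common exponential law. -/
theorem map_hold_chainLaw {r : ℝ} (hr : ∀ x, totalRate q x = r) (x : ℕ) :
    (chainLaw q x).map (fun z m => (z m).2) = streamLaw (expLaw r) := by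
  classical
  have key (n : ℕ) (t : ℕ → Set ℝ≥0∞) (ht : ∀ m, MeasurableSet (t m)) (x : ℕ) :
      chainLaw q x {z | ∀ m < n, (z m).2 ∈ t m} = ∏ m ∈ Finset.range n, expLaw r (t m) := by
    induction n generalizing t x with
    | zero => simp
    | succ n ih =>
      have hm (n : ℕ) (t : ℕ → Set ℝ≥0∞) (ht : ∀ m, MeasurableSet (t m)) :
          MeasurableSet {z : ℕ → ℕ × ℝ≥0∞ | ∀ m < n, (z m).2 ∈ t m} := by
        have : {z : ℕ → ℕ × ℝ≥0∞ | ∀ m < n, (z m).2 ∈ t m} =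
            ⋂ m < n, (fun z : ℕ → ℕ × ℝ≥0∞ => (z m).2) ⁻¹' t m := by ext z; simp
        rw [this]
        refine MeasurableSet.iInter fun m => MeasurableSet.iInter fun _ => ?_
        exact (by fun_prop : Measurable fun z : ℕ → ℕ × ℝ≥0∞ => (z m).2) (ht m)
      have h1 (h : ℝ≥0∞) (y : ℕ) : ∫⁻ z, {z : ℕ → ℕ × ℝ≥0∞ | ∀ m < n + 1, (z m).2 ∈ t m}.indicator 1
          (consStream (x, h) z) ∂chainLaw q y =
          (t 0).indicator 1 h * ∏ m ∈ Finset.range n, expLaw r (t (m + 1)) := by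
        rw [← ih (fun m => t (m + 1)) (fun m => ht _) y,
          ← lintegral_indicator_one (hm n (fun m => t (m + 1)) fun m => ht _),
          ← lintegral_const_mul _ (measurable_one.indicator
            (hm n (fun m => t (m + 1)) fun m => ht _))]
        congr 1; ext z
        have : (∀ m < n + 1, (consStream (x, h) z m).2 ∈ t m) ↔
            h ∈ t 0 ∧ ∀ m < n, (z m).2 ∈ t (m + 1) := by
          refine ⟨fun H => ⟨H 0 (by omega), fun m hm => H (m + 1) (by omega)⟩, fun H m hm => ?_⟩
          cases m with
          | zero => exact H.1
          | succ m => exact H.2 m (by omega)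
        simp only [Set.indicator_apply, Set.mem_ofPred_eq, this, Pi.one_apply]
        by_cases a : h ∈ t 0 <;> simp [a]
      rw [← lintegral_indicator_one (hm _ t ht),
        lintegral_chainLaw _ _ (measurable_one.indicator (hm _ t ht))]
      simp_rw [h1, ENNReal.tsum_mul_right, ProperRates.tsum_jumpProb, one_mul]
      rw [lintegral_mul_const _ (measurable_one.indicator (ht 0)),
        lintegral_indicator_one (ht 0), hr, Finset.prod_range_succ', mul_comm]
  refine Measure.eq_infinitePi _ fun s t ht => ?_
  obtain ⟨n, hn⟩ := s.exists_nat_subset_range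
  rw [Measure.map_apply (by fun_prop) (MeasurableSet.pi s.countable_toSet fun i _ => ht i)]
  have := key n (fun m => if m ∈ s then t m else Set.univ)
    (fun m => by split_ifs <;> [exact ht m; exact MeasurableSet.univ]) x
  have e : {z : ℕ → ℕ × ℝ≥0∞ | ∀ m < n, (z m).2 ∈ if m ∈ s then t m else Set.univ} =
      (fun (z : ℕ → ℕ × ℝ≥0∞) m => (z m).2) ⁻¹' Set.pi s t := by
    ext z
    simp only [Set.mem_ofPred_eq, Set.mem_preimage, Set.mem_pi, Finset.mem_coe]
    refine ⟨fun H m hm => by simpa [hm] using H m (Finset.mem_range.1 (hn hm)), fun H m _ => ?_⟩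
    split_ifs with h
    · exact H m h
    · trivial
  rw [← e, this, ← Finset.prod_subset hn]
  · exact Finset.prod_congr rfl fun m hm => by simp [hm]
  · intro m _ hm; simp [hm]

end ChainLaw

/-! ### Uniqueness of the law of jump chain and holding times -/

section ChainUnique

/-- The sequences whose first `n + 1` states are given and whose first `n + 1` holding times lie in
given sets. -/
def holdCylinder (n : ℕ) (y : ℕ → ℕ) (s : ℕ → Set ℝ≥0∞) : Set (ℕ → ℕ × ℝ≥0∞) :=
  {z | ∀ m ≤ n, (z m).1 = y m ∧ (z m).2 ∈ s m}

/-- Open upper rays with finite endpoints, and the whole half-line. -/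
def IsRay (s : Set ℝ≥0∞) : Prop := s = Set.univ ∨ ∃ t : ℝ≥0, s = Set.Ioi (t : ℝ≥0∞)

theorem IsRay.inter {s s' : Set ℝ≥0∞} (h : IsRay s) (h' : IsRay s') : IsRay (s ∩ s') := by
  rcases h with rfl | ⟨t, rfl⟩
  · simpa using h'
  · rcases h' with rfl | ⟨t', rfl⟩
    · exact Or.inr ⟨t, by simp⟩
    · exact Or.inr ⟨max t t', by rw [Set.Ioi_inter_Ioi]; simp⟩

theorem IsRay.measurableSet {s : Set ℝ≥0∞} (h : IsRay s) : MeasurableSet s := by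
  rcases h with rfl | ⟨t, rfl⟩
  · exact MeasurableSet.univ
  · exact measurableSet_Ioi

theorem measurableSet_holdCylinder (n : ℕ) (y : ℕ → ℕ) {s : ℕ → Set ℝ≥0∞}
    (hs : ∀ m, IsRay (s m)) : MeasurableSet (holdCylinder n y s) := by
  have : holdCylinder n y s = ⋂ m ≤ n, (fun z : ℕ → ℕ × ℝ≥0∞ => z m) ⁻¹' ({y m} ×ˢ s m) := by
    ext z; simp [holdCylinder]
  rw [this]
  exact MeasurableSet.iInter fun m => MeasurableSet.iInter fun _ =>
    measurable_pi_apply m ((measurableSet_singleton _).prod (hs m).measurableSet)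

/-- The cylinders with rays. -/
def holdCylinders : Set (Set (ℕ → ℕ × ℝ≥0∞)) :=
  {A | ∃ n y s, (∀ m, IsRay (s m)) ∧ A = holdCylinder n y s}

theorem isPiSystem_holdCylinders : IsPiSystem holdCylinders := by
  rintro _ ⟨n, y, s, hs, rfl⟩ _ ⟨n', y', s', hs', rfl⟩ ⟨z₀, h, h'⟩
  -- Cylinders that meet prescribe compatible states, and the states of a common point `z₀` fit
  -- both.
  refine ⟨max n n', fun m => (z₀ m).1, fun m =>
    (if m ≤ n then s m else Set.univ) ∩ (if m ≤ n' then s' m else Set.univ), fun m => ?_, ?_⟩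
  · refine IsRay.inter ?_ ?_
    · split_ifs <;> [exact hs m; exact Or.inl rfl]
    · split_ifs <;> [exact hs' m; exact Or.inl rfl]
  · ext z
    constructor
    · rintro ⟨a, a'⟩ m hm
      refine ⟨?_, ?_, ?_⟩
      · rcases le_max_iff.1 hm with hm | hm
        · exact (a m hm).1.trans (h m hm).1.symm
        · exact (a' m hm).1.trans (h' m hm).1.symm
      · split_ifs with hm <;> [exact (a m hm).2; trivial]
      · split_ifs with hm <;> [exact (a' m hm).2; trivial]
    · intro a
      refine ⟨fun m hm => ?_, fun m hm => ?_⟩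
      · have := a m (le_max_of_le_left hm)
        simp only [hm, if_true] at this
        exact ⟨this.1.trans (h m hm).1, this.2.1⟩
      · have := a m (le_max_of_le_right hm)
        simp only [hm, if_true] at this
        exact ⟨this.1.trans (h' m hm).1, this.2.2⟩

/-- Extension of a finite sequence of states by zeros. -/
def extendStates {n : ℕ} (p : Fin n → ℕ) (m : ℕ) : ℕ := if h : m < n then p ⟨m, h⟩ else 0

/-- A cylinder also fixes the states. An event about holding times alone is therefore a union over
finite sequences of states, which is countable. -/
theorem exists_holdCylinder (n : ℕ) (s : ℕ → Set ℝ≥0∞) :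
    {z : ℕ → ℕ × ℝ≥0∞ | ∀ m ≤ n, (z m).2 ∈ s m} =
      ⋃ p : Fin (n + 1) → ℕ, holdCylinder n (extendStates p) s := by
  ext z
  simp only [Set.mem_ofPred_eq, Set.mem_iUnion]
  refine ⟨fun h => ⟨fun i => (z i).1, fun m hm => ⟨?_, h m hm⟩⟩, fun ⟨p, hp⟩ m hm => (hp m hm).2⟩
  simp [extendStates, Nat.lt_succ_of_le hm]

/-- Stated for an arbitrary measurable space on the source, so that it can be applied to the
identity with the σ-algebra generated by the cylinders. -/
theorem measurable_of_holdCylinder {β : Type*} [MeasurableSpace β] {f : β → ℕ → ℕ × ℝ≥0∞}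
    (hcyl : ∀ n y s, (∀ m, IsRay (s m)) → MeasurableSet (f ⁻¹' holdCylinder n y s)) :
    Measurable f := by
  classical
  have hst (n : ℕ) : Measurable fun b => (f b n).1 := by
    refine measurable_to_countable' fun x => ?_
    have : (fun b => (f b n).1) ⁻¹' {x} = ⋃ p : Fin (n + 1) → ℕ, if extendStates p n = x
        then f ⁻¹' holdCylinder n (extendStates p) fun _ => Set.univ else ∅ := by
      ext b
      simp only [Set.mem_preimage, Set.mem_singleton_iff, Set.mem_iUnion]
      constructor
      · rintro rfl
        have hz : f b ∈ {z : ℕ → ℕ × ℝ≥0∞ | ∀ m ≤ n, (z m).2 ∈ (Set.univ : Set ℝ≥0∞)} := by simp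
        rw [exists_holdCylinder n fun _ => Set.univ, Set.mem_iUnion] at hz
        obtain ⟨p, hp⟩ := hz
        exact ⟨p, by rw [if_pos (hp n le_rfl).1.symm]; exact hp⟩
      · rintro ⟨p, hp⟩
        split_ifs at hp with h
        · rw [← h]; exact (hp n le_rfl).1
        · exact hp.elim
    rw [this]
    refine MeasurableSet.iUnion fun p => ?_
    split_ifs
    · exact hcyl _ _ _ fun _ => Or.inl rfl
    · exact MeasurableSet.empty
  have hho (n : ℕ) : Measurable fun b => (f b n).2 := by
    refine measurable_of_Ioi fun t => ?_
    induction t with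
    | top => simp
    | coe t =>
      have hs : ∀ m, IsRay (if m = n then Set.Ioi (t : ℝ≥0∞) else Set.univ) := fun m => by
        split_ifs <;> [exact Or.inr ⟨t, rfl⟩; exact Or.inl rfl]
      have : (fun b => (f b n).2) ⁻¹' Set.Ioi (t : ℝ≥0∞) =
          f ⁻¹' {z | ∀ m ≤ n, (z m).2 ∈ if m = n then Set.Ioi (t : ℝ≥0∞) else Set.univ} := by
        ext b
        simp only [Set.mem_preimage, Set.mem_ofPred_eq]
        refine ⟨fun h m _ => ?_, fun h => by simpa using h n le_rfl⟩
        split_ifs with hm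
        · rw [hm]; exact h
        · trivial
      rw [this, exists_holdCylinder, Set.preimage_iUnion]
      exact MeasurableSet.iUnion fun p => hcyl _ _ _ hs
  exact measurable_pi_lambda _ fun n => (hst n).prodMk (hho n)

theorem generateFrom_holdCylinders :
    (MeasurableSpace.pi : MeasurableSpace (ℕ → ℕ × ℝ≥0∞)) =
      MeasurableSpace.generateFrom holdCylinders := by
  refine le_antisymm (fun s hs => ?_) (MeasurableSpace.generateFrom_le ?_)
  · exact @measurable_of_holdCylinder _ (MeasurableSpace.generateFrom holdCylinders) id
      (fun n y s hs => MeasurableSpace.measurableSet_generateFrom ⟨n, y, s, hs, rfl⟩) s hs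
  · rintro _ ⟨n, y, s, hs, rfl⟩
    exact measurableSet_holdCylinder n y hs

variable (q : ℕ → ℕ → ℝ) [ProperRates q]

/-- The cylinders with rays form a generating π-system. The formula covers only the rays from finite
endpoints; the whole half-line is needed too, and it agrees with the ray from `0` once all holding
times are known to be positive. -/
theorem eq_chainLaw {ν : Measure (ℕ → ℕ × ℝ≥0∞)} [IsProbabilityMeasure ν] {x : ℕ}
    (h0 : ∀ᵐ z ∂ν, (z 0).1 = x)
    (h : ∀ (n : ℕ) (y : ℕ → ℕ) (t : ℕ → ℝ≥0), y 0 = x →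
      ν {z | ∀ m ≤ n, (z m).1 = y m ∧ (t m : ℝ≥0∞) < (z m).2} =
        ENNReal.ofReal ((∏ m ∈ Finset.range n, jumpProb q (y m) (y (m + 1))) *
          ∏ m ∈ Finset.range (n + 1), Real.exp (-(totalRate q (y m) * t m)))) :
    ν = chainLaw q x := by
  classical
  have hray (n : ℕ) (y : ℕ → ℕ) (t : ℕ → ℝ≥0) :
      ν (holdCylinder n y fun m => Set.Ioi (t m : ℝ≥0∞)) =
        chainLaw q x (holdCylinder n y fun m => Set.Ioi (t m : ℝ≥0∞)) := by
    by_cases hy : y 0 = x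
    · refine (h n y t hy).trans ?_
      rw [← hy]
      exact (chainLaw_cylinder q n y t).symm
    · have hz {ρ : Measure (ℕ → ℕ × ℝ≥0∞)} (hρ : ∀ᵐ z : ℕ → ℕ × ℝ≥0∞ ∂ρ, (z 0).1 = x) :
          ρ (holdCylinder n y fun m => Set.Ioi (t m : ℝ≥0∞)) = 0 :=
        measure_mono_null (t := {z : ℕ → ℕ × ℝ≥0∞ | ¬ (z 0).1 = x})
          (fun z hz hz' => hy ((hz 0 (Nat.zero_le _)).1.symm.trans hz')) hρ
      rw [hz h0, hz (ae_chainLaw_zero q x)]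
  have hsum (ρ : Measure (ℕ → ℕ × ℝ≥0∞)) (n : ℕ) :
      ρ {z : ℕ → ℕ × ℝ≥0∞ | ∀ m ≤ n, (z m).2 ∈ Set.Ioi ((0 : ℝ≥0) : ℝ≥0∞)} =
      ∑' p : Fin (n + 1) → ℕ, ρ (holdCylinder n (extendStates p)
        fun _ => Set.Ioi ((0 : ℝ≥0) : ℝ≥0∞)) := by
    rw [exists_holdCylinder n fun _ => Set.Ioi ((0 : ℝ≥0) : ℝ≥0∞), measure_iUnion]
    · intro p p' hp
      refine Set.disjoint_left.2 fun z hz hz' => hp ?_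
      ext i
      have h1 := (hz i (by omega)).1
      have h2 := (hz' i (by omega)).1
      rw [h1] at h2
      simpa [extendStates, Nat.le_of_lt_succ i.2] using h2
    · exact fun p => measurableSet_holdCylinder n _ fun _ => Or.inr ⟨0, rfl⟩
  have hposc : ∀ᵐ z ∂chainLaw q x, ∀ m, 0 < (z m).2 := by
    have hm : MeasurableSet {z : ℕ → ℕ × ℝ≥0∞ | 0 < (z 0).2} :=
      measurableSet_lt measurable_const (by fun_prop)
    have := ae_chainLaw_iterate q hm (fun x => ae_chainLaw_of_cons q hm x ?_) x
    · simpa using this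
    · filter_upwards [ae_expLaw_pos (totalRate q x)] with a ha y _
      exact Filter.Eventually.of_forall fun z => ha
  -- Positivity under `ν` is not assumed. Summing the cylinders with all endpoints `0` over the
  -- states gives the same total as for `chainLaw`, which is one.
  have hposν : ∀ᵐ z ∂ν, ∀ m, 0 < (z m).2 := by
    rw [ae_all_iff]
    intro n
    have hm : MeasurableSet {z : ℕ → ℕ × ℝ≥0∞ | ∀ m ≤ n, (z m).2 ∈ Set.Ioi ((0 : ℝ≥0) : ℝ≥0∞)} := by
      rw [exists_holdCylinder n fun _ => Set.Ioi ((0 : ℝ≥0) : ℝ≥0∞)]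
      exact MeasurableSet.iUnion fun p => measurableSet_holdCylinder n _ fun _ => Or.inr ⟨0, rfl⟩
    have h1 : ν {z | ∀ m ≤ n, (z m).2 ∈ Set.Ioi ((0 : ℝ≥0) : ℝ≥0∞)} = 1 := by
      rw [hsum]
      simp_rw [hray]
      rw [← hsum, ← prob_compl_eq_zero_iff hm, ← mem_ae_iff]
      filter_upwards [hposc] with z hz m _ using by simpa using hz m
    rw [← prob_compl_eq_zero_iff hm, ← mem_ae_iff] at h1
    filter_upwards [h1] with z hz
    simpa using hz n le_rfl
  refine ext_of_generate_finite holdCylinders generateFrom_holdCylinders isPiSystem_holdCylinders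
    ?_ (by simp)
  rintro _ ⟨n, y, s, hs, rfl⟩
  -- On positive holding times the whole half-line is the ray from `0`, so every cylinder may be
  -- replaced by one covered by the formula.
  have ht : ∃ t : ℕ → ℝ≥0, ∀ m, ∀ a, 0 < a → (a ∈ s m ↔ (t m : ℝ≥0∞) < a) := by
    have : ∀ m, ∃ t : ℝ≥0, ∀ a, 0 < a → (a ∈ s m ↔ (t : ℝ≥0∞) < a) := by
      intro m
      rcases hs m with h | ⟨t, h⟩
      · exact ⟨0, fun a ha => by simp [h, ha]⟩
      · exact ⟨t, fun a _ => by simp [h]⟩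
    choose t ht using this
    exact ⟨t, ht⟩
  obtain ⟨t, ht⟩ := ht
  have hc {ρ : Measure (ℕ → ℕ × ℝ≥0∞)} (hρ : ∀ᵐ z ∂ρ, ∀ m, 0 < (z m).2) :
      ρ (holdCylinder n y s) = ρ (holdCylinder n y fun m => Set.Ioi (t m : ℝ≥0∞)) := by
    refine measure_congr ?_
    filter_upwards [hρ] with z hz
    refine propext ⟨fun h m hm => ⟨(h m hm).1, (ht m _ (hz m)).1 (h m hm).2⟩,
      fun h m hm => ⟨(h m hm).1, (ht m _ (hz m)).2 (h m hm).2⟩⟩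
  rw [hc hposν, hc hposc, hray]

/-- Sequences of states and holding times in the support of their law. -/
def GoodChain (z : ℕ → ℕ × ℝ≥0∞) : Prop :=
  ∀ m, 0 < (z m).2 ∧ ((z m).2 = ∞ ↔ totalRate q (z m).1 = 0) ∧
    jumpProb q (z m).1 (z (m + 1)).1 ≠ 0

theorem ae_goodChain (x : ℕ) : ∀ᵐ z ∂chainLaw q x, GoodChain q z := by
  classical
  set P : (ℕ → ℕ × ℝ≥0∞) → Prop := fun z => 0 < (z 0).2 ∧
    ((z 0).2 = ∞ ↔ totalRate q (z 0).1 = 0) ∧ jumpProb q (z 0).1 (z 1).1 ≠ 0 with hP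
  have hPm : MeasurableSet {z | P z} := by
    refine MeasurableSet.inter (measurableSet_lt (g := fun z : ℕ → ℕ × ℝ≥0∞ => (z 0).2)
      measurable_const (by fun_prop)) (MeasurableSet.inter ?_ ?_)
    · have h1 : MeasurableSet {z : ℕ → ℕ × ℝ≥0∞ | (z 0).2 = ∞} :=
        measurableSet_eq_fun (by fun_prop) measurable_const
      have h2 : MeasurableSet {z : ℕ → ℕ × ℝ≥0∞ | totalRate q (z 0).1 = 0} :=
        (by fun_prop : Measurable fun z : ℕ → ℕ × ℝ≥0∞ => (z 0).1)
          (MeasurableSet.of_discrete (s := {y | totalRate q y = 0}))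
      exact h1.iff h2
    · exact (by fun_prop : Measurable fun z : ℕ → ℕ × ℝ≥0∞ => ((z 0).1, (z 1).1))
        (MeasurableSet.of_discrete (s := {y : ℕ × ℕ | jumpProb q y.1 y.2 ≠ 0}))
  refine (ae_chainLaw_iterate q hPm (fun x => ae_chainLaw_of_cons q hPm x ?_) x).mono
    fun z hz m => ?_
  · have h1 : ∀ᵐ a ∂expLaw (totalRate q x), (a = ∞ ↔ totalRate q x = 0) := by
      rcases (ProperRates.totalRate_nonneg (q := q) x).eq_or_lt with h | h
      · rw [← h, expLaw_of_nonpos le_rfl, ae_dirac_iff (by simp)]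
        simp
      · filter_upwards [ae_expLaw_lt_top h] with a ha
        simp [ha.ne, h.ne']
    filter_upwards [ae_expLaw_pos (totalRate q x), h1] with a ha ha' y hy
    filter_upwards [ae_chainLaw_zero q y] with z hz
    refine ⟨ha, ha', ?_⟩
    simpa [hz] using hy
  · have := hz m
    simpa [hP, add_comm 1 m] using this

end ChainUnique

/-! ### Reading jump chain and holding times off a path -/

section ReadPath

/-- The first time after `t` at which a path differs from `v`, along rational times. -/
noncomputable def nextJump (x : ℝ≥0 → ℕ) (v : ℕ) (t : ℝ≥0∞) : ℝ≥0∞ :=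
  ⨅ r : ℚ, if t < (Real.toNNReal r : ℝ≥0∞) ∧ x (Real.toNNReal r) ≠ v
    then (Real.toNNReal r : ℝ≥0∞) else ∞

/-- The path has the constant value `y` just after the time `t`, along rational times. -/
def ValueAfter (x : ℝ≥0 → ℕ) (t : ℝ≥0∞) (y : ℕ) : Prop :=
  ∃ k : ℕ, ∀ r : ℚ, t < (Real.toNNReal r : ℝ≥0∞) →
    (Real.toNNReal r : ℝ≥0∞) < t + (k + 1 : ℝ≥0∞)⁻¹ → x (Real.toNNReal r) = y

/-- The condition on the state after the next jump. -/
def NextState (p : (ℝ≥0 → ℕ) × ℕ × ℝ≥0∞) (y : ℕ) : Prop :=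
  if nextJump p.1 p.2.1 p.2.2 = ∞ then y = p.2.1
  else ValueAfter p.1 (nextJump p.1 p.2.1 p.2.2) y ∨
    ∀ y', ¬ ValueAfter p.1 (nextJump p.1 p.2.1 p.2.2) y'

theorem exists_nextState (p : (ℝ≥0 → ℕ) × ℕ × ℝ≥0∞) : ∃ y, NextState p y := by
  unfold NextState
  split_ifs
  · exact ⟨_, rfl⟩
  · by_cases h : ∃ y, ValueAfter p.1 (nextJump p.1 p.2.1 p.2.2) y
    · exact h.imp fun y hy => Or.inl hy
    · exact ⟨0, Or.inr (by simpa using h)⟩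

open Classical in
/-- The state after the next jump and the time of that jump. -/
noncomputable def readStep (p : (ℝ≥0 → ℕ) × ℕ × ℝ≥0∞) : ℕ × ℝ≥0∞ :=
  (Nat.find (exists_nextState p), nextJump p.1 p.2.1 p.2.2)

theorem measurable_nextJump :
    Measurable fun p : (ℝ≥0 → ℕ) × ℕ × ℝ≥0∞ => nextJump p.1 p.2.1 p.2.2 := by
  refine Measurable.iInf fun r => Measurable.ite (MeasurableSet.inter ?_ ?_) measurable_const
    measurable_const
  · exact measurableSet_lt (f := fun p : (ℝ≥0 → ℕ) × ℕ × ℝ≥0∞ => p.2.2) (by fun_prop)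
      measurable_const
  · refine (measurableSet_eq_fun (f := fun p : (ℝ≥0 → ℕ) × ℕ × ℝ≥0∞ => p.1 (Real.toNNReal r))
      (g := fun p => p.2.1) ?_ ?_).compl
    · exact (measurable_pi_apply _).comp measurable_fst
    · fun_prop

theorem measurableSet_valueAfter (y : ℕ) :
    MeasurableSet {p : (ℝ≥0 → ℕ) × ℝ≥0∞ | ValueAfter p.1 p.2 y} := by
  have : {p : (ℝ≥0 → ℕ) × ℝ≥0∞ | ValueAfter p.1 p.2 y} = ⋃ k : ℕ, ⋂ r : ℚ,
      ({p | p.2 < (Real.toNNReal r : ℝ≥0∞)}ᶜ ∪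
        ({p | (Real.toNNReal r : ℝ≥0∞) < p.2 + (k + 1 : ℝ≥0∞)⁻¹}ᶜ ∪
          (fun p => p.1 (Real.toNNReal r)) ⁻¹' {y})) := by
    ext p
    simp only [ValueAfter, Set.mem_ofPred_eq, Set.mem_iUnion, Set.mem_iInter, Set.mem_union,
      Set.mem_compl_iff, Set.mem_preimage, Set.mem_singleton_iff]
    refine exists_congr fun k => forall_congr' fun r => ?_
    tauto
  rw [this]
  refine MeasurableSet.iUnion fun k => MeasurableSet.iInter fun r => ?_
  refine (MeasurableSet.compl ?_).union ((MeasurableSet.compl ?_).union ?_)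
  · exact measurableSet_lt (by fun_prop) measurable_const
  · exact measurableSet_lt measurable_const (by fun_prop)
  · exact ((measurable_pi_apply _).comp measurable_fst) (measurableSet_singleton y)

theorem measurable_readStep : Measurable readStep := by
  classical
  refine Measurable.prodMk ?_ measurable_nextJump
  refine measurable_find exists_nextState fun y => ?_
  have h1 : MeasurableSet {p : (ℝ≥0 → ℕ) × ℕ × ℝ≥0∞ | nextJump p.1 p.2.1 p.2.2 = ∞} :=
    measurableSet_eq_fun measurable_nextJump measurable_const
  have h2 (y : ℕ) : MeasurableSet {p : (ℝ≥0 → ℕ) × ℕ × ℝ≥0∞ |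
      ValueAfter p.1 (nextJump p.1 p.2.1 p.2.2) y} :=
    (measurableSet_valueAfter y).preimage
      (f := fun p : (ℝ≥0 → ℕ) × ℕ × ℝ≥0∞ => (p.1, nextJump p.1 p.2.1 p.2.2))
      (measurable_fst.prodMk measurable_nextJump)
  have : {p | NextState p y} =
      ({p : (ℝ≥0 → ℕ) × ℕ × ℝ≥0∞ | nextJump p.1 p.2.1 p.2.2 = ∞} ∩ {p | y = p.2.1}) ∪
      ({p : (ℝ≥0 → ℕ) × ℕ × ℝ≥0∞ | nextJump p.1 p.2.1 p.2.2 = ∞}ᶜ ∩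
        ({p | ValueAfter p.1 (nextJump p.1 p.2.1 p.2.2) y} ∪
          ⋂ y', {p | ValueAfter p.1 (nextJump p.1 p.2.1 p.2.2) y'}ᶜ)) := by
    ext p
    simp only [NextState, Set.mem_ofPred_eq, Set.mem_union, Set.mem_inter_iff, Set.mem_compl_iff,
      Set.mem_iInter]
    split_ifs with h <;> simp [h]
  rw [this]
  exact (h1.inter (measurableSet_eq_fun measurable_const (by fun_prop))).union
    (h1.compl.inter ((h2 y).union (MeasurableSet.iInter fun y' => (h2 y').compl)))

/-- State after the `n`-th jump and time of the `n`-th jump. -/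
noncomputable def readJumps (x : ℝ≥0 → ℕ) : ℕ → ℕ × ℝ≥0∞
  | 0 => (x 0, 0)
  | n + 1 => readStep (x, readJumps x n)

/-- Jump chain and holding times of a path. -/
noncomputable def readPath (x : ℝ≥0 → ℕ) (n : ℕ) : ℕ × ℝ≥0∞ :=
  ((readJumps x n).1,
    if (readJumps x n).2 = ∞ then ∞ else (readJumps x (n + 1)).2 - (readJumps x n).2)

theorem measurable_readJumps (n : ℕ) : Measurable fun x => readJumps x n := by
  induction n with
  | zero => exact (measurable_pi_apply 0).prodMk measurable_const
  | succ n ih => exact measurable_readStep.comp (measurable_id.prodMk ih)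

theorem measurable_readPath : Measurable readPath := by
  refine measurable_pi_lambda _ fun n => ?_
  have h1 := measurable_readJumps n
  have h2 := measurable_readJumps (n + 1)
  refine h1.fst.prodMk (Measurable.ite ?_ measurable_const (h2.snd.sub h1.snd))
  exact measurableSet_eq_fun h1.snd measurable_const

/-- The time of the `n`-th jump. -/
noncomputable def jumpSum (z : ℕ → ℕ × ℝ≥0∞) (n : ℕ) : ℝ≥0∞ := ∑ m ∈ Finset.range n, (z m).2

theorem jumpSum_succ (z : ℕ → ℕ × ℝ≥0∞) (n : ℕ) : jumpSum z (n + 1) = jumpSum z n + (z n).2 :=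
  Finset.sum_range_succ _ _

/-- The path `x` has jump chain and holding times `z`. -/
structure IsPathOf (q : ℕ → ℕ → ℝ) (x : ℝ≥0 → ℕ) (z : ℕ → ℕ × ℝ≥0∞) : Prop where
  good : GoodChain q z
  tsum_eq : ∑' n, (z n).2 = ∞
  eq : ∀ (n : ℕ) (t : ℝ≥0), jumpSum z n ≤ t → (t : ℝ≥0∞) < jumpSum z (n + 1) → x t = (z n).1

variable {q : ℕ → ℕ → ℝ}

theorem jumpProb_self_of_ne_zero {x : ℕ} (h : totalRate q x ≠ 0) : jumpProb q x x = 0 := by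
  unfold jumpProb
  rw [if_neg h, if_pos rfl]

theorem eq_of_jumpProb_ne_zero {x y : ℕ} (h : totalRate q x = 0) (hy : jumpProb q x y ≠ 0) :
    y = x := by
  by_contra hne
  apply hy
  unfold jumpProb
  rw [if_pos h, if_neg hne]

/-- The path is constant on holding intervals of positive length, and a state that is left differs
from its successor. Rational times meet every such interval, so they detect the next jump time and
the value after it. -/
theorem IsPathOf.readJumps_eq {x : ℝ≥0 → ℕ} {z : ℕ → ℕ × ℝ≥0∞} (h : IsPathOf q x z) (n : ℕ) :
    readJumps x n = ((z n).1, jumpSum z n) := by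
  classical
  induction n with
  | zero =>
    have h0 : x 0 = (z 0).1 := h.eq 0 0 (by simp [jumpSum])
      (by simpa [jumpSum] using (h.good 0).1)
    simp [readJumps, jumpSum, h0]
  | succ n ih =>
    obtain ⟨hpos, htop, hjump⟩ := h.good n
    have hT : nextJump x (z n).1 (jumpSum z n) = jumpSum z (n + 1) := by
      refine le_antisymm ?_ (le_iInf fun r => ?_)
      · refine le_of_forall_gt fun b hb => ?_
        have hfin : jumpSum z (n + 1) ≠ ∞ := (hb.trans_le le_top).ne
        have hzn : (z n).2 ≠ ∞ := fun hz => hfin (by rw [jumpSum_succ, hz, add_top])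
        have hlt : jumpSum z (n + 1) < jumpSum z (n + 2) := by
          rw [jumpSum_succ z (n + 1)]
          exact ENNReal.lt_add_right hfin (h.good (n + 1)).1.ne'
        -- A rational time inside the next holding interval and below `b`. The path has changed its
        -- value there, because a state with finite holding time is not absorbing and never jumps to
        -- itself.
        obtain ⟨r, -, hr1, hr2⟩ := ENNReal.lt_iff_exists_rat_btwn.1 (lt_min hb hlt)
        have hxr := h.eq (n + 1) (Real.toNNReal r) hr1.le (hr2.trans_le (min_le_right _ _))
        have hne : (z (n + 1)).1 ≠ (z n).1 := by
          intro he
          rw [he] at hjump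
          exact hjump (jumpProb_self_of_ne_zero fun h0 => hzn (htop.2 h0))
        have hle : jumpSum z n ≤ jumpSum z (n + 1) := by rw [jumpSum_succ]; exact le_self_add
        refine lt_of_le_of_lt (iInf_le _ r) ?_
        rw [if_pos ⟨hle.trans_lt hr1, by rw [hxr]; exact hne⟩]
        exact hr2.trans_le (min_le_left _ _)
      · split_ifs with hr
        · by_contra hlt
          exact hr.2 (h.eq n _ hr.1.le (not_le.1 hlt))
        · exact le_top
    have hS : Nat.find (exists_nextState (x, (z n).1, jumpSum z n)) = (z (n + 1)).1 := by
      have hspec := Nat.find_spec (exists_nextState (x, (z n).1, jumpSum z n))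
      generalize Nat.find (exists_nextState (x, (z n).1, jumpSum z n)) = y at hspec
      simp only [NextState, hT] at hspec
      split_ifs at hspec with hinf
      · by_cases hz : totalRate q (z n).1 = 0
        · rw [hspec, eq_of_jumpProb_ne_zero hz hjump]
        · have hzn : (z n).2 ≠ ∞ := fun h' => hz (htop.1 h')
          exfalso
          -- Infinite holding times occur only at absorbing states, where the jump chain stays;
          -- state `n` would be absorbing as well.
          have hle : jumpSum z n ≠ ∞ := by
            intro h'
            obtain ⟨m, hm, hm'⟩ := ENNReal.sum_eq_top.1 h'
            obtain ⟨a, b, c⟩ := h.good m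
            have : ∀ k, m ≤ k → totalRate q (z k).1 = 0 := by
              intro k hk
              induction k, hk using Nat.le_induction with
              | base => exact b.1 hm'
              | succ k hk ihk =>
                rw [eq_of_jumpProb_ne_zero ihk (h.good k).2.2]; exact ihk
            exact hz (this n (Finset.mem_range.1 hm).le)
          rw [jumpSum_succ] at hinf
          exact (ENNReal.add_ne_top.2 ⟨hle, hzn⟩) hinf
      · have hlt : jumpSum z (n + 1) < jumpSum z (n + 2) := by
          rw [jumpSum_succ z (n + 1)]
          exact ENNReal.lt_add_right hinf (h.good (n + 1)).1.ne'
        have hval : ValueAfter x (jumpSum z (n + 1)) (z (n + 1)).1 := by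
          obtain ⟨k, hk⟩ := ENNReal.exists_inv_nat_lt (h.good (n + 1)).1.ne'
          refine ⟨k, fun r hr1 hr2 => h.eq (n + 1) _ hr1.le (hr2.trans_le ?_)⟩
          rw [jumpSum_succ z (n + 1)]
          refine add_le_add le_rfl (le_trans (ENNReal.inv_le_inv.2 ?_) hk.le)
          exact le_self_add
        have huniq : ∀ y, ValueAfter x (jumpSum z (n + 1)) y → y = (z (n + 1)).1 := by
          rintro y ⟨k, hk⟩
          have h1 : jumpSum z (n + 1) < jumpSum z (n + 1) + (k + 1 : ℝ≥0∞)⁻¹ :=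
            ENNReal.lt_add_right hinf (by simp [ENNReal.add_eq_top])
          obtain ⟨r, -, hr1, hr2⟩ := ENNReal.lt_iff_exists_rat_btwn.1 (lt_min h1 hlt)
          rw [← hk r hr1 (hr2.trans_le (min_le_left _ _)),
            h.eq (n + 1) _ hr1.le (hr2.trans_le (min_le_right _ _))]
        rcases hspec with hy | hy
        · exact huniq y hy
        · exact absurd hval (hy _)
    rw [readJumps, ih, readStep, hS, hT]

theorem IsPathOf.readPath_eq {x : ℝ≥0 → ℕ} {z : ℕ → ℕ × ℝ≥0∞} (h : IsPathOf q x z) :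
    readPath x = z := by
  ext n : 1
  rw [readPath, h.readJumps_eq, h.readJumps_eq]
  refine Prod.ext rfl ?_
  simp only
  split_ifs with ht
  -- After an infinite holding time a difference of jump times means nothing. The chain has been
  -- absorbed by then, and the true holding time is the default value `∞` of `readPath`.
  · obtain ⟨m, hm, hm'⟩ := ENNReal.sum_eq_top.1 ht
    have : ∀ k, m ≤ k → totalRate q (z k).1 = 0 := by
      intro k hk
      induction k, hk using Nat.le_induction with
      | base => exact (h.good m).2.1.1 hm'
      | succ k hk ihk => rw [eq_of_jumpProb_ne_zero ihk (h.good k).2.2]; exact ihk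
    exact ((h.good n).2.1.2 (this n (Finset.mem_range.1 hm).le)).symm
  · rw [jumpSum_succ, ENNReal.add_sub_cancel_left ht]

theorem measurableSet_goodChain (q : ℕ → ℕ → ℝ) : MeasurableSet {z | GoodChain q z} := by
  have : {z | GoodChain q z} = ⋂ m, {z : ℕ → ℕ × ℝ≥0∞ | 0 < (z m).2} ∩
      ({z | (z m).2 = ∞ ↔ totalRate q (z m).1 = 0} ∩
        {z | jumpProb q (z m).1 (z (m + 1)).1 ≠ 0}) := by
    ext z; simp [GoodChain]
  rw [this]
  refine MeasurableSet.iInter fun m => MeasurableSet.inter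
    (measurableSet_lt (g := fun z : ℕ → ℕ × ℝ≥0∞ => (z m).2) measurable_const (by fun_prop))
    (MeasurableSet.inter ?_ ?_)
  · have h1 : MeasurableSet {z : ℕ → ℕ × ℝ≥0∞ | (z m).2 = ∞} :=
      measurableSet_eq_fun (by fun_prop) measurable_const
    have h2 : MeasurableSet {z : ℕ → ℕ × ℝ≥0∞ | totalRate q (z m).1 = 0} :=
      (by fun_prop : Measurable fun z : ℕ → ℕ × ℝ≥0∞ => (z m).1)
        (MeasurableSet.of_discrete (s := {y | totalRate q y = 0}))
    exact h1.iff h2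
  · exact (by fun_prop : Measurable fun z : ℕ → ℕ × ℝ≥0∞ => ((z m).1, (z (m + 1)).1))
      (MeasurableSet.of_discrete (s := {y : ℕ × ℕ | jumpProb q y.1 y.2 ≠ 0}))

/-- Jump chain and holding times of a Markov chain can be read off its paths. -/
theorem IsMarkovChain.map_readPath [ProperRates q] {Ω : Type*} [MeasurableSpace Ω] {μ : Measure Ω}
    [IsProbabilityMeasure μ] {x₀ : ℕ} {X : Ω → ℝ≥0 → ℕ} (h : IsMarkovChain q x₀ X μ) :
    μ.map (fun ω => readPath (X ω)) = chainLaw q x₀ ∧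
      ∀ᵐ ω ∂μ, IsPathOf q (X ω) (readPath (X ω)) ∧ (readPath (X ω) 0).1 = x₀ := by
  obtain ⟨Y, H, hY, hH, h0, hcyl, hsum, hXY⟩ := h
  set Z : Ω → ℕ → ℕ × ℝ≥0∞ := fun ω m => (Y m ω, H m ω) with hZ
  have hZm : Measurable Z := measurable_pi_lambda _ fun m =>
    (measurable_to_countable' fun x => hY m x).prodMk (hH m)
  have : IsProbabilityMeasure (μ.map Z) := Measure.isProbabilityMeasure_map hZm.aemeasurable
  have hlaw : μ.map Z = chainLaw q x₀ := by
    refine eq_chainLaw q ?_ fun n y t hy => ?_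
    · have hm : MeasurableSet {z : ℕ → ℕ × ℝ≥0∞ | (z 0).1 = x₀} :=
        (by fun_prop : Measurable fun z : ℕ → ℕ × ℝ≥0∞ => (z 0).1) (measurableSet_singleton x₀)
      rw [ae_map_iff hZm.aemeasurable hm]
      exact h0
    · rw [← hcyl n y t hy, Measure.map_apply hZm]
      · rfl
      · exact measurableSet_holdCylinder n y fun m => Or.inr ⟨t m, rfl⟩
  have hgood : ∀ᵐ ω ∂μ, GoodChain q (Z ω) := by
    have := ae_goodChain q x₀
    rw [← hlaw, ae_map_iff hZm.aemeasurable (measurableSet_goodChain q)] at this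
    exact this
  have hpath : ∀ᵐ ω ∂μ, IsPathOf q (X ω) (Z ω) := by
    filter_upwards [hgood, hsum, hXY] with ω a b c using ⟨a, b, c⟩
  refine ⟨?_, ?_⟩
  · rw [← hlaw]
    refine Measure.map_congr ?_
    filter_upwards [hpath] with ω hω using hω.readPath_eq
  · filter_upwards [hpath, h0] with ω hω h0
    rw [hω.readPath_eq]
    exact ⟨hω, h0⟩

end ReadPath

/-! ### Rates of tables and of the Poisson process -/

section TableRates

theorem properRates_of_tsum {q : ℕ → ℕ → ℝ} (hq : ∀ x y, 0 ≤ q x y) (hd : ∀ x, q x x = 0)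
    {r : ℕ → ℝ} (hr : ∀ x, 0 ≤ r x)
    (h : ∀ x, ∑' y, ENNReal.ofReal (q x y) = ENNReal.ofReal (r x)) :
    (∀ x, totalRate q x = r x) ∧ ProperRates q := by
  classical
  have ht : ∀ x, totalRate q x = r x := by
    intro x
    have h1 : totalRate q x = ∑' y, q x y := by
      unfold totalRate
      refine tsum_congr fun y => ?_
      split_ifs with hy
      · rw [hy, hd]
      · rfl
    have h2 := congrArg ENNReal.toReal (h x)
    rw [ENNReal.tsum_toReal_eq fun _ => ENNReal.ofReal_ne_top, ENNReal.toReal_ofReal (hr x)] at h2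
    rw [h1, ← h2]
    exact tsum_congr fun y => (ENNReal.toReal_ofReal (hq x y)).symm
  refine ⟨ht, fun x => (ht x).symm ▸ hr x, fun x y => ?_, fun x => ?_⟩
  · unfold jumpProb
    rw [ht]
    split_ifs <;> first | exact div_nonneg (hq x y) (hr x) | norm_num
  · by_cases hx : r x = 0
    · have : ∀ y, jumpProb q x y = if y = x then 1 else 0 := fun y => by
        unfold jumpProb; rw [ht, if_pos hx]; split_ifs <;> rfl
      simp_rw [this]
      rw [tsum_eq_single x fun y hy => by simp [hy]]
      simp
    · have : ∀ y, ENNReal.ofReal (jumpProb q x y) =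
          ENNReal.ofReal (q x y) * ENNReal.ofReal (r x)⁻¹ := fun y => by
        unfold jumpProb
        rw [ht, if_neg hx, ← ENNReal.ofReal_mul (hq x y)]
        split_ifs with hy
        · rw [hy, hd, zero_mul]
        · rfl
      simp_rw [this]
      rw [ENNReal.tsum_mul_right, h, ← ENNReal.ofReal_mul (hr x), mul_inv_cancel₀ hx,
        ENNReal.ofReal_one]

variable {α : ℝ}

theorem tsum_tableRate_mul (hα₁ : α ≤ 1) {n : ℕ} (hn : n ≠ 0) :
    ∑' m, ENNReal.ofReal (tableRate α n m) = ENNReal.ofReal (2 * n - α) := by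
  have hn' : (1 : ℝ) ≤ n := by exact_mod_cast Nat.one_le_iff_ne_zero.2 hn
  have h : ∀ m, ENNReal.ofReal (tableRate α n m) =
      (if m = n + 1 then ENNReal.ofReal (n - α) else 0) +
        (if m = n - 1 then ENNReal.ofReal n else 0) := by
    intro m
    unfold tableRate
    rw [if_neg hn]
    by_cases h1 : m = n + 1
    · have : ¬ m = n - 1 := by omega
      rw [if_pos h1, if_pos h1, if_neg this, add_zero]
    · by_cases h2 : m = n - 1
      · have h3 : n - 1 + 1 = n := by omega
        have h4 : ¬ n - 1 = n + 1 := by omega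
        simp [h2, h3, h4]
      · have h3 : ¬ m + 1 = n := by omega
        simp [h1, h2, h3]
  simp_rw [h]
  rw [ENNReal.tsum_add, tsum_ite_eq, tsum_ite_eq, ← ENNReal.ofReal_add (by linarith) (by positivity)]
  congr 1; ring

theorem tableRate_nonneg (hα₁ : α ≤ 1) (n m : ℕ) : 0 ≤ tableRate α n m := by
  unfold tableRate
  split_ifs with h
  · exact le_rfl
  · have hn' : (1 : ℝ) ≤ n := by exact_mod_cast Nat.one_le_iff_ne_zero.2 h
    linarith
  · positivity
  · exact le_rfl

theorem tableRate_self (n : ℕ) : tableRate α n n = 0 := by simp [tableRate]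

theorem tableRate_proper (hα₁ : α ≤ 1) :
    (∀ n, totalRate (tableRate α) n = if n = 0 then 0 else 2 * n - α) ∧
      ProperRates (tableRate α) := by
  refine properRates_of_tsum (tableRate_nonneg hα₁) tableRate_self (fun n => ?_) fun n => ?_
  · split_ifs with h
    · exact le_rfl
    · have hn' : (1 : ℝ) ≤ n := by exact_mod_cast Nat.one_le_iff_ne_zero.2 h
      linarith
  · split_ifs with h
    · simp [h, tableRate]
    · exact tsum_tableRate_mul hα₁ h

theorem poissonRate_proper {r : ℝ} (hr : 0 ≤ r) :
    (∀ n, totalRate (fun m l : ℕ => if l = m + 1 then r else 0) n = r) ∧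
      ProperRates (fun m l : ℕ => if l = m + 1 then r else 0) := by
  refine properRates_of_tsum (fun n m => by split_ifs <;> simp [hr]) (by simp) (fun _ => hr)
    fun n => ?_
  rw [tsum_eq_single (n + 1) fun m hm => by simp [hm]]
  simp

theorem jumpProb_tableRate (hα₁ : α ≤ 1) {n : ℕ} (hn : n ≠ 0) (m : ℕ) :
    ENNReal.ofReal (2 * n - α) * ENNReal.ofReal (jumpProb (tableRate α) n m) =
      ENNReal.ofReal (tableRate α n m) := by
  have hn' : (1 : ℝ) ≤ n := by exact_mod_cast Nat.one_le_iff_ne_zero.2 hn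
  have hr : (0 : ℝ) < 2 * n - α := by linarith
  have ht := (tableRate_proper hα₁).1 n
  rw [if_neg hn] at ht
  rw [← ENNReal.ofReal_mul hr.le]
  unfold jumpProb
  rw [ht, if_neg hr.ne']
  split_ifs with h
  · rw [h, tableRate_self, mul_zero]
  · congr 1; field_simp

end TableRates

/-! ### The word of an excursion as a function of its driving variables -/

section Machine

/-- The current level, the rest of the current table, the gaps to the next birth events, and the
tables to be used next. -/
abbrev MachineState : Type :=
  ℝ × (ℕ → ℕ × ℝ≥0∞) × (ℕ → ℝ≥0∞) × (ℕ → ℕ → ℕ × ℝ≥0∞)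

/-- The excursion ends here. -/
def HaltsNow (d : MachineState) : Prop := (d.2.1 0).1 = 0 ∧ ENNReal.ofReal d.1 < d.2.2.1 0

/-- A step of the machine: a table follows its chain until it is absorbed in `0`, then the level
goes down by the next gap and the next table is started. -/
noncomputable def machineStep (d : MachineState) : MachineState :=
  if (d.2.1 0).1 ≠ 0 then (d.1 + (d.2.1 0).2.toReal, tailStream d.2.1, d.2.2)
  else (d.1 - (d.2.2.1 0).toReal, d.2.2.2 0, tailStream d.2.2.1, tailStream d.2.2.2)

/-- The level and table size that describe a state of the machine. -/
def machineLetter (d : MachineState) : Letter := (d.1, (d.2.1 0).1)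

/-- The letters of the first steps of the machine. -/
noncomputable def machineWord : ℕ → MachineState → Word
  | 0, _ => []
  | k + 1, d => machineLetter (machineStep d) :: machineWord k (machineStep d)

/-- The machine halts after exactly `k` steps. -/
def HaltsAt : ℕ → MachineState → Prop
  | 0, d => HaltsNow d
  | k + 1, d => ¬ HaltsNow d ∧ HaltsAt k (machineStep d)

theorem measurableSet_haltsNow : MeasurableSet {d | HaltsNow d} := by
  refine MeasurableSet.inter ?_ (measurableSet_lt
    (f := fun d : MachineState => ENNReal.ofReal d.1) (g := fun d => d.2.2.1 0)
    (by fun_prop) (by fun_prop))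
  exact (by fun_prop : Measurable fun d : MachineState => (d.2.1 0).1) (measurableSet_singleton 0)

theorem measurable_machineStep : Measurable machineStep := by
  refine Measurable.ite ?_ (by fun_prop) ?_
  · exact ((by fun_prop : Measurable fun d : MachineState => (d.2.1 0).1)
      (measurableSet_singleton 0)).compl
  · have : Measurable fun d : MachineState => d.2.2.2 0 := by fun_prop
    fun_prop

theorem measurable_machineLetter : Measurable machineLetter := by unfold machineLetter; fun_prop

theorem measurable_machineWord (k : ℕ) : Measurable (machineWord k) := by
  induction k with
  | zero => exact measurable_const
  | succ k ih =>
    exact Measurable.list_cons (measurable_machineLetter.comp measurable_machineStep)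
      (ih.comp measurable_machineStep)

theorem measurableSet_haltsAt (k : ℕ) : MeasurableSet {d | HaltsAt k d} := by
  induction k with
  | zero => exact measurableSet_haltsNow
  | succ k ih => exact measurableSet_haltsNow.compl.inter (measurable_machineStep ih)

theorem HaltsAt.unique {j k : ℕ} {d : MachineState} (hj : HaltsAt j d) (hk : HaltsAt k d) :
    j = k := by
  induction j generalizing k d with
  | zero =>
    cases k with
    | zero => rfl
    | succ k => exact absurd hj hk.1
  | succ j ih =>
    cases k with
    | zero => exact absurd hk hj.1
    | succ k => rw [ih hj.2 hk.2]

open Classical in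
/-- The value of a function at the word of the machine, if it halts after exactly `k` steps. -/
noncomputable def machineValue (k : ℕ) (F : Word → ℝ≥0∞) (d : MachineState) : ℝ≥0∞ :=
  if HaltsAt k d then F (machineWord k d) else 0

theorem measurable_machineValue (k : ℕ) {F : Word → ℝ≥0∞} (hF : Measurable F) :
    Measurable (machineValue k F) :=
  Measurable.ite (measurableSet_haltsAt k) (hF.comp (measurable_machineWord k)) measurable_const

theorem machineValue_succ (k : ℕ) (F : Word → ℝ≥0∞) (d : MachineState) (h : ¬ HaltsNow d) :
    machineValue (k + 1) F d =
      machineValue k (fun w => F (machineLetter (machineStep d) :: w)) (machineStep d) := by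
  by_cases a : HaltsAt k (machineStep d)
  · have b : HaltsAt (k + 1) d := ⟨h, a⟩
    rw [machineValue, machineValue, if_pos a, if_pos b]
    rfl
  · have b : ¬ HaltsAt (k + 1) d := fun b => a b.2
    rw [machineValue, machineValue, if_neg a, if_neg b]

variable {α : ℝ} [ProperRates (tableRate α)]

/-- The law of gaps and tables. -/
noncomputable def reserveLaw (α : ℝ) [ProperRates (tableRate α)] :
    Measure ((ℕ → ℝ≥0∞) × (ℕ → ℕ → ℕ × ℝ≥0∞)) :=
  (streamLaw (expLaw α)).prod (streamLaw (chainLaw (tableRate α) 1))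

instance : IsProbabilityMeasure (reserveLaw α) := by unfold reserveLaw; infer_instance

theorem lintegral_reserveLaw_cons {F : (ℕ → ℝ≥0∞) × (ℕ → ℕ → ℕ × ℝ≥0∞) → ℝ≥0∞}
    (hF : Measurable F) : ∫⁻ r, F r ∂reserveLaw α =
      ∫⁻ g, ∫⁻ z, ∫⁻ r, F (consStream g r.1, consStream z r.2) ∂reserveLaw α
        ∂chainLaw (tableRate α) 1 ∂expLaw α := by
  rw [reserveLaw, lintegral_prod _ hF.aemeasurable,
    lintegral_streamLaw_cons _ hF.lintegral_prod_right']
  congr 1; ext g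
  have h1 (x : ℕ → ℝ≥0∞) : ∫⁻ y, F (consStream g x, y) ∂streamLaw (chainLaw (tableRate α) 1) =
      ∫⁻ z, ∫⁻ y, F (consStream g x, consStream z y) ∂streamLaw (chainLaw (tableRate α) 1)
        ∂chainLaw (tableRate α) 1 := lintegral_streamLaw_cons _ (hF.comp measurable_prodMk_left)
  simp_rw [h1]
  have h2 : Measurable fun p : (ℕ → ℝ≥0∞) × (ℕ → ℕ × ℝ≥0∞) =>
      ∫⁻ y, F (consStream g p.1, consStream p.2 y) ∂streamLaw (chainLaw (tableRate α) 1) := by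
    have : Measurable fun p : ((ℕ → ℝ≥0∞) × (ℕ → ℕ × ℝ≥0∞)) × (ℕ → ℕ → ℕ × ℝ≥0∞) =>
      F (consStream g p.1.1, consStream p.1.2 p.2) := by fun_prop
    exact this.lintegral_prod_right'
  rw [lintegral_lintegral_swap h2.aemeasurable]
  congr 1; ext z
  rw [lintegral_prod]
  exact (hF.comp (by fun_prop)).aemeasurable

/-- Integrals against the law of the machine started from level `s` with a table of size `n`. -/
noncomputable def machineIntegral (α : ℝ) [ProperRates (tableRate α)] (n : ℕ) (s : ℝ)
    (Φ : MachineState → ℝ≥0∞) : ℝ≥0∞ :=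
  ∫⁻ z, ∫⁻ r, Φ (s, z, r) ∂reserveLaw α ∂chainLaw (tableRate α) n

theorem lintegral_powMeasure_letter (k : ℕ) {F : Word → ℝ≥0∞} (hF : Measurable F) :
    ∫⁻ w, F w ∂powMeasure letterMeasure (k + 1) =
      ∫⁻ l in Set.Ioi 0, ∑' m, ∫⁻ w, F ((l, m) :: w) ∂powMeasure letterMeasure k := by
  rw [lintegral_powMeasure_succ _ _ hF, lintegral_letterMeasure]
  have : Measurable fun p : Letter × Word => F (p.1 :: p.2) := by fun_prop
  exact this.lintegral_prod_right'

/-- The factor `exp (-(α * s))` is the probability that the next gap exceeds `s`, and it acts as a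
potential of the current level. A step down from `s` to `l` has density `α * exp (-(α * (s - l)))`,
which combines with the potential at `l` to `α` times the potential at `s`. A step up raises the
potential term by the `α` that completes the table rate to `2 * n`. At the end, halting at level `s`
has exactly the probability given by the potential. -/
theorem machineIntegral_machineValue (hα₀ : 0 ≤ α) (hα₁ : α ≤ 1) (k n : ℕ) {s : ℝ} (hs : 0 ≤ s)
    {F : Word → ℝ≥0∞} (hF : Measurable F) :
    machineIntegral α n s (machineValue k F) =
      ENNReal.ofReal (Real.exp (-(α * s))) *
        ∫⁻ w, F w * weight α n s w ∂powMeasure letterMeasure k := by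
  classical
  induction k generalizing n s F with
  | zero =>
    have hr : ∫⁻ w, F w * weight α n s w ∂powMeasure letterMeasure 0 =
        F [] * if n = 0 then 1 else 0 := by
      rw [powMeasure, lintegral_dirac' _ (by fun_prop)]; rfl
    rw [hr]
    have h1 : ∀ᵐ z ∂chainLaw (tableRate α) n, ∫⁻ r, machineValue 0 F (s, z, r) ∂reserveLaw α =
        (F [] * if n = 0 then 1 else 0) * ENNReal.ofReal (Real.exp (-(α * s))) := by
      filter_upwards [ae_chainLaw_zero (tableRate α) n] with z hz
      have hm : MeasurableSet {r : (ℕ → ℝ≥0∞) × (ℕ → ℕ → ℕ × ℝ≥0∞) | ENNReal.ofReal s < r.1 0} :=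
        measurableSet_lt measurable_const (by fun_prop)
      have h2 : ∀ r, machineValue 0 F (s, z, r) = (F [] * if n = 0 then 1 else 0) *
          {r : (ℕ → ℝ≥0∞) × (ℕ → ℕ → ℕ × ℝ≥0∞) | ENNReal.ofReal s < r.1 0}.indicator 1 r := by
        intro r
        by_cases a : n = 0 <;> by_cases b : ENNReal.ofReal s < r.1 0 <;>
          simp [machineValue, HaltsAt, HaltsNow, machineWord, hz, a, b]
      simp_rw [h2]
      rw [lintegral_const_mul _ (measurable_one.indicator hm), lintegral_indicator_one hm]
      congr 1
      have h3 : {r : (ℕ → ℝ≥0∞) × (ℕ → ℕ → ℕ × ℝ≥0∞) | ENNReal.ofReal s < r.1 0} =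
          ((fun x : ℕ → ℝ≥0∞ => x 0) ⁻¹' Set.Ioi (ENNReal.ofReal s)) ×ˢ Set.univ := by
        ext r; simp
      have h4 := expLaw_Ioi hα₀ (Real.toNNReal s)
      rw [Real.coe_toNNReal s hs] at h4
      rw [h3, reserveLaw, Measure.prod_prod, measure_univ, mul_one,
        ← Measure.map_apply (by fun_prop) measurableSet_Ioi, streamLaw,
        Measure.infinitePi_map_eval, ← h4]
      rfl
    rw [machineIntegral, lintegral_congr_ae h1, lintegral_const, measure_univ, mul_one, mul_comm]
  | succ k ih =>
    have hVm (s : ℝ) : Measurable fun p : (ℕ → ℕ × ℝ≥0∞) × (ℕ → ℝ≥0∞) × (ℕ → ℕ → ℕ × ℝ≥0∞) =>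
        machineValue (k + 1) F (s, p) :=
      (measurable_machineValue (k + 1) hF).comp measurable_prodMk_left
    have hI (l : ℝ) (m : ℕ) : Measurable fun w : Word => F ((l, m) :: w) := by fun_prop
    set I : ℝ → ℕ → ℝ≥0∞ := fun l m =>
      ∫⁻ w, F ((l, m) :: w) * weight α m l w ∂powMeasure letterMeasure k with hIdef
    have hIm (m : ℕ) : Measurable fun l => I l m := by
      have : Measurable fun p : ℝ × Word => F ((p.1, m) :: p.2) * weight α m p.1 p.2 := by fun_prop
      exact this.lintegral_prod_right'
    have hR : ∫⁻ w, F w * weight α n s w ∂powMeasure letterMeasure (k + 1) =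
        ∫⁻ l in Set.Ioi 0, ∑' m, stepWeight α n s l m * I l m := by
      rw [lintegral_powMeasure_letter _ (by fun_prop)]
      congr 1; ext l
      refine tsum_congr fun m => ?_
      simp only [weight, hIdef]
      rw [← lintegral_const_mul _ (by fun_prop)]
      congr 1; ext w; ring
    rw [hR]
    by_cases hn : n = 0
    · subst hn
      have h1 : ∀ᵐ z ∂chainLaw (tableRate α) 0,
          ∫⁻ r, machineValue (k + 1) F (s, z, r) ∂reserveLaw α =
          ENNReal.ofReal (Real.exp (-(α * s))) *
            ∫⁻ l in Set.Ioi 0, ∑' m, stepWeight α 0 s l m * I l m := by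
        filter_upwards [ae_chainLaw_zero (tableRate α) 0] with z hz
        have hVz : Measurable fun r => machineValue (k + 1) F (s, z, r) :=
          (hVm s).comp measurable_prodMk_left
        rw [lintegral_reserveLaw_cons hVz]
        have h2 (g : ℝ≥0∞) : ∫⁻ z', ∫⁻ r, machineValue (k + 1) F
            (s, z, (consStream g r.1, consStream z' r.2)) ∂reserveLaw α ∂chainLaw (tableRate α) 1 =
            {g : ℝ≥0∞ | g ≤ ENNReal.ofReal s}.indicator (fun g =>
              ENNReal.ofReal (Real.exp (-(α * (s - g.toReal)))) * I (s - g.toReal) 1) g := by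
          by_cases hg : g ≤ ENNReal.ofReal s
          · have hgs : g.toReal ≤ s := by
              have := ENNReal.toReal_mono ENNReal.ofReal_ne_top hg
              rwa [ENNReal.toReal_ofReal hs] at this
            have hg' : g ∈ {g : ℝ≥0∞ | g ≤ ENNReal.ofReal s} := hg
            rw [Set.indicator_of_mem hg', ← ih 1 (sub_nonneg.2 hgs) (hI _ _), machineIntegral]
            refine lintegral_congr_ae ?_
            filter_upwards [ae_chainLaw_zero (tableRate α) 1] with z' hz'
            congr 1; ext r
            rw [machineValue_succ]
            · simp [machineStep, hz, machineLetter, hz']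
            · simp [HaltsNow, hg]
          · have hg' : g ∉ {g : ℝ≥0∞ | g ≤ ENNReal.ofReal s} := hg
            rw [Set.indicator_of_notMem hg']
            have : ∀ (z' : ℕ → ℕ × ℝ≥0∞) (r : (ℕ → ℝ≥0∞) × (ℕ → ℕ → ℕ × ℝ≥0∞)),
                machineValue (k + 1) F
                (s, z, (consStream g r.1, consStream z' r.2)) = 0 := by
              intro z' r
              have : HaltsNow (s, z, (consStream g r.1, consStream z' r.2)) :=
                ⟨hz, by simpa using hg⟩
              simp [machineValue, HaltsAt, this]
            simp [this]
        simp_rw [h2]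
        have hms : MeasurableSet {g : ℝ≥0∞ | g ≤ ENNReal.ofReal s} := measurableSet_Iic
        have hJ : Measurable fun g : ℝ≥0∞ =>
            ENNReal.ofReal (Real.exp (-(α * (s - g.toReal)))) * I (s - g.toReal) 1 :=
          Measurable.mul (by fun_prop) ((hIm 1).comp (by fun_prop))
        rw [lintegral_expLaw α (hJ.indicator hms)]
        -- For `α = 0` the gap is infinite: the machine halts instead of starting another table, and
        -- the indicator vanishes.
        have htop : (if α ≤ 0 then {g : ℝ≥0∞ | g ≤ ENNReal.ofReal s}.indicator (fun g =>
              ENNReal.ofReal (Real.exp (-(α * (s - g.toReal)))) * I (s - g.toReal) 1) ∞ else 0) =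
              0 := by
          simp
        -- The substitution `l = s - g` replaces the gap by the level of the next birth. Gaps beyond
        -- `s` correspond to negative levels and do not contribute.
        rw [htop, add_zero, ← lintegral_const_mul' _ _ ENNReal.ofReal_ne_top,
          ← lintegral_indicator measurableSet_Ioi, ← lintegral_indicator measurableSet_Ioi,
          ← lintegral_sub_left_eq_self _ s]
        have hne0 : ∀ᵐ t : ℝ, t ≠ 0 := by simp [ae_iff]
        have hnes : ∀ᵐ t : ℝ, t ≠ s := by simp [ae_iff]
        refine lintegral_congr_ae ?_
        filter_upwards [hne0, hnes] with l hl0 hls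
        have hsw : ∀ l m, stepWeight α 0 s l m * I l m =
            if m = 1 then (if l < s then ENNReal.ofReal α else 0) * I l 1 else 0 := by
          intro l m
          unfold stepWeight
          by_cases a : m = 1 <;> by_cases b : l < s <;> simp [a, b]
        simp_rw [hsw, tsum_ite_eq]
        by_cases b : l < s
        · have b' : (0 : ℝ) < s - l := sub_pos.2 b
          by_cases c : 0 < l
          · have e1 : ENNReal.ofReal (s - l) ≤ ENNReal.ofReal s :=
              ENNReal.ofReal_le_ofReal (by linarith)
            have e2 : Real.exp (-(α * s)) =
                Real.exp (-(α * (s - l))) * Real.exp (-(α * l)) := by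
              rw [← Real.exp_add]; congr 1; ring
            simp only [Set.indicator_apply, Set.mem_Ioi, b', c, if_true, Set.mem_ofPred_eq, e1, b,
              ENNReal.toReal_ofReal b'.le, sub_sub_cancel, e2,
              ENNReal.ofReal_mul (Real.exp_pos _).le]
            ring
          · have c' : l < 0 := lt_of_le_of_ne (not_lt.1 c) hl0
            have e1 : ¬ ENNReal.ofReal (s - l) ≤ ENNReal.ofReal s := by
              rw [ENNReal.ofReal_le_ofReal_iff hs]; linarith
            simp [Set.indicator_apply, c, e1]
        · have b' : ¬ l < s := b
          have b2 : ¬ (0 : ℝ) < s - l := by linarith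
          simp [Set.indicator_apply, b']
      rw [machineIntegral, lintegral_congr_ae h1, lintegral_const, measure_univ, mul_one]
    · have hn' : (1 : ℝ) ≤ n := by exact_mod_cast Nat.one_le_iff_ne_zero.2 hn
      have hr : (0 : ℝ) < 2 * n - α := by linarith
      have ht := (tableRate_proper hα₁).1 n
      rw [if_neg hn] at ht
      rw [machineIntegral, lintegral_chainLaw _ _ (hVm s).lintegral_prod_right', ht]
      have h2 (h : ℝ≥0∞) : ∑' m, ENNReal.ofReal (jumpProb (tableRate α) n m) *
          ∫⁻ z, ∫⁻ r, machineValue (k + 1) F (s, consStream (n, h) z, r) ∂reserveLaw α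
            ∂chainLaw (tableRate α) m =
          ∑' m, ENNReal.ofReal (jumpProb (tableRate α) n m) *
            (ENNReal.ofReal (Real.exp (-(α * (s + h.toReal)))) * I (s + h.toReal) m) := by
        refine tsum_congr fun m => ?_
        rw [← ih m (add_nonneg hs ENNReal.toReal_nonneg) (hI _ _), machineIntegral]
        congr 1
        refine lintegral_congr_ae ?_
        filter_upwards [ae_chainLaw_zero (tableRate α) m] with z hz
        congr 1; ext r
        rw [machineValue_succ]
        · simp [machineStep, hn, machineLetter, hz]
        · simp [HaltsNow, hn]
      simp_rw [h2]
      have hJ : Measurable fun h : ℝ≥0∞ => ∑' m, ENNReal.ofReal (jumpProb (tableRate α) n m) *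
          (ENNReal.ofReal (Real.exp (-(α * (s + h.toReal)))) * I (s + h.toReal) m) :=
        Measurable.tsum fun m => Measurable.const_mul
          (Measurable.mul (by fun_prop) ((hIm m).comp (by fun_prop))) _
      rw [lintegral_expLaw_of_pos hr hJ,
        ← lintegral_const_mul' _ _ ENNReal.ofReal_ne_top, ← lintegral_Ioi_shift (t := s),
        ← lintegral_indicator measurableSet_Ioi, ← lintegral_indicator measurableSet_Ioi]
      congr 1; ext l
      by_cases a : s < l
      · have a0 : 0 < l := hs.trans_lt a
        have a1 : 0 ≤ l - s := by linarith
        simp only [Set.indicator_apply, Set.mem_Ioi, a, a0, if_true, ENNReal.toReal_ofReal a1,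
          add_sub_cancel]
        rw [← ENNReal.tsum_mul_left, ← ENNReal.tsum_mul_left]
        refine tsum_congr fun m => ?_
        rw [stepWeight, if_neg hn, if_pos a, ← jumpProb_tableRate hα₁ hn]
        -- The exponent `2 * n` arises here: the holding time supplies `2 * n - α`, and the
        -- potential at the new level `l` the missing `α`.
        have e : ENNReal.ofReal (Real.exp (-((2 * n - α) * (l - s)))) *
            ENNReal.ofReal (Real.exp (-(α * l))) =
            ENNReal.ofReal (Real.exp (-(α * s))) *
              ENNReal.ofReal (Real.exp (-(2 * n * (l - s)))) := by
          rw [← ENNReal.ofReal_mul (Real.exp_pos _).le, ← ENNReal.ofReal_mul (Real.exp_pos _).le,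
            ← Real.exp_add, ← Real.exp_add]
          congr 2; ring
        calc _ = (ENNReal.ofReal (Real.exp (-((2 * n - α) * (l - s)))) *
            ENNReal.ofReal (Real.exp (-(α * l)))) * (ENNReal.ofReal (2 * n - α) *
              ENNReal.ofReal (jumpProb (tableRate α) n m) * I l m) := by ring
          _ = _ := by rw [e]; ring
      · simp [Set.indicator_apply, a, stepWeight, hn]

end Machine

/-! ### The law of the word of an excursion -/

section MachineLaw

open Classical in
/-- The word produced by the machine when it halts. -/
noncomputable def machineOutput (d : MachineState) : Word :=
  if h : ∃ k, HaltsAt k d then machineWord (Nat.find h) d else []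

theorem machineOutput_eq {k : ℕ} {d : MachineState} (h : HaltsAt k d) :
    machineOutput d = machineWord k d := by
  classical
  have hex : ∃ k, HaltsAt k d := ⟨k, h⟩
  rw [machineOutput, dif_pos hex, (Nat.find_spec hex).unique h]

theorem measurable_machineOutput : Measurable machineOutput := by
  intro s hs
  have : machineOutput ⁻¹' s = (⋃ k, {d | HaltsAt k d} ∩ machineWord k ⁻¹' s) ∪
      ((⋃ k, {d | HaltsAt k d})ᶜ ∩ {_d | ([] : Word) ∈ s}) := by
    ext d
    simp only [Set.mem_preimage, Set.mem_union, Set.mem_iUnion, Set.mem_inter_iff,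
      Set.mem_ofPred_eq, Set.mem_compl_iff]
    by_cases h : ∃ k, HaltsAt k d
    · obtain ⟨k, hk⟩ := h
      rw [machineOutput_eq hk]
      refine ⟨fun h => Or.inl ⟨k, hk, h⟩, ?_⟩
      rintro (⟨j, hj, h⟩ | ⟨h, -⟩)
      · rwa [hk.unique hj]
      · exact absurd ⟨k, hk⟩ h
    · have h' : ∀ k, ¬ HaltsAt k d := fun k hk => h ⟨k, hk⟩
      rw [machineOutput, dif_neg h]
      simp [h']
  rw [this]
  refine (MeasurableSet.iUnion fun k => (measurableSet_haltsAt k).inter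
    (measurable_machineWord k hs)).union ((MeasurableSet.iUnion fun k =>
      measurableSet_haltsAt k).compl.inter (MeasurableSet.const _))

theorem tsum_machineValue {F : Word → ℝ≥0∞} {d : MachineState} (h : ∃ k, HaltsAt k d) :
    ∑' k, machineValue k F d = F (machineOutput d) := by
  obtain ⟨k, hk⟩ := h
  rw [machineOutput_eq hk, tsum_eq_single k]
  · simp [machineValue, hk]
  · intro j hj
    have : ¬ HaltsAt j d := fun h => hj (h.unique hk)
    simp [machineValue, this]

variable {α : ℝ} [ProperRates (tableRate α)]

/-- The law of the initial state of the machine. -/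
noncomputable def machineLaw (α : ℝ) [ProperRates (tableRate α)] (n : ℕ) : Measure MachineState :=
  ((chainLaw (tableRate α) n).prod (reserveLaw α)).map fun p => (0, p)

instance (n : ℕ) : IsProbabilityMeasure (machineLaw α n) :=
  Measure.isProbabilityMeasure_map (by fun_prop)

theorem lintegral_machineLaw (n : ℕ) {Φ : MachineState → ℝ≥0∞} (hΦ : Measurable Φ) :
    ∫⁻ d, Φ d ∂machineLaw α n = machineIntegral α n 0 Φ := by
  rw [machineLaw, lintegral_map hΦ (by fun_prop), lintegral_prod _ (by fun_prop), machineIntegral]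

/-- At the initial level `0` the potential equals one. The sum over the number of steps corresponds
to the sum over word lengths in the free measure. -/
theorem lintegral_tsum_machineValue (hα₀ : 0 ≤ α) (hα₁ : α ≤ 1) (n : ℕ) {F : Word → ℝ≥0∞}
    (hF : Measurable F) :
    ∫⁻ d, ∑' k, machineValue k F d ∂machineLaw α n = ∫⁻ w, F w ∂excursionLaw α n := by
  rw [lintegral_tsum fun k => (measurable_machineValue k hF).aemeasurable,
    lintegral_excursionLaw _ hF, lintegral_freeMeasure]
  refine tsum_congr fun k => ?_
  rw [lintegral_machineLaw _ (measurable_machineValue k hF),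
    machineIntegral_machineValue hα₀ hα₁ k n le_rfl hF]
  simp

/-- The machine halts after at most one number of steps, so the mass is a halting probability and
hence at most one; the extinction recursion then forces equality. -/
theorem excursionLaw_univ_eq_one (hα₀ : 0 ≤ α) (hα₁ : α ≤ 1) (n : ℕ) :
    excursionLaw α n Set.univ = 1 := by
  refine excursionLaw_univ hα₀ hα₁ (fun n => ?_) n
  have h := lintegral_tsum_machineValue (F := fun _ => 1) hα₀ hα₁ n measurable_const
  rw [← lintegral_one, ← h]
  calc _ ≤ ∫⁻ _, 1 ∂machineLaw α n := lintegral_mono fun d => ?_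
    _ = 1 := by simp
  by_cases hd : ∃ k, HaltsAt k d
  · rw [tsum_machineValue hd]
  · have : ∀ k, ¬ HaltsAt k d := fun k hk => hd ⟨k, hk⟩
    simp [machineValue, this]

/-- The halting probability is the mass of the excursion law. So the finiteness of excursions,
obtained analytically, returns as a pathwise statement. -/
theorem ae_haltsAt (hα₀ : 0 ≤ α) (hα₁ : α ≤ 1) (n : ℕ) :
    ∀ᵐ d ∂machineLaw α n, ∃ k, HaltsAt k d := by
  have hm : MeasurableSet {d : MachineState | ∃ k, HaltsAt k d} := by
    have : {d : MachineState | ∃ k, HaltsAt k d} = ⋃ k, {d | HaltsAt k d} := by ext; simp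
    rw [this]
    exact MeasurableSet.iUnion measurableSet_haltsAt
  have h := lintegral_tsum_machineValue (F := fun _ => 1) hα₀ hα₁ n measurable_const
  rw [lintegral_one, excursionLaw_univ_eq_one hα₀ hα₁] at h
  have h1 : ∀ d, ∑' k, machineValue k (fun _ => 1) d =
      {d : MachineState | ∃ k, HaltsAt k d}.indicator 1 d := by
    intro d
    by_cases hd : ∃ k, HaltsAt k d
    · rw [tsum_machineValue hd]
      simp [hd]
    · have : ∀ k, ¬ HaltsAt k d := fun k hk => hd ⟨k, hk⟩
      simp [machineValue, this]
  simp_rw [h1] at h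
  rw [lintegral_indicator_one hm] at h
  rwa [← prob_compl_eq_zero_iff hm] at h

theorem map_machineOutput (hα₀ : 0 ≤ α) (hα₁ : α ≤ 1) (n : ℕ) :
    (machineLaw α n).map machineOutput = excursionLaw α n := by
  refine Measure.ext_of_lintegral _ fun F hF => ?_
  rw [lintegral_map hF measurable_machineOutput, ← lintegral_tsum_machineValue hα₀ hα₁ n hF]
  refine lintegral_congr_ae ?_
  filter_upwards [ae_haltsAt hα₀ hα₁ n] with d hd
  rw [tsum_machineValue hd]

end MachineLaw

/-! ### The machine fed with driving paths -/

section Driving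

/-- The initial state of the machine that belongs to a driving path. -/
noncomputable def drivingState (w : DrivingPath) : MachineState :=
  (0, readPath (w.2 0), fun k => (readPath w.1 k).2, fun i => readPath (w.2 (i + 1)))

theorem measurable_drivingState : Measurable drivingState := by
  have := measurable_readPath
  have h1 (i : ℕ) : Measurable fun w : DrivingPath => readPath (w.2 i) :=
    this.comp ((measurable_pi_apply i).comp measurable_snd)
  have h2 : Measurable fun w : DrivingPath => readPath w.1 := this.comp measurable_fst
  refine measurable_const.prodMk ((h1 0).prodMk (Measurable.prodMk ?_ ?_))
  · exact measurable_pi_lambda _ fun k => ((measurable_pi_apply k).comp h2).snd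
  · exact measurable_pi_lambda _ fun i => h1 (i + 1)

/-- The word of the excursion of a driving path. -/
noncomputable def drivingWord (w : DrivingPath) : Word := machineOutput (drivingState w)

theorem measurable_drivingWord : Measurable drivingWord :=
  measurable_machineOutput.comp measurable_drivingState

variable {Ω : Type*} [MeasurableSpace Ω] {μ : Measure Ω} [IsProbabilityMeasure μ] {α : ℝ}

/-- All states of the Poisson process have the same total rate, so the holding times are independent
exponentials regardless of the jump chain. -/
theorem IsPoissonProcess.map_readPath {r : ℝ} (hr : 0 ≤ r) {J : Ω → ℝ≥0 → ℕ} (hJm : Measurable J)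
    (hJ : IsPoissonProcess r J μ) :
    μ.map (fun ω k => (readPath (J ω) k).2) = streamLaw (expLaw r) ∧
      ∀ᵐ ω ∂μ, IsPathOf (fun m l => if l = m + 1 then r else 0) (J ω) (readPath (J ω)) ∧
        (readPath (J ω) 0).1 = 0 := by
  obtain ⟨ht, hp⟩ := poissonRate_proper hr
  obtain ⟨h1, h2⟩ := IsMarkovChain.map_readPath hJ
  refine ⟨?_, h2⟩
  have hm : Measurable fun ω => readPath (J ω) := measurable_readPath.comp hJm
  rw [← map_hold_chainLaw _ ht 0, ← h1, Measure.map_map (by fun_prop) hm]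
  rfl

variable [ProperRates (tableRate α)]

/-- Each ingredient of the machine is a measurable function, through `readPath`, of one of the
independent driving paths. This is the reason for recovering jump chains from paths: the chains
provided by `IsMarkovChain` carry no information on joint independence. -/
theorem IsDriving.map_drivingState (hα₀ : 0 ≤ α) {n : ℕ} {W : Ω → DrivingPath}
    (hW : IsDriving α n W μ) : μ.map (fun ω => drivingState (W ω)) = machineLaw α n := by
  have hR := measurable_readPath
  have hJm : Measurable fun ω => (W ω).1 := hW.measurable.fst
  have hZm (i : ℕ) : Measurable fun ω => (W ω).2 i :=
    (measurable_pi_apply i).comp hW.measurable.snd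
  set R : Ω → ℕ → ℕ → ℕ × ℝ≥0∞ := fun ω i => readPath ((W ω).2 i) with hRdef
  have hRi (i : ℕ) : Measurable fun ω => R ω i := hR.comp (hZm i)
  have hRm : Measurable R := measurable_pi_lambda _ hRi
  set G : Ω → ℕ → ℝ≥0∞ := fun ω k => (readPath (W ω).1 k).2 with hG
  have hgap : Measurable fun (x : ℝ≥0 → ℕ) (k : ℕ) => (readPath x k).2 :=
    measurable_pi_lambda _ fun k => ((measurable_pi_apply k).comp hR).snd
  have hGm : Measurable G := hgap.comp hJm
  set ν : ℕ → Measure (ℕ → ℕ × ℝ≥0∞) := fun i =>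
    chainLaw (tableRate α) (if i = 0 then n else 1) with hν
  have hlaw (i : ℕ) : μ.map (fun ω => R ω i) = ν i := by
    by_cases hi : i = 0
    · subst hi
      exact (IsMarkovChain.map_readPath hW.first).1
    · simp only [hν, hi, if_false]
      exact (IsMarkovChain.map_readPath (hW.others i (Nat.one_le_iff_ne_zero.2 hi))).1
  have hRlaw : μ.map R = Measure.infinitePi ν := by
    have := (hW.indep_tables.comp (fun _ => readPath) fun _ => hR).map_fun_eq_infinitePi_map
      (fun i => hRi i)
    refine this.trans ?_
    congr 1
    funext i
    exact hlaw i
  have hGlaw : μ.map G = streamLaw (expLaw α) :=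
    (IsPoissonProcess.map_readPath hα₀ hJm hW.poisson).1
  have hind : IndepFun G R μ :=
    hW.indep_poisson.comp (φ := fun x k => (readPath x k).2)
      (ψ := fun (z : ℕ → ℝ≥0 → ℕ) i => readPath (z i)) hgap
      (measurable_pi_lambda _ fun i => hR.comp (measurable_pi_apply i))
  have hjoint : μ.map (fun ω => (G ω, R ω)) =
      (streamLaw (expLaw α)).prod (Measure.infinitePi ν) := by
    rw [(indepFun_iff_map_prod_eq_prod_map_map hGm.aemeasurable hRm.aemeasurable).1 hind, hRlaw,
      hGlaw]
  refine Measure.ext_of_lintegral _ fun Φ hΦ => ?_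
  have hκ : Measurable fun p : (ℕ → ℝ≥0∞) × (ℕ → ℕ → ℕ × ℝ≥0∞) =>
      ((0 : ℝ), p.2 0, p.1, tailStream p.2) := by
    have : Measurable fun p : (ℕ → ℝ≥0∞) × (ℕ → ℕ → ℕ × ℝ≥0∞) => p.2 0 := by fun_prop
    fun_prop
  have hΦκ : Measurable fun p : (ℕ → ℝ≥0∞) × (ℕ → ℕ → ℕ × ℝ≥0∞) =>
      Φ ((0 : ℝ), p.2 0, p.1, tailStream p.2) := hΦ.comp hκ
  have hSm : Measurable fun ω => drivingState (W ω) := measurable_drivingState.comp hW.measurable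
  have hΦS : ∫⁻ ω, Φ (drivingState (W ω)) ∂μ = ∫⁻ p, Φ ((0 : ℝ), p.2 0, p.1, tailStream p.2)
      ∂μ.map fun ω => (G ω, R ω) := by
    rw [lintegral_map hΦκ (hGm.prodMk hRm)]
    rfl
  rw [lintegral_map hΦ hSm, hΦS, hjoint,
    lintegral_machineLaw _ hΦ, machineIntegral, ← map_consStream_infinitePi ν,
    lintegral_prod_symm' _ hΦκ]
  have h1 : Measurable fun R : ℕ → ℕ → ℕ × ℝ≥0∞ => ∫⁻ G, Φ ((0 : ℝ), R 0, G, tailStream R)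
      ∂streamLaw (expLaw α) := by
    have : Measurable fun p : (ℕ → ℕ → ℕ × ℝ≥0∞) × (ℕ → ℝ≥0∞) =>
      Φ ((0 : ℝ), p.1 0, p.2, tailStream p.1) := hΦκ.comp measurable_swap
    exact this.lintegral_prod_right'
  have h2 : Measurable fun p : (ℕ → ℕ × ℝ≥0∞) × (ℕ → ℕ → ℕ × ℝ≥0∞) =>
      ∫⁻ G, Φ ((0 : ℝ), p.1, G, p.2) ∂streamLaw (expLaw α) := by
    have : Measurable fun p : ((ℕ → ℕ × ℝ≥0∞) × (ℕ → ℕ → ℕ × ℝ≥0∞)) × (ℕ → ℝ≥0∞) =>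
      Φ ((0 : ℝ), p.1.1, p.2, p.1.2) := by fun_prop
    exact this.lintegral_prod_right'
  rw [lintegral_map h1 (by fun_prop)]
  simp only [consStream_zero, tailStream_consStream]
  rw [lintegral_prod _ h2.aemeasurable]
  simp only [hν, if_true, Nat.add_eq_zero_iff, one_ne_zero, and_false, if_false]
  congr 1; ext z
  rw [reserveLaw, lintegral_prod_symm' _ (by fun_prop)]
  rfl

theorem IsDriving.map_drivingWord (hα₀ : 0 ≤ α) (hα₁ : α ≤ 1) {n : ℕ} {W : Ω → DrivingPath}
    (hW : IsDriving α n W μ) : μ.map (fun ω => drivingWord (W ω)) = excursionLaw α n := by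
  have hm : Measurable fun ω => drivingState (W ω) := measurable_drivingState.comp hW.measurable
  rw [← map_machineOutput hα₀ hα₁, ← hW.map_drivingState hα₀,
    Measure.map_map measurable_machineOutput hm]
  rfl

/-- Driving paths that behave as they do almost surely. -/
structure GoodDriving (α : ℝ) (n : ℕ) (w : DrivingPath) : Prop where
  poisson : IsPathOf (fun m l => if l = m + 1 then α else 0) w.1 (readPath w.1)
  poisson_zero : (readPath w.1 0).1 = 0
  tables : ∀ i, IsPathOf (tableRate α) (w.2 i) (readPath (w.2 i))
  first : (readPath (w.2 0) 0).1 = n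
  halts : ∃ k, HaltsAt k (drivingState w)

theorem IsDriving.ae_good (hα₀ : 0 ≤ α) (hα₁ : α ≤ 1) {n : ℕ} {W : Ω → DrivingPath}
    (hW : IsDriving α n W μ) : ∀ᵐ ω ∂μ, GoodDriving α n (W ω) := by
  have h1 := (IsPoissonProcess.map_readPath hα₀ hW.measurable.fst hW.poisson).2
  have h2 := (IsMarkovChain.map_readPath hW.first).2
  have h3 : ∀ᵐ ω ∂μ, ∀ i, IsPathOf (tableRate α) ((W ω).2 (i + 1))
      (readPath ((W ω).2 (i + 1))) := by
    rw [ae_all_iff]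
    intro i
    filter_upwards [(IsMarkovChain.map_readPath (hW.others (i + 1) (by omega))).2] with ω h using h.1
  have h4 : ∀ᵐ ω ∂μ, ∃ k, HaltsAt k (drivingState (W ω)) := by
    have hm : Measurable fun ω => drivingState (W ω) := measurable_drivingState.comp hW.measurable
    refine ae_of_ae_map (p := fun d => ∃ k, HaltsAt k d) hm.aemeasurable ?_
    rw [hW.map_drivingState hα₀]
    exact ae_haltsAt hα₀ hα₁ n
  filter_upwards [h1, h2, h3, h4] with ω a b c d
  refine ⟨a.1, a.2, fun i => ?_, b.2, d⟩
  cases i with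
  | zero => exact b.1
  | succ i => exact c i

end Driving

/-! ### Skewers computed from words -/

section WordSection

open Classical in
/-- The table sizes at level `y` in the rest of an excursion whose current table has size `n` at
level `s`. -/
noncomputable def wordSection (y : ℝ) : ℕ → ℝ → Word → List ℕ
  | _, _, [] => []
  | n, s, (l, m) :: w => (if n ≠ 0 ∧ s ≤ y ∧ y < l then [n] else []) ++ wordSection y m l w

theorem wordSection_shift (y b : ℝ) (n : ℕ) (s : ℝ) (w : Word) :
    wordSection (y - b) n (s - b) (shiftWord b w) = wordSection y n s w := by
  induction w generalizing n s with
  | nil => rfl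
  | cons x w ih =>
    have h := ih x.2 x.1
    simp only [shiftWord, List.map_cons, wordSection, sub_le_sub_iff_right,
      sub_lt_sub_iff_right] at h ⊢
    rw [h]

/-- The starting level enters only through the first comparison with `y`; afterwards the levels of
the letters are used. -/
theorem wordSection_level {y s s' : ℝ} (hs : s ≤ y) (hs' : s' ≤ y) (n : ℕ) (w : Word) :
    wordSection y n s w = wordSection y n s' w := by
  cases w with
  | nil => rfl
  | cons x w => simp [wordSection, hs, hs']

theorem wordSection_eq_nil {y : ℝ} {w : Word} (h : ∀ x ∈ w, y < x.1) (n : ℕ) {s : ℝ} (hs : y < s) :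
    wordSection y n s w = [] := by
  induction w generalizing n s with
  | nil => rfl
  | cons x w ih =>
    have h1 := ih (fun z hz => h z (List.mem_cons_of_mem _ hz)) x.2 (h x List.mem_cons_self)
    simp [wordSection, h1, not_le.2 hs]

end WordSection

/-! ### Jump times of paths -/

section JumpTimes

variable {q : ℕ → ℕ → ℝ} {x : ℝ≥0 → ℕ} {z : ℕ → ℕ × ℝ≥0∞}

theorem jumpSum_mono (z : ℕ → ℕ × ℝ≥0∞) : Monotone (jumpSum z) :=
  monotone_nat_of_le_succ fun n => by rw [jumpSum_succ]; exact le_self_add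

theorem exists_jumpSum_bracket {n : ℕ} {t : ℝ≥0∞} (h : t < jumpSum z n) :
    ∃ m < n, jumpSum z m ≤ t ∧ t < jumpSum z (m + 1) := by
  induction n with
  | zero => simp [jumpSum] at h
  | succ n ih =>
    by_cases hn : t < jumpSum z n
    · obtain ⟨m, hm, h1⟩ := ih hn
      exact ⟨m, hm.trans (Nat.lt_succ_self n), h1⟩
    · exact ⟨n, Nat.lt_succ_self n, not_lt.1 hn, h⟩

theorem IsPathOf.exists_bracket (h : IsPathOf q x z) (t : ℝ≥0) :
    ∃ m, jumpSum z m ≤ t ∧ (t : ℝ≥0∞) < jumpSum z (m + 1) := by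
  have h1 := ENNReal.tendsto_nat_tsum fun n => (z n).2
  rw [h.tsum_eq] at h1
  obtain ⟨n, hn⟩ := (h1.eventually_const_lt (ENNReal.coe_lt_top (r := t))).exists
  obtain ⟨m, -, h2⟩ := exists_jumpSum_bracket (z := z) hn
  exact ⟨m, h2⟩

variable {α : ℝ}

/-- A table whose jump chain is absorbed after `k` jumps. -/
structure AbsorbedAfter (z : ℕ → ℕ × ℝ≥0∞) (k : ℕ) : Prop where
  ne_zero : ∀ m < k, (z m).1 ≠ 0
  eq_zero : (z k).1 = 0

theorem IsPathOf.jumpSum_lt_top (h : IsPathOf q x z) {k : ℕ}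
    (hk : ∀ m < k, totalRate q (z m).1 ≠ 0) : jumpSum z k < ∞ := by
  refine ENNReal.sum_lt_top.2 fun m hm => ?_
  exact lt_top_iff_ne_top.2 fun h1 => hk m (Finset.mem_range.1 hm) (((h.good m).2.1).1 h1)

theorem totalRate_tableRate_ne_zero (hα₁ : α ≤ 1) {n : ℕ} (hn : n ≠ 0) :
    totalRate (tableRate α) n ≠ 0 := by
  rw [(tableRate_proper hα₁).1, if_neg hn]
  have hn' : (1 : ℝ) ≤ n := by exact_mod_cast Nat.one_le_iff_ne_zero.2 hn
  linarith

/-- The first `k` states are nonzero, with finite holding times, and state `0` is held forever. So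
the path vanishes exactly from the `k`-th jump time on. -/
theorem IsPathOf.absorptionTime_eq (hα₁ : α ≤ 1) (h : IsPathOf (tableRate α) x z) {k : ℕ}
    (hk : AbsorbedAfter z k) :
    jumpSum z k < ∞ ∧ (absorptionTime x : ℝ) = (jumpSum z k).toReal := by
  have h0 : jumpSum z k < ∞ :=
    h.jumpSum_lt_top fun m hm => totalRate_tableRate_ne_zero hα₁ (hk.ne_zero m hm)
  refine ⟨h0, ?_⟩
  have hT : (z k).2 = ∞ := by
    rw [(h.good k).2.1, hk.eq_zero, (tableRate_proper hα₁).1, if_pos rfl]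
  obtain ⟨s, hs⟩ := WithTop.ne_top_iff_exists.1 h0.ne
  replace hs : (s : ℝ≥0∞) = jumpSum z k := hs
  rw [← hs, ENNReal.coe_toReal, NNReal.coe_inj]
  refine IsLeast.csInf_eq ⟨?_, fun t ht => ?_⟩
  · have : x s = (z k).1 := by
      refine h.eq k s hs.ge ?_
      rw [jumpSum_succ, hT, add_top]
      exact ENNReal.coe_lt_top
    exact this.trans hk.eq_zero
  · by_contra hts
    have h1 : (t : ℝ≥0∞) < jumpSum z k := by rw [← hs]; exact_mod_cast not_le.1 hts
    obtain ⟨m, hm, h2, h3⟩ := exists_jumpSum_bracket h1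
    have h4 := h.eq m t h2 h3
    have ht' : x t = 0 := ht
    exact hk.ne_zero m hm (h4.symm.trans ht')

end JumpTimes

/-! ### The machine follows the tables of the driving path -/

section Follow

/-- The state of the machine at the `k`-th jump of the `i`-th table, if this table is born at
level `s`. -/
noncomputable def tableState (w : DrivingPath) (i k : ℕ) (s : ℝ) : MachineState :=
  (s + (jumpSum (readPath (w.2 i)) k).toReal, fun m => readPath (w.2 i) (k + m),
    fun m => (readPath w.1 (i + m)).2, fun m => readPath (w.2 (i + 1 + m)))

theorem tableState_zero (w : DrivingPath) : tableState w 0 0 0 = drivingState w := by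
  simp [tableState, drivingState, jumpSum, add_comm]

/-- The level at which the `i`-th table is born. -/
noncomputable def birthLevel (w : DrivingPath) (i : ℕ) : ℝ :=
  ∑ j ∈ Finset.range i, (absorptionTime (w.2 j) : ℝ) - (jumpSum (readPath w.1) i).toReal

/-- The level at which the `i`-th table dies. -/
noncomputable def deathLevel (w : DrivingPath) (i : ℕ) : ℝ :=
  birthLevel w i + absorptionTime (w.2 i)

/-- The part of the `i`-th table above level `s` is crossed at level `y`. -/
noncomputable def tableSection (w : DrivingPath) (y s : ℝ) (i : ℕ) : List ℕ := by
  classical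
  exact if s ≤ y ∧ y < deathLevel w i then [w.2 i (y - birthLevel w i).toNNReal] else []

/-- The machine uses precisely the tables from `i` to `r`. -/
structure TablesUntil (w : DrivingPath) (i r : ℕ) : Prop where
  le : i ≤ r
  gap_le : ∀ j, i ≤ j → j < r → (readPath w.1 j).2 ≤ ENNReal.ofReal (deathLevel w j)
  lt_gap : ENNReal.ofReal (deathLevel w r) < (readPath w.1 r).2

variable {α : ℝ} {n : ℕ} {w : DrivingPath}

theorem machineStep_tableState_of_ne_zero {i k : ℕ} {s : ℝ}
    (h : IsPathOf (tableRate α) (w.2 i) (readPath (w.2 i))) (hα₁ : α ≤ 1)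
    (hk : ∀ m ≤ k, (readPath (w.2 i) m).1 ≠ 0) :
    machineStep (tableState w i k s) = tableState w i (k + 1) s := by
  have h1 : (tableState w i k s).2.1 0 = readPath (w.2 i) k := rfl
  have h2 : jumpSum (readPath (w.2 i)) (k + 1) < ∞ := h.jumpSum_lt_top fun m hm =>
    totalRate_tableRate_ne_zero hα₁ (hk m (Nat.lt_succ_iff.1 hm))
  rw [jumpSum_succ, ENNReal.add_lt_top] at h2
  rw [machineStep, h1, if_pos (hk k le_rfl)]
  simp only [tableState, jumpSum_succ, ENNReal.toReal_add h2.1.ne h2.2.ne]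
  refine Prod.ext (by ring) (Prod.ext ?_ rfl)
  funext m
  exact congrArg (readPath (w.2 i)) (by omega)

theorem birthLevel_succ {i : ℕ} (h : jumpSum (readPath w.1) (i + 1) < ∞) :
    birthLevel w (i + 1) = deathLevel w i - ((readPath w.1 i).2).toReal := by
  rw [jumpSum_succ, ENNReal.add_lt_top] at h
  rw [deathLevel, birthLevel, birthLevel, jumpSum_succ, ENNReal.toReal_add h.1.ne h.2.ne,
    Finset.sum_range_succ]
  ring

/-- Induction on the number of remaining steps of the machine. A step of a living table contributes
the part of its lifetime between two jumps; at a dead table the machine moves down by a gap and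
starts the next table at its birth level. -/
theorem GoodDriving.exists_tablesUntil (hw : GoodDriving α n w) (hα₁ : α ≤ 1) {K i k : ℕ}
    (hi : jumpSum (readPath w.1) i < ∞)
    (hk : ∀ m < k, (readPath (w.2 i) m).1 ≠ 0)
    (hK : HaltsAt K (tableState w i k (birthLevel w i))) :
    ∃ r, TablesUntil w i r ∧ (jumpSum (readPath (w.2 i)) k).toReal ≤ absorptionTime (w.2 i) ∧
      ∀ y : ℝ, wordSection y (readPath (w.2 i) k).1
      (birthLevel w i + (jumpSum (readPath (w.2 i)) k).toReal)
        (machineWord K (tableState w i k (birthLevel w i))) =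
      tableSection w y (birthLevel w i + (jumpSum (readPath (w.2 i)) k).toReal) i ++
        (List.range' (i + 1) (r - i)).flatMap fun j => tableSection w y (birthLevel w j) j := by
  classical
  induction K generalizing i k with
  | zero =>
    have h1 : (readPath (w.2 i) k).1 = 0 := hK.1
    obtain ⟨h2, h3⟩ := (hw.tables i).absorptionTime_eq hα₁ ⟨hk, h1⟩
    refine ⟨i, ⟨le_rfl, fun j h1 h2 => absurd h2 (not_lt.2 h1), ?_⟩, h3.ge, fun y => ?_⟩
    · have := hK.2
      rw [deathLevel, h3]
      exact this
    · have : ¬ (birthLevel w i + (jumpSum (readPath (w.2 i)) k).toReal ≤ y ∧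
          y < birthLevel w i + (jumpSum (readPath (w.2 i)) k).toReal) := fun h =>
        absurd h.2 (not_lt.2 h.1)
      simp [machineWord, wordSection, tableSection, deathLevel, h3, this]
  | succ K ih =>
    by_cases h0 : (readPath (w.2 i) k).1 = 0
    · obtain ⟨h2, h3⟩ := (hw.tables i).absorptionTime_eq hα₁ ⟨hk, h0⟩
      have hle : (readPath w.1 i).2 ≤ ENNReal.ofReal (deathLevel w i) := by
        by_contra hlt
        refine hK.1 ⟨h0, ?_⟩
        rw [deathLevel, h3] at hlt
        exact not_le.1 hlt
      have hi' : jumpSum (readPath w.1) (i + 1) < ∞ := by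
        rw [jumpSum_succ, ENNReal.add_lt_top]
        exact ⟨hi, hle.trans_lt ENNReal.ofReal_lt_top⟩
      have hb := birthLevel_succ (w := w) hi'
      have hstep : machineStep (tableState w i k (birthLevel w i)) =
          tableState w (i + 1) 0 (birthLevel w (i + 1)) := by
        have h1 : (tableState w i k (birthLevel w i)).2.1 0 = readPath (w.2 i) k := rfl
        rw [machineStep, h1, if_neg (not_not.2 h0), hb]
        refine Prod.ext ?_ (Prod.ext ?_ (Prod.ext ?_ ?_))
        · simp [tableState, jumpSum, deathLevel, h3]
        · simp [tableState]
        · funext m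
          exact congrArg (fun k => (readPath w.1 k).2) (by omega)
        · funext m
          exact congrArg (fun k => readPath (w.2 k)) (by omega)
      have hK2 := hK.2
      rw [hstep] at hK2
      obtain ⟨r, hr, -, hs⟩ := ih hi' (fun m hm => absurd hm (Nat.not_lt_zero m)) hK2
      refine ⟨r, ⟨(Nat.le_succ i).trans hr.le, fun j h1 h2 => ?_, hr.lt_gap⟩, h3.ge, fun y => ?_⟩
      · rcases h1.eq_or_lt with rfl | h1
        · exact hle
        · exact hr.gap_le j h1 h2
      · have hne : ¬ (birthLevel w i + (jumpSum (readPath (w.2 i)) k).toReal ≤ y ∧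
            y < birthLevel w i + (jumpSum (readPath (w.2 i)) k).toReal) := fun h =>
          absurd h.2 (not_lt.2 h.1)
        have e1 : r - i = (r - (i + 1)) + 1 := by have := hr.le; omega
        have e2 : tableSection w y (birthLevel w i + (jumpSum (readPath (w.2 i)) k).toReal) i =
            [] := by
          simp [tableSection, deathLevel, h3, hne]
        have hs' := hs y
        have e3 : birthLevel w (i + 1) + (jumpSum (readPath (w.2 (i + 1))) 0).toReal =
            birthLevel w (i + 1) := by simp [jumpSum]
        have e4 : machineLetter (tableState w (i + 1) 0 (birthLevel w (i + 1))) =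
            (birthLevel w (i + 1), (readPath (w.2 (i + 1)) 0).1) := by
          simp [machineLetter, tableState, jumpSum]
        rw [e3] at hs'
        rw [machineWord, hstep, e4, wordSection, h0, e2, e1, List.range'_succ, hs']
        simp
    · have hk' : ∀ m < k + 1, (readPath (w.2 i) m).1 ≠ 0 := fun m hm => by
        rcases (Nat.lt_succ_iff.1 hm).eq_or_lt with rfl | h
        · exact h0
        · exact hk m h
      have hstep := machineStep_tableState_of_ne_zero (s := birthLevel w i) (hw.tables i) hα₁
        fun m hm => hk' m (Nat.lt_succ_iff.2 hm)
      have hK2 := hK.2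
      rw [hstep] at hK2
      obtain ⟨r, hr, hd, hs⟩ := ih hi hk' hK2
      have hfin : jumpSum (readPath (w.2 i)) (k + 1) < ∞ := (hw.tables i).jumpSum_lt_top fun m hm =>
        totalRate_tableRate_ne_zero hα₁ (hk' m hm)
      have hmono : (jumpSum (readPath (w.2 i)) k).toReal ≤
          (jumpSum (readPath (w.2 i)) (k + 1)).toReal :=
        ENNReal.toReal_mono hfin.ne (jumpSum_mono _ (Nat.le_succ k))
      have hfin' : jumpSum (readPath (w.2 i)) k < ∞ :=
        (jumpSum_mono _ (Nat.le_succ k)).trans_lt hfin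
      refine ⟨r, hr, hmono.trans hd, fun y => ?_⟩
      have e4 : machineLetter (tableState w i (k + 1) (birthLevel w i)) =
          (birthLevel w i + (jumpSum (readPath (w.2 i)) (k + 1)).toReal,
            (readPath (w.2 i) (k + 1)).1) := rfl
      rw [machineWord, hstep, e4, wordSection, hs y, ← List.append_assoc]
      congr 1
      -- The new letter covers the levels of one holding interval, and the section of the same table
      -- from the next jump covers those above; together they give the section from the present
      -- jump.
      simp only [tableSection, deathLevel]
      by_cases h1 : birthLevel w i + (jumpSum (readPath (w.2 i)) k).toReal ≤ y
      · by_cases h2 : y < birthLevel w i + (jumpSum (readPath (w.2 i)) (k + 1)).toReal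
        · have h3 : w.2 i (y - birthLevel w i).toNNReal = (readPath (w.2 i) k).1 := by
            refine (hw.tables i).eq k _ ?_ ?_
            · rw [← ENNReal.ofReal_toReal hfin'.ne]
              exact ENNReal.ofReal_le_ofReal (by linarith)
            · rw [← ENNReal.ofReal_toReal hfin.ne]
              exact (ENNReal.ofReal_lt_ofReal_iff_of_nonneg
                (by linarith [ENNReal.toReal_nonneg (a := jumpSum (readPath (w.2 i)) k)])).2
                (by linarith)
          have h4 : y < birthLevel w i + absorptionTime (w.2 i) := by linarith
          simp [h0, h1, h2, h3, h4]
        · simp [h1, h2, not_lt.1 h2]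
      · have h2 : ¬ birthLevel w i + (jumpSum (readPath (w.2 i)) (k + 1)).toReal ≤ y := by linarith
        simp [h1, h2]

/-- The section of the word of a driving path lists its tables in the order of their birth. -/
theorem GoodDriving.wordSection_drivingWord (hw : GoodDriving α n w) (hα₁ : α ≤ 1) :
    ∃ r, TablesUntil w 0 r ∧ ∀ y : ℝ, wordSection y n 0 (drivingWord w) =
      (List.range (r + 1)).flatMap fun j => tableSection w y (birthLevel w j) j := by
  obtain ⟨K, hK⟩ := hw.halts
  have hb : birthLevel w 0 = 0 := by simp [birthLevel, jumpSum]
  have h1 := hK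
  rw [← tableState_zero, ← hb] at h1
  obtain ⟨r, hr, -, hs⟩ := hw.exists_tablesUntil hα₁ (by simp [jumpSum])
    (fun m hm => absurd hm (Nat.not_lt_zero m)) h1
  refine ⟨r, hr, fun y => ?_⟩
  have h2 := hs y
  have e : birthLevel w 0 + (jumpSum (readPath (w.2 0)) 0).toReal = birthLevel w 0 := by
    simp [jumpSum]
  rw [e, hw.first, hb, tableState_zero] at h2
  rw [drivingWord, machineOutput_eq hK, h2, List.range_eq_range', List.range'_succ]
  simp [hb]

end Follow

/-! ### The contour of a driving path -/

section Contour

open Filter Topology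

variable {α : ℝ} {n r : ℕ} {w : DrivingPath}

/-- The time at which the contour jumps from the birth level to the death level of a table. -/
noncomputable def birthTime (w : DrivingPath) (i : ℕ) : ℝ := (jumpSum (readPath w.1) i).toReal

theorem birthTime_zero : birthTime w 0 = 0 := by simp [birthTime, jumpSum]

theorem birthLevel_zero : birthLevel w 0 = 0 := by simp [birthLevel, jumpSum]

theorem TablesUntil.jumpSum_lt_top (h : TablesUntil w 0 r) {j : ℕ} (hj : j ≤ r) :
    jumpSum (readPath w.1) j < ∞ :=
  ENNReal.sum_lt_top.2 fun m hm => (h.gap_le m (Nat.zero_le m)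
    ((Finset.mem_range.1 hm).trans_le hj)).trans_lt ENNReal.ofReal_lt_top

/-- A birth level is the preceding death level minus a gap that does not exceed it. -/
theorem TablesUntil.birthLevel_nonneg (h : TablesUntil w 0 r) {j : ℕ} (hj : j ≤ r) :
    0 ≤ birthLevel w j := by
  induction j with
  | zero => rw [birthLevel_zero]
  | succ j ih =>
    have h1 : 0 ≤ deathLevel w j := add_nonneg (ih (by omega)) (NNReal.coe_nonneg _)
    have h2 := ENNReal.toReal_mono ENNReal.ofReal_ne_top (h.gap_le j (Nat.zero_le j) hj)
    rw [ENNReal.toReal_ofReal h1] at h2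
    rw [birthLevel_succ (h.jumpSum_lt_top hj)]
    linarith

theorem TablesUntil.deathLevel_nonneg (h : TablesUntil w 0 r) {j : ℕ} (hj : j ≤ r) :
    0 ≤ deathLevel w j :=
  add_nonneg (h.birthLevel_nonneg hj) (NNReal.coe_nonneg _)

theorem TablesUntil.birthTime_succ (h : TablesUntil w 0 r) {j : ℕ} (hj : j < r) :
    birthTime w (j + 1) = birthTime w j + ((readPath w.1 j).2).toReal := by
  have h1 := h.jumpSum_lt_top (Nat.succ_le_of_lt hj)
  rw [jumpSum_succ, ENNReal.add_lt_top] at h1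
  rw [birthTime, jumpSum_succ, ENNReal.toReal_add h1.1.ne h1.2.ne]
  rfl

theorem TablesUntil.ofReal_birthTime (h : TablesUntil w 0 r) {j : ℕ} (hj : j ≤ r) :
    ENNReal.ofReal (birthTime w j) = jumpSum (readPath w.1) j :=
  ENNReal.ofReal_toReal (h.jumpSum_lt_top hj).ne

theorem GoodDriving.birthTime_lt (hw : GoodDriving α n w) (h : TablesUntil w 0 r) {j : ℕ}
    (hj : j < r) : birthTime w j < birthTime w (j + 1) := by
  rw [h.birthTime_succ hj]
  have h1 := h.jumpSum_lt_top (Nat.succ_le_of_lt hj)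
  rw [jumpSum_succ, ENNReal.add_lt_top] at h1
  have := ENNReal.toReal_pos (hw.poisson.good j).1.ne' h1.2.ne
  linarith

theorem GoodDriving.birthTime_strictMono (hw : GoodDriving α n w) (h : TablesUntil w 0 r) {i j : ℕ}
    (hij : i < j) (hj : j ≤ r) : birthTime w i < birthTime w j := by
  induction j, hij using Nat.le_induction with
  | base => exact hw.birthTime_lt h hj
  | succ j hij ih => exact (ih (by omega)).trans (hw.birthTime_lt h hj)

/-- Finiteness of the jump time cannot be dropped: for `α = 0` the Poisson process never jumps and
its jump chain remains at `0`. -/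
theorem GoodDriving.readPath_poisson (hw : GoodDriving α n w) {j : ℕ}
    (hj : jumpSum (readPath w.1) j < ∞) : (readPath w.1 j).1 = j := by
  induction j with
  | zero => exact hw.poisson_zero
  | succ j ih =>
    rw [jumpSum_succ, ENNReal.add_lt_top] at hj
    have h1 := ih hj.1
    by_contra hne
    refine (hw.poisson.good j).2.2 ?_
    have h2 : totalRate (fun m l => if l = m + 1 then α else 0) (readPath w.1 j).1 ≠ 0 := fun h2 =>
      hj.2.ne ((hw.poisson.good j).2.1.2 h2)
    rw [jumpProb, if_neg h2, h1, if_neg hne]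
    split_ifs <;> simp

theorem GoodDriving.driving_eq (hw : GoodDriving α n w) (h : TablesUntil w 0 r) {j : ℕ}
    (hj : j ≤ r) {t : ℝ} (h1 : birthTime w j ≤ t)
    (h2 : ENNReal.ofReal t < jumpSum (readPath w.1) (j + 1)) : w.1 t.toNNReal = j := by
  rw [← hw.readPath_poisson (h.jumpSum_lt_top hj)]
  refine hw.poisson.eq j _ ?_ h2
  rw [← h.ofReal_birthTime hj]
  exact ENNReal.ofReal_le_ofReal h1

theorem GoodDriving.contour_eq (hw : GoodDriving α n w) (h : TablesUntil w 0 r) {j : ℕ}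
    (hj : j ≤ r) {t : ℝ} (h1 : birthTime w j ≤ t)
    (h2 : ENNReal.ofReal t < jumpSum (readPath w.1) (j + 1)) :
    contour w t = deathLevel w j - (t - birthTime w j) := by
  have ht : ¬ t < 0 := not_lt.2 (ENNReal.toReal_nonneg.trans h1)
  rw [contour, if_neg ht, hw.driving_eq h hj h1 h2, Finset.sum_range_succ, deathLevel, birthLevel,
    birthTime]
  ring

/-- The length of the excursion. -/
noncomputable def contourLength (w : DrivingPath) (r : ℕ) : ℝ := birthTime w r + deathLevel w r

theorem TablesUntil.birthTime_le (h : TablesUntil w 0 r) {j : ℕ}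
    (hj : j ≤ r) : birthTime w j ≤ contourLength w r := by
  have h1 : birthTime w j ≤ birthTime w r :=
    ENNReal.toReal_mono (h.jumpSum_lt_top le_rfl).ne (jumpSum_mono _ hj)
  have := h.deathLevel_nonneg le_rfl
  rw [contourLength]; linarith

theorem TablesUntil.contourLength_lt (h : TablesUntil w 0 r) :
    ENNReal.ofReal (contourLength w r) < jumpSum (readPath w.1) (r + 1) := by
  rw [contourLength, ENNReal.ofReal_add (p := birthTime w r) ENNReal.toReal_nonneg (h.deathLevel_nonneg le_rfl),
    h.ofReal_birthTime le_rfl, jumpSum_succ]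
  exact ENNReal.add_lt_add_left (h.jumpSum_lt_top le_rfl).ne h.lt_gap

theorem TablesUntil.exists_bracket (h : TablesUntil w 0 r) {t : ℝ} (h0 : 0 ≤ t)
    (ht : t ≤ contourLength w r) : ∃ j ≤ r, birthTime w j ≤ t ∧
      ENNReal.ofReal t < jumpSum (readPath w.1) (j + 1) := by
  obtain ⟨j, hj, h1, h2⟩ := exists_jumpSum_bracket
    ((ENNReal.ofReal_le_ofReal ht).trans_lt h.contourLength_lt)
  refine ⟨j, by omega, ?_, h2⟩
  have := ENNReal.toReal_mono ENNReal.ofReal_ne_top h1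
  rwa [ENNReal.toReal_ofReal h0] at this

/-- The contour is nonnegative before and at the end of each table. -/
theorem TablesUntil.sub_nonneg (h : TablesUntil w 0 r) {j : ℕ} (hj : j ≤ r) {t : ℝ}
    (ht : t ≤ contourLength w r) (h2 : ENNReal.ofReal t ≤ jumpSum (readPath w.1) (j + 1)) :
    0 ≤ deathLevel w j - (t - birthTime w j) := by
  rcases hj.eq_or_lt with rfl | hj
  · rw [contourLength] at ht; linarith
  · have h3 := ENNReal.toReal_mono ENNReal.ofReal_ne_top (h.gap_le j (Nat.zero_le j) hj)
    rw [ENNReal.toReal_ofReal (h.deathLevel_nonneg hj.le)] at h3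
    have h4 := ENNReal.toReal_mono (h.jumpSum_lt_top (Nat.succ_le_of_lt hj)).ne h2
    have h5 := h.birthTime_succ hj
    rw [birthTime] at h5
    have h6 : t ≤ (ENNReal.ofReal t).toReal := by
      rw [ENNReal.toReal_ofReal']; exact le_max_left _ _
    linarith

/-- The contour has slope `-1` between births. It is still nonnegative when the descent ends,
strictly after `t`, so it is positive at `t`. -/
theorem GoodDriving.contour_pos (hw : GoodDriving α n w) (h : TablesUntil w 0 r) {t : ℝ}
    (h0 : 0 ≤ t) (ht : t < contourLength w r) : 0 < contour w t := by
  obtain ⟨j, hj, h1, h2⟩ := h.exists_bracket h0 ht.le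
  rw [hw.contour_eq h hj h1 h2]
  obtain ⟨t', h3, h4, h5⟩ : ∃ t', t < t' ∧ t' ≤ contourLength w r ∧
      ENNReal.ofReal t' ≤ jumpSum (readPath w.1) (j + 1) := by
    rcases hj.eq_or_lt with rfl | hj
    · exact ⟨_, ht, le_rfl, h.contourLength_lt.le⟩
    · rw [← h.ofReal_birthTime (Nat.succ_le_of_lt hj),
        ENNReal.ofReal_lt_ofReal_iff_of_nonneg h0] at h2
      exact ⟨_, h2, h.birthTime_le hj, (h.ofReal_birthTime hj).le⟩
  have := h.sub_nonneg hj h4 h5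
  linarith

theorem GoodDriving.hit_contour (hw : GoodDriving α n w) (h : TablesUntil w 0 r) :
    MarkedPath.hit (contour w) = contourLength w r := by
  have h0 : 0 ≤ contourLength w r :=
    add_nonneg ENNReal.toReal_nonneg (h.deathLevel_nonneg le_rfl)
  refine IsLeast.csInf_eq ⟨⟨h0, ?_⟩, fun t ht => ?_⟩
  · rw [hw.contour_eq h le_rfl (h.birthTime_le le_rfl) h.contourLength_lt, contourLength]
    ring
  · by_contra hlt
    exact (hw.contour_pos h ht.1 (not_le.1 hlt)).ne' ht.2

theorem GoodDriving.tendsto_contour (hw : GoodDriving α n w) (h : TablesUntil w 0 r) {j : ℕ}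
    (hj : j ≤ r) {t : ℝ} (h1 : birthTime w j < t)
    (h2 : ENNReal.ofReal t ≤ jumpSum (readPath w.1) (j + 1)) :
    Tendsto (contour w) (𝓝[<] t) (𝓝 (deathLevel w j - (t - birthTime w j))) := by
  have hc : Tendsto (fun s => deathLevel w j - (s - birthTime w j)) (𝓝[<] t)
      (𝓝 (deathLevel w j - (t - birthTime w j))) :=
    Continuous.tendsto' (by fun_prop) t _ rfl |>.mono_left nhdsWithin_le_nhds
  refine hc.congr' ?_
  filter_upwards [Ioo_mem_nhdsLT h1] with s hs
  refine (hw.contour_eq h hj hs.1.le (lt_of_lt_of_le ?_ h2)).symm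
  exact (ENNReal.ofReal_lt_ofReal_iff_of_nonneg (ENNReal.toReal_nonneg.trans hs.1.le)).2 hs.2

theorem tendsto_contour_zero (w : DrivingPath) : Tendsto (contour w) (𝓝[<] 0) (𝓝 0) := by
  refine tendsto_const_nhds.congr' ?_
  filter_upwards [self_mem_nhdsWithin] with s hs
  have hs' : s < 0 := hs
  rw [contour, if_pos hs']

theorem leftLim_eq {f : ℝ → ℝ} {t l : ℝ} (h : Tendsto f (𝓝[<] t) (𝓝 l)) :
    Function.leftLim f t = l :=
  leftLim_eq_of_tendsto h

/-- For left limits the brackets must be closed on the right: a birth time is assigned to the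
descent that precedes it. -/
theorem GoodDriving.exists_left_bracket (hw : GoodDriving α n w) (h : TablesUntil w 0 r) {t : ℝ}
    (h0 : 0 < t) (ht : t ≤ contourLength w r) : ∃ j ≤ r, birthTime w j < t ∧
      ENNReal.ofReal t ≤ jumpSum (readPath w.1) (j + 1) := by
  obtain ⟨j, hj, h1, h2⟩ := h.exists_bracket h0.le ht
  rcases h1.eq_or_lt with h1 | h1
  · cases j with
    | zero => rw [birthTime_zero] at h1; exact absurd h1 h0.ne
    | succ j =>
      refine ⟨j, by omega, h1 ▸ hw.birthTime_lt h hj, ?_⟩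
      rw [← h1, h.ofReal_birthTime hj]
  · exact ⟨j, hj, h1, h2.le⟩

theorem GoodDriving.tendsto_contour_birthTime (hw : GoodDriving α n w) (h : TablesUntil w 0 r)
    {j : ℕ} (hj : j ≤ r) :
    Tendsto (contour w) (𝓝[<] (birthTime w j)) (𝓝 (birthLevel w j)) := by
  cases j with
  | zero => rw [birthTime_zero, birthLevel_zero]; exact tendsto_contour_zero w
  | succ j =>
    have h1 := hw.tendsto_contour h (j := j) (by omega) (hw.birthTime_lt h hj)
      (h.ofReal_birthTime hj).le
    have h2 : deathLevel w j - (birthTime w (j + 1) - birthTime w j) = birthLevel w (j + 1) := by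
      rw [birthLevel_succ (h.jumpSum_lt_top hj), h.birthTime_succ hj]; ring
    rwa [h2] at h1

end Contour

/-! ### Skewers as lists -/

section Skewer

open Filter Topology

namespace MarkedPath

/-- The list `l` consists of the times of the jumps across level `y`, from left to right. -/
structure CrossedAt (E : MarkedPath) (y : ℝ≥0) (l : List ℝ) : Prop where
  sorted : l.Pairwise (· < ·)
  mem_iff : ∀ t, t ∈ l ↔ t ∈ E.crossings y

theorem CrossedAt.skewer_eq {E : MarkedPath} {y : ℝ≥0} {l : List ℝ} (h : E.CrossedAt y l) :
    E.skewer y = l.map fun t => E.mark t (y - E.birth t).toNNReal := by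
  classical
  have hfin : (E.crossings y).Finite := by
    refine Set.Finite.subset l.toFinset.finite_toSet fun t ht => ?_
    simpa using (h.mem_iff t).2 ht
  rw [skewer, dif_pos hfin]
  congr 1
  have h1 : hfin.toFinset = l.toFinset := by ext t; simp [h.mem_iff]
  rw [h1]
  exact (List.toFinset_sort (· ≤ ·) (h.sorted.imp ne_of_lt)).2 (h.sorted.imp le_of_lt)

/-- Excursions of finite length `ξ` above `0` that start with a jump, with left limits. -/
structure Tidy (E : MarkedPath) (ξ : ℝ) : Prop where
  nonneg : 0 ≤ ξ
  dom_eq : E.dom = Set.Icc 0 ξ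
  hit_eq : hit E.path = ξ
  birth_zero : E.birth 0 = 0
  tendsto : ∀ t ∈ Set.Icc 0 ξ, Tendsto E.path (𝓝[<] t) (𝓝 (E.birth t))
  birth_nonneg : ∀ t ∈ Set.Icc 0 ξ, 0 ≤ E.birth t

end MarkedPath

variable {α : ℝ} {n r : ℕ} {w : DrivingPath}

theorem GoodDriving.tidy (hw : GoodDriving α n w) (h : TablesUntil w 0 r) :
    (markedContour w).Tidy (contourLength w r) := by
  have hd : (markedContour w).dom = Set.Icc 0 (contourLength w r) := by
    rw [← hw.hit_contour h]; rfl
  have hp : (markedContour w).path = contour w := rfl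
  have h0 : (markedContour w).birth 0 = 0 := leftLim_eq (tendsto_contour_zero w)
  refine ⟨add_nonneg ENNReal.toReal_nonneg (h.deathLevel_nonneg le_rfl), hd, hw.hit_contour h, h0,
    fun t ht => ?_, fun t ht => ?_⟩
  · rcases ht.1.eq_or_lt with rfl | ht0
    · rw [h0]; exact tendsto_contour_zero w
    · obtain ⟨j, hj, h1, h2⟩ := hw.exists_left_bracket h ht0 ht.2
      have h3 := hw.tendsto_contour h hj h1 h2
      have h4 : (markedContour w).birth t = _ := leftLim_eq h3
      rw [h4]; exact h3
  · rcases ht.1.eq_or_lt with rfl | ht0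
    · rw [h0]
    · obtain ⟨j, hj, h1, h2⟩ := hw.exists_left_bracket h ht0 ht.2
      have h3 := hw.tendsto_contour h hj h1 h2
      have h4 : (markedContour w).birth t = _ := leftLim_eq h3
      rw [h4]
      exact h.sub_nonneg hj ht.2 h2

theorem flatMap_eq_map_filter {β γ : Type*} (l : List β) (p : β → Prop) [DecidablePred p]
    (f : β → γ) : (l.flatMap fun x => if p x then [f x] else []) = (l.filter p).map f := by
  induction l with
  | nil => rfl
  | cons x l ih =>
    by_cases hx : p x <;> simp [hx, ih]

theorem GoodDriving.birth_birthTime (hw : GoodDriving α n w) (h : TablesUntil w 0 r) {j : ℕ}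
    (hj : j ≤ r) : (markedContour w).birth (birthTime w j) = birthLevel w j :=
  leftLim_eq (hw.tendsto_contour_birthTime h hj)

theorem GoodDriving.bracket_birthTime (hw : GoodDriving α n w) (h : TablesUntil w 0 r) {j : ℕ}
    (hj : j ≤ r) : ENNReal.ofReal (birthTime w j) < jumpSum (readPath w.1) (j + 1) := by
  rcases hj.eq_or_lt with rfl | hj
  · exact (ENNReal.ofReal_le_ofReal (h.birthTime_le le_rfl)).trans_lt h.contourLength_lt
  · rw [← h.ofReal_birthTime hj]
    exact (ENNReal.ofReal_lt_ofReal_iff_of_nonneg ENNReal.toReal_nonneg).2 (hw.birthTime_lt h hj)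

/-- Apart from the birth times the contour is left-continuous, so birth and death levels coincide
and nothing can lie between them. -/
theorem GoodDriving.mem_crossings (hw : GoodDriving α n w) (h : TablesUntil w 0 r) (y : ℝ≥0)
    (t : ℝ) : t ∈ (markedContour w).crossings y ↔
      ∃ j ≤ r, t = birthTime w j ∧ birthLevel w j ≤ y ∧ y < deathLevel w j := by
  have hd := (hw.tidy h).dom_eq
  have hp : (markedContour w).path = contour w := rfl
  rw [MarkedPath.crossings, Set.mem_ofPred_eq, hd, hp]
  constructor
  · rintro ⟨ht, h1, h2⟩
    obtain ⟨j, hj, h3, h4⟩ := h.exists_bracket ht.1 ht.2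
    rw [hw.contour_eq h hj h3 h4] at h2
    rcases h3.eq_or_lt with rfl | h3
    · rw [hw.birth_birthTime h hj] at h1
      exact ⟨j, hj, rfl, h1, by linarith⟩
    · have h5 : (markedContour w).birth t = _ := leftLim_eq (hw.tendsto_contour h hj h3 h4.le)
      rw [h5] at h1
      linarith
  · rintro ⟨j, hj, rfl, h1, h2⟩
    refine ⟨⟨ENNReal.toReal_nonneg, h.birthTime_le hj⟩, ?_, ?_⟩
    · rwa [hw.birth_birthTime h hj]
    · rw [hw.contour_eq h hj le_rfl (hw.bracket_birthTime h hj)]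
      linarith

/-- Birth times increase with the index, hence the order of birth is the order from left to right.
The tables alive at `y`, listed by index, give both the crossings of the contour and the section of
the word. -/
theorem GoodDriving.exists_crossedAt (hw : GoodDriving α n w) (hα₁ : α ≤ 1) :
    ∃ ξ, (markedContour w).Tidy ξ ∧ ∀ y : ℝ≥0, ∃ l, (markedContour w).CrossedAt y l ∧
      (l.map fun t => (markedContour w).mark t (y - (markedContour w).birth t).toNNReal) =
        wordSection y n 0 (drivingWord w) := by
  classical
  obtain ⟨r, h, hs⟩ := hw.wordSection_drivingWord hα₁
  refine ⟨_, hw.tidy h, fun y => ?_⟩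
  set p : ℕ → Prop := fun j => birthLevel w j ≤ y ∧ (y : ℝ) < deathLevel w j with hp
  refine ⟨((List.range (r + 1)).filter p).map (birthTime w), ⟨?_, fun t => ?_⟩, ?_⟩
  · rw [List.pairwise_map]
    have h1 : ((List.range (r + 1)).filter p).Pairwise (· < ·) :=
      List.Pairwise.filter _ List.pairwise_lt_range
    refine h1.imp_of_mem fun {i j} hi hj hij => ?_
    have hj' : j < r + 1 := List.mem_range.1 (List.mem_of_mem_filter hj)
    exact hw.birthTime_strictMono h hij (Nat.lt_succ_iff.1 hj')
  · rw [hw.mem_crossings h]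
    simp only [List.mem_map, List.mem_filter, List.mem_range, decide_eq_true_eq, hp]
    constructor
    · rintro ⟨j, ⟨hj, h1, h2⟩, rfl⟩
      exact ⟨j, Nat.lt_succ_iff.1 hj, rfl, h1, h2⟩
    · rintro ⟨j, hj, rfl, h1, h2⟩
      exact ⟨j, ⟨Nat.lt_succ_iff.2 hj, h1, h2⟩, rfl⟩
  · rw [hs y]
    have h1 : (List.range (r + 1)).flatMap (fun j => tableSection w y (birthLevel w j) j) =
        ((List.range (r + 1)).filter p).map fun j => w.2 j (y - birthLevel w j).toNNReal := by
      rw [← flatMap_eq_map_filter]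
      rfl
    rw [h1, List.map_map]
    refine List.map_congr_left fun j hj => ?_
    have hj' : j ≤ r := Nat.lt_succ_iff.1 (List.mem_range.1 (List.mem_of_mem_filter hj))
    simp only [Function.comp_apply]
    rw [hw.birth_birthTime h hj']
    have h2 : w.1 (birthTime w j).toNNReal = j :=
      hw.driving_eq h hj' le_rfl (hw.bracket_birthTime h hj')
    have h3 : (markedContour w).mark (birthTime w j) = w.2 (w.1 (birthTime w j).toNNReal) := rfl
    rw [h3, h2]

end Skewer

/-! ### The skewer on the negative time axis -/

section NegativeAxis

open Filter Topology

variable {M : ℝ≥0 → ℕ} {E : ℕ → MarkedPath} {ξ : ℕ → ℝ}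

/-- Insertion levels that increase to infinity, and excursions of finite length. -/
structure TidyAxis (M : ℝ≥0 → ℕ) (E : ℕ → MarkedPath) (ξ : ℕ → ℝ) : Prop where
  tidy : ∀ j, (E j).Tidy (ξ j)
  jumpTime_zero : jumpTime M 0 = 0
  jumpTime_lt : ∀ j, jumpTime M j < jumpTime M (j + 1)
  exists_lt : ∀ t : ℝ≥0, ∃ j, t < jumpTime M j

namespace TidyAxis

theorem excLength_eq (h : TidyAxis M E ξ) (j : ℕ) : excLength (E j) = ξ j := (h.tidy j).hit_eq

theorem leftEnd_zero (h : TidyAxis M E ξ) : leftEnd M E 0 = 0 := by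
  simp [leftEnd, h.jumpTime_zero]

theorem leftEnd_succ_add (h : TidyAxis M E ξ) (j : ℕ) :
    leftEnd M E (j + 1) + ξ j = leftEnd M E j - (jumpTime M (j + 1) - jumpTime M j) := by
  rw [leftEnd, leftEnd, Finset.sum_range_succ, h.excLength_eq]
  ring

theorem rightEnd_lt (h : TidyAxis M E ξ) (j : ℕ) : leftEnd M E (j + 1) + ξ j < leftEnd M E j := by
  have h1 : (jumpTime M j : ℝ) < jumpTime M (j + 1) := h.jumpTime_lt j
  rw [h.leftEnd_succ_add]; linarith

theorem leftEnd_antitone (h : TidyAxis M E ξ) : Antitone (leftEnd M E) :=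
  antitone_nat_of_succ_le fun j => by
    have := h.rightEnd_lt j
    have := (h.tidy j).nonneg
    linarith

theorem mem_excInterval (h : TidyAxis M E ξ) {j : ℕ} {t : ℝ} :
    t ∈ excInterval M E j ↔ leftEnd M E (j + 1) ≤ t ∧ t ≤ leftEnd M E (j + 1) + ξ j := by
  rw [excInterval, h.excLength_eq]; rfl

theorem mem_driftInterval (h : TidyAxis M E ξ) {j : ℕ} {t : ℝ} :
    t ∈ driftInterval M E j ↔ leftEnd M E (j + 1) + ξ j < t ∧ t < leftEnd M E j := by
  rw [driftInterval, h.excLength_eq]; rfl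

/-- The half-open intervals between consecutive left ends are disjoint, so the `Nat.find` in
`negMarkedPath` has only one candidate. -/
theorem eq_of_mem (h : TidyAxis M E ξ) {i j : ℕ} {t : ℝ}
    (hi : leftEnd M E (i + 1) ≤ t ∧ t < leftEnd M E i)
    (hj : leftEnd M E (j + 1) ≤ t ∧ t < leftEnd M E j) : i = j := by
  by_contra hne
  rcases lt_or_gt_of_ne hne with hlt | hlt
  · have := h.leftEnd_antitone (Nat.succ_le_of_lt hlt)
    simp only [Nat.succ_eq_add_one] at this
    linarith [hi.1, hj.2]
  · have := h.leftEnd_antitone (Nat.succ_le_of_lt hlt)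
    simp only [Nat.succ_eq_add_one] at this
    linarith [hj.1, hi.2]

theorem mem_of_mem_excInterval (h : TidyAxis M E ξ) {j : ℕ} {t : ℝ} (ht : t ∈ excInterval M E j) :
    leftEnd M E (j + 1) ≤ t ∧ t < leftEnd M E j :=
  ⟨(h.mem_excInterval.1 ht).1, (h.mem_excInterval.1 ht).2.trans_lt (h.rightEnd_lt j)⟩

theorem mem_of_mem_driftInterval (h : TidyAxis M E ξ) {j : ℕ} {t : ℝ}
    (ht : t ∈ driftInterval M E j) : leftEnd M E (j + 1) ≤ t ∧ t < leftEnd M E j := by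
  have h1 := h.mem_driftInterval.1 ht
  exact ⟨by linarith [(h.tidy j).nonneg], h1.2⟩

theorem excInterval_or_driftInterval (h : TidyAxis M E ξ) {t : ℝ} (ht : t < 0) :
    ∃ j, t ∈ excInterval M E j ∨ t ∈ driftInterval M E j := by
  classical
  have hex : ∃ j, leftEnd M E j ≤ t := by
    obtain ⟨j, hj⟩ := h.exists_lt (-t).toNNReal
    refine ⟨j, ?_⟩
    have h1 : -t < jumpTime M j := by
      rw [← NNReal.coe_lt_coe, Real.coe_toNNReal _ (by linarith)] at hj
      exact hj
    have h2 : 0 ≤ ∑ i ∈ Finset.range j, excLength (E i) := Finset.sum_nonneg fun i _ => by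
      rw [h.excLength_eq]; exact (h.tidy i).nonneg
    rw [leftEnd]; linarith
  obtain ⟨h1, h2⟩ := And.intro (Nat.find_spec hex) fun m => Nat.find_min hex (m := m)
  cases hN : Nat.find hex with
  | zero =>
    rw [hN, h.leftEnd_zero] at h1
    exact absurd h1 (not_le.2 ht)
  | succ j =>
    rw [hN] at h1
    have h3 := not_le.1 (h2 j (by omega))
    refine ⟨j, ?_⟩
    rw [h.mem_excInterval, h.mem_driftInterval]
    by_cases h4 : t ≤ leftEnd M E (j + 1) + ξ j
    · exact Or.inl ⟨h1, h4⟩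
    · exact Or.inr ⟨not_le.1 h4, h3⟩

theorem path_exc (h : TidyAxis M E ξ) {j : ℕ} {t : ℝ} (ht : t ∈ excInterval M E j) :
    (negMarkedPath M E).path t = jumpTime M (j + 1) + (E j).path (t - leftEnd M E (j + 1)) ∧
      (negMarkedPath M E).mark t = (E j).mark (t - leftEnd M E (j + 1)) := by
  classical
  have hex : ∃ j, t ∈ excInterval M E j := ⟨j, ht⟩
  have hj : Nat.find hex = j := h.eq_of_mem (h.mem_of_mem_excInterval (Nat.find_spec hex))
    (h.mem_of_mem_excInterval ht)
  constructor
  · change (if h : ∃ j, t ∈ excInterval M E j then _ else _) = _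
    rw [dif_pos hex, hj]
  · change (if h : ∃ j, t ∈ excInterval M E j then _ else _) = _
    rw [dif_pos hex, hj]

theorem not_mem_excInterval (h : TidyAxis M E ξ) {i j : ℕ} {t : ℝ} (ht : t ∈ driftInterval M E j) :
    t ∉ excInterval M E i := fun hi => by
  have := h.eq_of_mem (h.mem_of_mem_excInterval hi) (h.mem_of_mem_driftInterval ht)
  subst this
  exact absurd (h.mem_excInterval.1 hi).2 (not_le.2 (h.mem_driftInterval.1 ht).1)

theorem path_drift (h : TidyAxis M E ξ) {j : ℕ} {t : ℝ} (ht : t ∈ driftInterval M E j) :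
    (negMarkedPath M E).path t = -t - ∑ i ∈ Finset.range j, ξ i := by
  classical
  have hex : ∃ j, t ∈ driftInterval M E j := ⟨j, ht⟩
  have hne : ¬ ∃ j, t ∈ excInterval M E j := fun ⟨i, hi⟩ => h.not_mem_excInterval ht hi
  have hj : Nat.find hex = j := h.eq_of_mem (h.mem_of_mem_driftInterval (Nat.find_spec hex))
    (h.mem_of_mem_driftInterval ht)
  have h0 : t < 0 := (h.mem_driftInterval.1 ht).2.trans_le
    (h.leftEnd_zero ▸ h.leftEnd_antitone (Nat.zero_le j))
  change (if h : ∃ j, t ∈ excInterval M E j then _ else _) = _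
  rw [dif_neg hne, dif_pos hex, hj, abs_of_neg h0]
  simp_rw [h.excLength_eq]

theorem tendsto_drift (h : TidyAxis M E ξ) {j : ℕ} {t : ℝ} (h1 : leftEnd M E (j + 1) + ξ j < t)
    (h2 : t ≤ leftEnd M E j) :
    Tendsto (negMarkedPath M E).path (𝓝[<] t) (𝓝 (-t - ∑ i ∈ Finset.range j, ξ i)) := by
  have hc : Tendsto (fun s => -s - ∑ i ∈ Finset.range j, ξ i) (𝓝[<] t)
      (𝓝 (-t - ∑ i ∈ Finset.range j, ξ i)) :=
    Continuous.tendsto' (by fun_prop) t _ rfl |>.mono_left nhdsWithin_le_nhds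
  refine hc.congr' ?_
  filter_upwards [Ioo_mem_nhdsLT h1] with s hs
  exact (h.path_drift (h.mem_driftInterval.2 ⟨hs.1, hs.2.trans_le h2⟩)).symm

/-- Inside the excursion the left limit is a translate of its own. At the left end it comes from the
adjacent drift, which has reached the insertion level there, in accordance with birth level `0` of
the first table. -/
theorem birth_exc (h : TidyAxis M E ξ) {j : ℕ} {t : ℝ} (ht : t ∈ excInterval M E j) :
    (negMarkedPath M E).birth t =
      jumpTime M (j + 1) + (E j).birth (t - leftEnd M E (j + 1)) := by
  have ht' := h.mem_excInterval.1 ht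
  refine leftLim_eq ?_
  rcases ht'.1.eq_or_lt with h1 | h1
  -- Immediately to the left of excursion `j` lies the drift interval with index `j + 1`.
  · have h2 := h.tendsto_drift (j := j + 1) (t := t) (h1 ▸ h.rightEnd_lt (j + 1)) h1.ge
    have h3 : -t - ∑ i ∈ Finset.range (j + 1), ξ i =
        jumpTime M (j + 1) + (E j).birth (t - leftEnd M E (j + 1)) := by
      rw [← h1, sub_self, (h.tidy j).birth_zero, leftEnd]
      simp_rw [h.excLength_eq]
      ring
    rwa [h3] at h2
  · set u := t - leftEnd M E (j + 1) with hu
    have h2 := (h.tidy j).tendsto u ⟨by linarith, by linarith [ht'.2]⟩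
    have h3 : Tendsto (fun s => s - leftEnd M E (j + 1)) (𝓝[<] t) (𝓝[<] u) := by
      refine tendsto_nhdsWithin_iff.2 ⟨?_, ?_⟩
      · exact (Continuous.tendsto' (by fun_prop) t _ rfl).mono_left nhdsWithin_le_nhds
      · filter_upwards [self_mem_nhdsWithin] with s hs
        have hs' : s < t := hs
        have : s - leftEnd M E (j + 1) < u := by linarith
        exact this
    refine ((h2.comp h3).const_add (jumpTime M (j + 1) : ℝ)).congr' ?_
    filter_upwards [Ioo_mem_nhdsLT h1] with s hs
    exact (h.path_exc (h.mem_excInterval.2 ⟨hs.1.le, hs.2.le.trans ht'.2⟩)).1.symm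

theorem birth_drift (h : TidyAxis M E ξ) {j : ℕ} {t : ℝ} (ht : t ∈ driftInterval M E j) :
    (negMarkedPath M E).birth t = (negMarkedPath M E).path t := by
  have ht' := h.mem_driftInterval.1 ht
  rw [h.path_drift ht]
  exact leftLim_eq (h.tendsto_drift ht'.1 ht'.2.le)

theorem jumpTime_mono (h : TidyAxis M E ξ) : Monotone (jumpTime M) :=
  monotone_nat_of_le_succ fun j => (h.jumpTime_lt j).le

/-- Drift intervals contain no jumps. The excursion `j` has nonnegative birth levels relative to its
insertion level, so only excursions inserted at or below `y` can cross `y`. -/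
theorem mem_crossings (h : TidyAxis M E ξ) {y : ℝ≥0} {N : ℕ} (h1 : jumpTime M N ≤ y)
    (h2 : y < jumpTime M (N + 1)) (t : ℝ) : t ∈ (negMarkedPath M E).crossings y ↔
      ∃ j < N, t - leftEnd M E (j + 1) ∈ (E j).crossings (y - jumpTime M (j + 1)) := by
  have hd : (negMarkedPath M E).dom = Set.Iio 0 := rfl
  have key : ∀ j, t ∈ excInterval M E j → jumpTime M (j + 1) ≤ y →
      (t ∈ (negMarkedPath M E).crossings y ↔
        t - leftEnd M E (j + 1) ∈ (E j).crossings (y - jumpTime M (j + 1))) := by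
    intro j hj hy
    have h0 : t < 0 := (h.mem_of_mem_excInterval hj).2.trans_le
      (h.leftEnd_zero ▸ h.leftEnd_antitone (Nat.zero_le j))
    have hj' := h.mem_excInterval.1 hj
    have hu : t - leftEnd M E (j + 1) ∈ Set.Icc 0 (ξ j) := ⟨by linarith, by linarith⟩
    simp only [MarkedPath.crossings, Set.mem_ofPred_eq, hd, h.birth_exc hj, (h.path_exc hj).1,
      (h.tidy j).dom_eq, hu, Set.mem_Iio, h0, true_and, NNReal.coe_sub hy]
    constructor <;> rintro ⟨a, b⟩ <;> constructor <;> linarith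
  constructor
  · intro ht
    have h0 : t < 0 := ht.1
    obtain ⟨j, hj | hj⟩ := h.excInterval_or_driftInterval h0
    · have hj' := h.mem_excInterval.1 hj
      have h3 := (h.tidy j).birth_nonneg (t - leftEnd M E (j + 1))
        ⟨by linarith, by linarith⟩
      have h4 := ht.2.1
      rw [h.birth_exc hj] at h4
      have h5 : jumpTime M (j + 1) ≤ y := by
        rw [← NNReal.coe_le_coe]; linarith
      refine ⟨j, ?_, (key j hj h5).1 ht⟩
      by_contra hN
      exact absurd h2 (not_lt.2 ((h.jumpTime_mono (by omega)).trans h5))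
    · have h3 := ht.2
      rw [h.birth_drift hj] at h3
      linarith
  · rintro ⟨j, hj, ht⟩
    have h3 := ht.1
    rw [(h.tidy j).dom_eq] at h3
    refine (key j (h.mem_excInterval.2 ⟨by linarith [h3.1], by linarith [h3.2]⟩) ?_).2 ht
    exact (h.jumpTime_mono hj).trans h1

/-- Excursions inserted at higher levels lie further to the left, which explains the reversed order
of the indices. -/
theorem skewer_eq (h : TidyAxis M E ξ) {y : ℝ≥0} {N : ℕ} (h1 : jumpTime M N ≤ y)
    (h2 : y < jumpTime M (N + 1)) {l : ℕ → List ℝ}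
    (hl : ∀ j < N, (E j).CrossedAt (y - jumpTime M (j + 1)) (l j)) :
    (negMarkedPath M E).skewer y = (List.range N).reverse.flatMap fun j =>
      (l j).map fun t => (E j).mark t (((y - jumpTime M (j + 1) : ℝ≥0) : ℝ) -
        (E j).birth t).toNNReal := by
  have hexc : ∀ j < N, ∀ t ∈ l j, leftEnd M E (j + 1) + t ∈ excInterval M E j := by
    intro j hj t ht
    have h3 := (((hl j hj).mem_iff t).1 ht).1
    rw [(h.tidy j).dom_eq] at h3
    exact h.mem_excInterval.2 ⟨by linarith [h3.1], by linarith [h3.2]⟩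
  have hc : (negMarkedPath M E).CrossedAt y ((List.range N).reverse.flatMap fun j =>
      (l j).map fun t => leftEnd M E (j + 1) + t) := by
    refine ⟨List.pairwise_flatMap.2 ⟨fun j hj => ?_, ?_⟩, fun t => ?_⟩
    · have hj' : j < N := by simpa using hj
      rw [List.pairwise_map]
      exact (hl j hj').sorted.imp fun hab => by linarith
    · rw [List.pairwise_reverse]
      refine List.pairwise_lt_range.imp_of_mem fun {i j} hi hj hij => ?_
      intro x hx z hz
      obtain ⟨s, hs, rfl⟩ := List.mem_map.1 hx
      obtain ⟨t, ht, rfl⟩ := List.mem_map.1 hz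
      have h3 := h.mem_of_mem_excInterval (hexc j (List.mem_range.1 hj) s hs)
      have h4 := h.mem_of_mem_excInterval (hexc i (List.mem_range.1 hi) t ht)
      exact h3.2.trans_le ((h.leftEnd_antitone (Nat.succ_le_of_lt hij)).trans h4.1)
    · rw [h.mem_crossings h1 h2]
      simp only [List.mem_flatMap, List.mem_reverse, List.mem_range, List.mem_map]
      constructor
      · rintro ⟨j, hj, s, hs, rfl⟩
        refine ⟨j, hj, ?_⟩
        rw [add_sub_cancel_left]
        exact ((hl j hj).mem_iff s).1 hs
      · rintro ⟨j, hj, ht⟩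
        exact ⟨j, hj, _, ((hl j hj).mem_iff _).2 ht, by ring⟩
  rw [hc.skewer_eq, List.map_flatMap]
  refine List.flatMap_congr fun j hj => ?_
  have hj' : j < N := by simpa using hj
  rw [List.map_map]
  refine List.map_congr_left fun t ht => ?_
  have h3 := hexc j hj' t ht
  have h4 : jumpTime M (j + 1) ≤ y := (h.jumpTime_mono hj').trans h1
  simp only [Function.comp_apply]
  rw [h.birth_exc h3, (h.path_exc h3).2, add_sub_cancel_left, NNReal.coe_sub h4, sub_sub]

end TidyAxis

/-! ### Insertion levels given by a Poisson process -/

variable {θ : ℝ}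

theorem IsPathOf.poisson_lt_top (hθ : 0 < θ) {z : ℕ → ℕ × ℝ≥0∞}
    (h : IsPathOf (fun m l => if l = m + 1 then θ else 0) M z) (j : ℕ) : (z j).2 < ∞ := by
  refine lt_top_iff_ne_top.2 fun h1 => ?_
  have h2 := (h.good j).2.1.1 h1
  rw [(poissonRate_proper hθ.le).1] at h2
  exact hθ.ne' h2

theorem IsPathOf.poisson_jumpSum_lt_top (hθ : 0 < θ) {z : ℕ → ℕ × ℝ≥0∞}
    (h : IsPathOf (fun m l => if l = m + 1 then θ else 0) M z) (j : ℕ) : jumpSum z j < ∞ :=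
  ENNReal.sum_lt_top.2 fun m _ => h.poisson_lt_top hθ m

theorem IsPathOf.poisson_state (hθ : 0 < θ) {z : ℕ → ℕ × ℝ≥0∞}
    (h : IsPathOf (fun m l => if l = m + 1 then θ else 0) M z) (h0 : (z 0).1 = 0) (j : ℕ) :
    (z j).1 = j := by
  induction j with
  | zero => exact h0
  | succ j ih =>
    by_contra hne
    refine (h.good j).2.2 ?_
    rw [jumpProb, (poissonRate_proper hθ.le).1, if_neg hθ.ne', ih, if_neg hne]
    split_ifs <;> simp

theorem IsPathOf.jumpTime_eq (hθ : 0 < θ) {z : ℕ → ℕ × ℝ≥0∞}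
    (h : IsPathOf (fun m l => if l = m + 1 then θ else 0) M z) (h0 : (z 0).1 = 0) (j : ℕ) :
    (jumpTime M j : ℝ≥0∞) = jumpSum z j := by
  obtain ⟨s, hs⟩ := WithTop.ne_top_iff_exists.1 (h.poisson_jumpSum_lt_top hθ j).ne
  replace hs : (s : ℝ≥0∞) = jumpSum z j := hs
  rw [← hs, ENNReal.coe_inj]
  have key : ∀ t : ℝ≥0, j ≤ M t ↔ s ≤ t := by
    intro t
    obtain ⟨m, h1, h2⟩ := h.exists_bracket t
    rw [h.eq m t h1 h2, h.poisson_state hθ h0, ← ENNReal.coe_le_coe, hs]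
    constructor
    · exact fun hj => (jumpSum_mono z hj).trans h1
    · intro hj
      by_contra hlt
      exact absurd h2 (not_lt.2 ((jumpSum_mono z (by omega)).trans hj))
  refine IsLeast.csInf_eq ⟨(key s).2 le_rfl, fun t ht => (key t).1 ht⟩

theorem IsPathOf.tidyAxis (hθ : 0 < θ) {z : ℕ → ℕ × ℝ≥0∞}
    (h : IsPathOf (fun m l => if l = m + 1 then θ else 0) M z) (h0 : (z 0).1 = 0)
    (hE : ∀ j, (E j).Tidy (ξ j)) : TidyAxis M E ξ := by
  have hj := h.jumpTime_eq hθ h0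
  refine ⟨hE, ?_, fun j => ?_, fun t => ?_⟩
  · have := hj 0
    simpa [jumpSum] using this
  · rw [← ENNReal.coe_lt_coe, hj, hj, jumpSum_succ]
    exact ENNReal.lt_add_right (h.poisson_jumpSum_lt_top hθ j).ne (h.good j).1.ne'
  · obtain ⟨m, -, h2⟩ := h.exists_bracket t
    refine ⟨m + 1, ?_⟩
    rwa [← ENNReal.coe_lt_coe, hj]

end NegativeAxis

/-! ### Skewers of configurations -/

section ConfigSection

variable {α : ℝ}

/-- Nonzero weight makes `(b, m)` a birth, preceded by size `0`. The step down to it belongs to no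
table and adds nothing to the section. -/
theorem wordSection_append {y : ℝ} {n m : ℕ} {s b : ℝ} {u v : Word} (hs : b < s)
    (hu : ∀ x ∈ u, b < x.1) (h : weight α n s (u ++ (b, m) :: v) ≠ 0) :
    m = 1 ∧ wordSection y n s (u ++ (b, m) :: v) = wordSection y n s u ++ wordSection y m b v := by
  induction u generalizing n s with
  | nil =>
    have h1 : stepWeight α n s b m ≠ 0 := left_ne_zero_of_mul h
    have hn : n = 0 := by
      by_contra hn
      exact h1 (by rw [stepWeight, if_neg hn, if_neg hs.le.not_gt])
    have hm : m = 1 := by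
      by_contra hm
      exact h1 (by simp [stepWeight, hn, hm])
    exact ⟨hm, by simp [wordSection, hn]⟩
  | cons x u ih =>
    obtain ⟨h1, h2⟩ := ih (hu x List.mem_cons_self) (fun z hz => hu z (List.mem_cons_of_mem _ hz))
      (right_ne_zero_of_mul h)
    refine ⟨h1, ?_⟩
    rw [List.cons_append, wordSection, h2, wordSection, List.append_assoc]

/-- The table sizes at level `y` of a block. -/
noncomputable def blockSection (y : ℝ) (p : Block) : List ℕ := wordSection y p.1 0 p.2

/-- The table sizes at level `y` of a forest. -/
noncomputable def forestSection (y : ℝ) (x : List Block) : List ℕ := x.flatMap (blockSection y)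

theorem GoodWord.ne_nil {n : ℕ+} {w : Word} (h : GoodWord α n w) : w ≠ [] := by
  rintro rfl
  exact h.1 (by simp [weight])

theorem blockSection_of_lt {y : ℝ} (hy : 0 ≤ y) {p : Block} (hp : GoodWord α p.1 p.2)
    (h : ENNReal.ofReal y < wordClock p.2) : blockSection y p = [(p.1 : ℕ)] := by
  rw [ofReal_lt_wordClock hy] at h
  obtain ⟨x, w, hw⟩ := List.exists_cons_of_ne_nil hp.ne_nil
  rw [hw] at h
  rw [blockSection, hw, wordSection, wordSection_eq_nil
    (fun z hz => h z (List.mem_cons_of_mem _ hz)) _ (h x List.mem_cons_self)]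
  simp [hy, h x List.mem_cons_self]

theorem blockSection_shift {y b : ℝ} (hb : 0 ≤ b) (hy : b ≤ y) (p : Block) :
    blockSection (y - b) (p.1, shiftWord b p.2) = blockSection y p := by
  rw [blockSection, blockSection, ← wordSection_shift y b,
    wordSection_level (s := 0) (s' := 0 - b) (by linarith) (by linarith)]

theorem forestSection_shift {y b : ℝ} (hb : 0 ≤ b) (hy : b ≤ y) (x : List Block) :
    forestSection (y - b) (forestShift b x) = forestSection y x := by
  rw [forestSection, forestShift, List.flatMap_map]
  exact List.flatMap_congr fun p _ => blockSection_shift hb hy p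

/-- Cutting an excursion at its lowest letter removes nothing above that letter: the blocks that
replace it are the two sides of the cut, in the same order. -/
theorem forestSection_blockNext {y : ℝ} (hy : 0 ≤ y) {p : Block} (hp : GoodWord α p.1 p.2)
    (h : wordClock p.2 ≤ ENNReal.ofReal y) :
    forestSection (y - (wordClock p.2).toReal) (blockNext p) = blockSection y p := by
  obtain ⟨n, w⟩ := p
  have hw : w ≠ [] := hp.ne_nil
  obtain ⟨hsplit, hmin⟩ := minSplit_spec hw
  rcases hq : minSplit w with ⟨u, ⟨b, m⟩, v⟩
  rw [hq] at hsplit hmin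
  simp only at hsplit
  have hb0 : 0 < b := hp.2 (b, m) (by rw [hsplit]; simp)
  have hc : wordClock w = ENNReal.ofReal b := by rw [wordClock, if_neg hw, hq]
  simp only [hc] at h ⊢
  rw [ENNReal.ofReal_le_ofReal_iff hy] at h
  rw [ENNReal.toReal_ofReal hb0.le]
  have hn : (n : ℕ) ≠ 0 := n.ne_zero
  have hwt := hp.1
  simp only [hsplit] at hwt
  have hshift : ∀ (k : ℕ) (z : Word), wordSection (y - b) k 0 (shiftWord b z) =
      wordSection y k b z := fun k z => by
    have := wordSection_shift y b k b z
    rwa [sub_self] at this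
  simp only [blockNext, hq, relSplit, splitBlocks]
  cases u with
  | nil =>
    have h1 : weight α n 0 ((b, m) :: v) = stepWeight α n 0 b m * weight α m b v := rfl
    rw [List.nil_append, h1] at hwt
    have hs : blockSection y (n, w) = wordSection y m b v := by
      rw [blockSection, hsplit]
      simp [wordSection, not_lt.2 h]
    rw [hs, if_pos (by simp [shiftWord])]
    -- A first jump to size `0` at the lowest letter ends the excursion, as a further letter would
    -- have to be a birth strictly below.
    by_cases hm : m = 0
    · have hv : v = [] := by
        by_contra hv
        obtain ⟨x, v', rfl⟩ := List.exists_cons_of_ne_nil hv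
        have h2 : weight α m b (x :: v') = stepWeight α m b x.1 x.2 * weight α x.2 x.1 v' := rfl
        rw [h2] at hwt
        refine left_ne_zero_of_mul (right_ne_zero_of_mul hwt) ?_
        have h3 : b ≤ x.1 := hmin.2 x List.mem_cons_self
        simp [stepWeight, hm, not_lt.2 h3]
      rw [if_pos hm, hv]
      rfl
    · rw [if_neg hm]
      have hm' : ((m.toPNat' : ℕ+) : ℕ) = m := by
        rw [Nat.toPNat'_coe, if_pos (Nat.pos_of_ne_zero hm)]
      simp [forestSection, blockSection, hm', hshift]
  | cons x u =>
    have h1 : weight α n 0 (x :: u ++ (b, m) :: v) =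
      stepWeight α n 0 x.1 x.2 * weight α x.2 x.1 (u ++ (b, m) :: v) := rfl
    rw [h1] at hwt
    obtain ⟨h2, h3⟩ := wordSection_append (y := y) (hmin.1 x List.mem_cons_self)
      (fun z hz => hmin.1 z (List.mem_cons_of_mem _ hz)) (right_ne_zero_of_mul hwt)
    have hne : ¬ shiftWord b (x :: u) = [] := by simp [shiftWord]
    rw [if_neg hne]
    have hs : blockSection y (n, w) = wordSection y n 0 (x :: u) ++ wordSection y 1 b v := by
      rw [blockSection, hsplit, List.cons_append, wordSection, h3, wordSection, h2,
        List.append_assoc]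
    -- At a level `y ≥ b` it makes no difference whether the root table starts at `0` or at `b`.
    rw [hs, wordSection_level (s' := b) hy h]
    simp only [forestSection, blockSection, List.flatMap_cons, List.flatMap_nil, List.append_nil,
      hshift, PNat.one_coe]

theorem forestSection_of_lt {y : ℝ} (hy : 0 ≤ y) {x : List Block}
    (hx : ∀ p ∈ x, GoodWord α (p.1 : ℕ) p.2) (h : ENNReal.ofReal y < forestClock x) :
    forestSection y x = (blockSizes x).map PNat.val := by
  induction x with
  | nil => rfl
  | cons p x ih =>
    rw [forestClock, lt_min_iff] at h
    have h1 := ih (fun q hq => hx q (List.mem_cons_of_mem _ hq)) h.2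
    have h2 := blockSection_of_lt hy (hx p List.mem_cons_self) h.1
    simp only [forestSection, List.flatMap_cons, blockSizes, List.map_cons] at h1 ⊢
    rw [h1, h2]
    rfl

theorem forestSection_forestNext {y : ℝ} (hy : 0 ≤ y) {x : List Block}
    (hx : ∀ p ∈ x, GoodWord α (p.1 : ℕ) p.2) (h : forestClock x ≤ ENNReal.ofReal y) :
    forestSection (y - (forestClock x).toReal) (forestNext x) = forestSection y x := by
  have hle : ∀ c : ℝ≥0∞, c ≤ ENNReal.ofReal y → c.toReal ≤ y := fun c hc => by
    have := ENNReal.toReal_mono ENNReal.ofReal_ne_top hc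
    rwa [ENNReal.toReal_ofReal hy] at this
  induction x with
  | nil => simp [forestClock] at h
  | cons p x ih =>
    have hcons : forestSection y (p :: x) = blockSection y p ++ forestSection y x := rfl
    by_cases hlt : wordClock p.2 < forestClock x
    · have h1 : forestClock (p :: x) = wordClock p.2 := min_eq_left hlt.le
      rw [h1] at h ⊢
      rw [forestNext, if_pos hlt, hcons]
      have h2 := forestSection_blockNext hy (hx p List.mem_cons_self) h
      have h3 := forestSection_shift ENNReal.toReal_nonneg (hle _ h) x
      rw [forestSection] at h2 h3 ⊢
      rw [List.flatMap_append, h2, h3]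
    · have h1 : forestClock (p :: x) = forestClock x := min_eq_right (not_lt.1 hlt)
      rw [h1] at h ⊢
      rw [forestNext, if_neg hlt, hcons]
      have h2 := ih (fun q hq => hx q (List.mem_cons_of_mem _ hq)) h
      have h3 := blockSection_shift ENNReal.toReal_nonneg (hle _ h) p
      rw [← h2, ← h3]
      rfl

/-- The table sizes at level `y` in excursions that start at the levels given by a stream of
gaps; excursions that start at higher levels come first. -/
inductive StreamSection : ℝ → (ℕ → ℝ≥0∞ × Word) → List ℕ → Prop
  | nil {y : ℝ} {g : ℕ → ℝ≥0∞ × Word} (h : ENNReal.ofReal y < (g 0).1) : StreamSection y g []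
  | cons {y : ℝ} {g : ℕ → ℝ≥0∞ × Word} {l : List ℕ} (h : (g 0).1 ≤ ENNReal.ofReal y)
      (hl : StreamSection (y - (g 0).1.toReal) (tailStream g) l) :
      StreamSection y g (l ++ wordSection (y - (g 0).1.toReal) 1 0 (g 0).2)

/-- The table sizes at level `y` of a configuration. -/
def ConfigSection (y : ℝ) (d : Config) (l : List ℕ) : Prop :=
  ∃ l₁, StreamSection y d.1 l₁ ∧ l = l₁ ++ forestSection y d.2

/-- All levels of a stream are relative to the preceding ones, so lowering the whole stream by `c`
shortens only its first gap. -/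
theorem StreamSection.shift {y : ℝ} {c : ℝ≥0∞} (hc : c ≠ ∞) {g : ℕ → ℝ≥0∞ × Word} {l : List ℕ}
    (hcy : c.toReal ≤ y) (hcg : c ≤ (g 0).1) (hg : (g 0).1 ≠ ∞) (h : StreamSection y g l) :
    StreamSection (y - c.toReal) (consStream ((g 0).1 - c, (g 0).2) (tailStream g)) l := by
  have h1 : ((g 0).1 - c).toReal = (g 0).1.toReal - c.toReal :=
    ENNReal.toReal_sub_of_le hcg hg
  have h2 : ENNReal.ofReal (y - c.toReal) = ENNReal.ofReal y - c := by
    rw [ENNReal.ofReal_sub _ ENNReal.toReal_nonneg, ENNReal.ofReal_toReal hc]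
  have h3 : c ≤ ENNReal.ofReal y := by
    rw [← ENNReal.ofReal_toReal hc]; exact ENNReal.ofReal_le_ofReal hcy
  cases h with
  | nil h =>
    refine .nil ?_
    rw [h2]
    exact (ENNReal.cancel_of_ne hc).tsub_lt_tsub_right_of_le h3 h
  | cons h hl =>
    have h4 : y - (g 0).1.toReal = y - c.toReal - ((g 0).1 - c).toReal := by rw [h1]; ring
    rw [h4] at hl ⊢
    refine .cons (g := consStream ((g 0).1 - c, (g 0).2) (tailStream g)) ?_ hl
    rw [h2]
    exact tsub_le_tsub_right h c

theorem ConfigSection.eq_of_lt {y : ℝ} (hy : 0 ≤ y) {d : Config} {l : List ℕ} (hd : GoodConfig α d)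
    (h : ENNReal.ofReal y < configClock d) (hl : ConfigSection y d l) :
    l = (configSizes d).map PNat.val := by
  obtain ⟨l₁, h1, rfl⟩ := hl
  rw [configClock, lt_min_iff] at h
  rw [forestSection_of_lt hy hd.2 h.2]
  cases h1 with
  | nil => rfl
  | cons h2 => exact absurd h.1 (not_lt.2 h2)

/-- The deterministic counterpart of the Markov step: an event at or below `y` rearranges the
configuration without changing what is seen at `y`. An immigrant passes from the end of the stream
part to the front of the forest part, so the concatenation is the same. -/
theorem ConfigSection.next {y : ℝ} (hy : 0 ≤ y) {d : Config} {l : List ℕ} (hd : GoodConfig α d)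
    (h : configClock d ≤ ENNReal.ofReal y) (hl : ConfigSection y d l) :
    ConfigSection (y - (configClock d).toReal) (configNext d) l := by
  obtain ⟨l₁, h1, rfl⟩ := hl
  have hcy : (configClock d).toReal ≤ y := by
    have := ENNReal.toReal_mono ENNReal.ofReal_ne_top h
    rwa [ENNReal.toReal_ofReal hy] at this
  have hfin : configClock d ≠ ∞ := ne_top_of_le_ne_top ENNReal.ofReal_ne_top h
  by_cases hlt : (d.1 0).1 < forestClock d.2
  · have hc : configClock d = (d.1 0).1 := min_eq_left hlt.le
    rw [configNext, if_pos hlt]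
    rw [hc] at h hcy ⊢
    cases h1 with
    | nil h2 => exact absurd h2 (not_lt.2 h)
    | cons h2 hl =>
      refine ⟨_, hl, ?_⟩
      have h3 := forestSection_shift ENNReal.toReal_nonneg hcy d.2
      rw [← h3, List.append_assoc]
      rfl
  · have hc : configClock d = forestClock d.2 := min_eq_right (not_lt.1 hlt)
    rw [configNext, if_neg hlt]
    rw [hc] at h hcy hfin ⊢
    refine ⟨l₁, h1.shift hfin hcy (not_lt.1 hlt) (hd.1 0).2.1.ne, ?_⟩
    rw [forestSection_forestNext hy hd.2 h]

/-- The events up to `y` are cut away one by one. Above the last of them nothing has happened yet at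
`y`, and the section consists of the initial sizes. -/
theorem ConfigSection.eq_configSizes {d : Config} (hd : ∀ m, GoodConfig α (configNext^[m] d))
    {n : ℕ} {y : ℝ} (hy : 0 ≤ y) {l : List ℕ} (hl : ConfigSection y d l)
    (h1 : ∑ m ∈ Finset.range n, configClock (configNext^[m] d) ≤ ENNReal.ofReal y)
    (h2 : ENNReal.ofReal y < ∑ m ∈ Finset.range (n + 1), configClock (configNext^[m] d)) :
    l = (configSizes (configNext^[n] d)).map PNat.val := by
  induction n generalizing d y with
  | zero => exact hl.eq_of_lt hy (hd 0) (by simpa using h2)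
  | succ n ih =>
    simp only [Finset.sum_range_succ', Function.iterate_succ, Function.comp_apply,
      Function.iterate_zero, id] at h1 h2
    have h3 : configClock d ≤ ENNReal.ofReal y := le_add_self.trans h1
    have hfin : configClock d ≠ ∞ := ne_top_of_le_ne_top ENNReal.ofReal_ne_top h3
    have hcy : (configClock d).toReal ≤ y := by
      have := ENNReal.toReal_mono ENNReal.ofReal_ne_top h3
      rwa [ENNReal.toReal_ofReal hy] at this
    have h4 : ENNReal.ofReal (y - (configClock d).toReal) = ENNReal.ofReal y - configClock d := by
      rw [ENNReal.ofReal_sub _ ENNReal.toReal_nonneg, ENNReal.ofReal_toReal hfin]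
    refine ih (d := configNext d) (fun m => hd (m + 1)) (sub_nonneg.2 hcy)
      (hl.next hy (hd 0) h3) ?_ ?_
    · rw [h4]
      exact ENNReal.le_sub_of_add_le_right hfin h1
    · rw [h4, Finset.sum_range_succ']
      exact ENNReal.sub_lt_of_lt_add h3 h2

/-- A stream of excursions up to the level between two starting levels. -/
theorem streamSection_of_bracket {g : ℕ → ℝ≥0∞ × Word} {N : ℕ} {y : ℝ} (hy : 0 ≤ y)
    (h1 : ∑ m ∈ Finset.range N, (g m).1 ≤ ENNReal.ofReal y)
    (h2 : ENNReal.ofReal y < ∑ m ∈ Finset.range (N + 1), (g m).1) :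
    StreamSection y g ((List.range N).reverse.flatMap fun j =>
      wordSection (y - (∑ m ∈ Finset.range (j + 1), (g m).1).toReal) 1 0 (g j).2) := by
  induction N generalizing g y with
  | zero => exact .nil (by simpa using h2)
  | succ N ih =>
    have h1' := h1
    rw [Finset.sum_range_succ'] at h1 h2
    have h3 : (g 0).1 ≤ ENNReal.ofReal y := le_add_self.trans h1
    have hfin : (g 0).1 ≠ ∞ := ne_top_of_le_ne_top ENNReal.ofReal_ne_top h3
    have hcy : (g 0).1.toReal ≤ y := by
      have := ENNReal.toReal_mono ENNReal.ofReal_ne_top h3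
      rwa [ENNReal.toReal_ofReal hy] at this
    have h4 : ENNReal.ofReal (y - (g 0).1.toReal) = ENNReal.ofReal y - (g 0).1 := by
      rw [ENNReal.ofReal_sub _ ENNReal.toReal_nonneg, ENNReal.ofReal_toReal hfin]
    have h5 := ih (g := tailStream g) (y := y - (g 0).1.toReal) (sub_nonneg.2 hcy)
      (by rw [h4]; exact ENNReal.le_sub_of_add_le_right hfin h1)
      (by rw [h4]; exact ENNReal.sub_lt_of_lt_add h3 h2)
    have h6 := StreamSection.cons h3 h5
    rw [List.range_succ_eq_map, List.reverse_cons, List.flatMap_append, ← List.map_reverse,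
      List.flatMap_map]
    convert h6 using 2
    · refine List.flatMap_congr fun j hj => ?_
      have hj' : j < N := by simpa using hj
      have h7 : (∑ m ∈ Finset.range (j + 1), (g (m + 1)).1) ≠ ∞ := by
        refine ne_top_of_le_ne_top (ne_top_of_le_ne_top ENNReal.ofReal_ne_top h1) ?_
        refine le_trans ?_ le_self_add
        exact Finset.sum_le_sum_of_subset (Finset.range_mono (by omega))
      rw [Finset.sum_range_succ', ENNReal.toReal_add h7 hfin]
      rw [add_comm, ← sub_sub]
      rfl
    · simp

end ConfigSection

/-! ### The law of the configuration -/

section ConfigOf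

/-- With the first stream fixed, a box has a product of probabilities under the second; these
factors are functions of independent entries of the first stream. -/
theorem map_zip_streamLaw {X Y : Type*} [MeasurableSpace X] [MeasurableSpace Y] (ν : Measure X)
    (ν' : Measure Y) [IsProbabilityMeasure ν] [IsProbabilityMeasure ν'] :
    ((streamLaw ν).prod (streamLaw ν')).map (fun p k => (p.1 k, p.2 k)) =
      streamLaw (ν.prod ν') := by
  have hm : Measurable fun (p : (ℕ → X) × (ℕ → Y)) (k : ℕ) => (p.1 k, p.2 k) := by fun_prop
  refine Measure.eq_infinitePi _ fun s t ht => ?_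
  have hst : MeasurableSet (Set.pi (s : Set ℕ) t) :=
    MeasurableSet.pi s.countable_toSet fun i _ => ht i
  rw [Measure.map_apply hm hst, Measure.prod_apply (hm hst)]
  have h1 (a : ℕ → X) : streamLaw ν' (Prod.mk a ⁻¹' ((fun (p : (ℕ → X) × (ℕ → Y)) (k : ℕ) =>
      (p.1 k, p.2 k)) ⁻¹' Set.pi (s : Set ℕ) t)) = ∏ i ∈ s, ν' (Prod.mk (a i) ⁻¹' t i) := by
    rw [← Measure.infinitePi_pi (fun _ => ν') fun i _ => measurable_prodMk_left (ht i)]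
    rfl
  simp_rw [h1]
  have h2 (i : ℕ) : Measurable fun x => ν' (Prod.mk x ⁻¹' t i) := measurable_measure_prodMk_left (ht i)
  have h3 := iIndepFun_infinitePi (P := fun _ : ℕ => ν) (X := fun i x => ν' (Prod.mk x ⁻¹' t i)) h2
  rw [streamLaw, lintegral_prod_eq_prod_lintegral_of_indepFun s _ h3
    fun i => (h2 i).comp (measurable_pi_apply i)]
  refine Finset.prod_congr rfl fun i _ => ?_
  rw [Measure.prod_apply (ht i)]
  exact (measurePreserving_eval_infinitePi (fun _ : ℕ => ν) i).lintegral_comp (h2 i)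

theorem measurable_ofFn {X : Type*} [MeasurableSpace X] [Nonempty X] (k : ℕ) :
    Measurable fun f : Fin k → X => List.ofFn f := by
  induction k with
  | zero => simp only [List.ofFn_zero]; exact measurable_const
  | succ k ih =>
    simp only [List.ofFn_succ]
    refine Measurable.list_cons (measurable_pi_apply 0) (ih.comp ?_)
    exact measurable_pi_lambda _ fun i => measurable_pi_apply _

theorem measurable_blocksOf (c : List ℕ+) :
    Measurable fun f : Fin c.length → Word => List.ofFn fun j => (c.get j, f j) :=
  (measurable_ofFn (X := Block) c.length).comp (by fun_prop)

variable {α θ : ℝ} [∀ n, IsProbabilityMeasure (excursionLaw α n)]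

theorem map_blocksOf (c : List ℕ+) :
    (Measure.pi fun j : Fin c.length => excursionLaw α (c.get j : ℕ)).map
      (fun f => List.ofFn fun j => (c.get j, f j)) = forestLaw α c := by
  induction c with
  | nil =>
    refine Measure.ext_of_lintegral _ fun F hF => ?_
    rw [lintegral_map hF (measurable_blocksOf []), lintegral_forestLaw_nil hF]
    simp
  | cons a c ih =>
    refine Measure.ext_of_lintegral _ fun F hF => ?_
    rw [lintegral_map hF (measurable_blocksOf (a :: c)), lintegral_forestLaw_cons _ _ hF, ← ih]
    have hmp := measurePreserving_piFinSuccAbove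
      (fun j : Fin (c.length + 1) => excursionLaw α ((a :: c).get j : ℕ)) 0
    have hb := measurable_blocksOf c
    have hG : Measurable fun p : Word × (Fin c.length → Word) =>
        F ((a, p.1) :: List.ofFn fun j => (c.get j, p.2 j)) :=
      hF.comp (Measurable.list_cons (by fun_prop) (hb.comp measurable_snd))
    have h1 := hmp.lintegral_comp hG
    have h2 (w : Word) : ∫⁻ x, F ((a, w) :: x) ∂(Measure.pi fun j : Fin c.length =>
        excursionLaw α (c.get j : ℕ)).map (fun f => List.ofFn fun j => (c.get j, f j)) =
        ∫⁻ f, F ((a, w) :: List.ofFn fun j => (c.get j, f j))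
          ∂Measure.pi fun j : Fin c.length => excursionLaw α (c.get j : ℕ) :=
      lintegral_map (by fun_prop) hb
    simp_rw [h2]
    rw [lintegral_prod _ hG.aemeasurable] at h1
    refine Eq.trans ?_ h1
    refine lintegral_congr fun f => ?_
    congr 1
    exact List.ofFn_succ (f := fun j : Fin (c.length + 1) => ((a :: c).get j, f j))

/-- The configuration given by driving paths and insertion levels. -/
noncomputable def configOf (c : List ℕ+) (W : Fin c.length → DrivingPath) (M : ℝ≥0 → ℕ)
    (V : ℕ → DrivingPath) : Config :=
  (fun j => ((readPath M j).2, drivingWord (V j)),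
    List.ofFn fun j => (c.get j, drivingWord (W j)))

variable {Ω : Type*} [MeasurableSpace Ω] {μ : Measure Ω} [IsProbabilityMeasure μ]
  [ProperRates (tableRate α)]

/-- Gaps, words of immigrants and words of initial tables are measurable functions of independent
inputs, so the joint law is the product of the three laws. -/
theorem map_configOf (hα₀ : 0 ≤ α) (hα₁ : α ≤ 1) (hθ : 0 < θ) {c : List ℕ+}
    {W : Fin c.length → Ω → DrivingPath} (hW : ∀ j, IsDriving α (c.get j : ℕ) (W j) μ)
    (hW_indep : iIndepFun W μ) {M : Ω → ℝ≥0 → ℕ} (hMm : Measurable M)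
    (hM : IsPoissonProcess θ M μ) {V : ℕ → Ω → DrivingPath} (hV : ∀ j, IsDriving α 1 (V j) μ)
    (hV_indep : iIndepFun V μ) (hMV : IndepFun M (fun ω j => V j ω) μ)
    (hWMV : IndepFun (fun ω j => W j ω) (fun ω => (M ω, fun j => V j ω)) μ) :
    (Measurable fun ω => configOf c (fun j => W j ω) (M ω) fun j => V j ω) ∧
      μ.map (fun ω => configOf c (fun j => W j ω) (M ω) fun j => V j ω) = configLaw α θ c := by
  have hD := measurable_drivingWord
  have hR := measurable_readPath
  have hgap : Measurable fun (x : ℝ≥0 → ℕ) (k : ℕ) => (readPath x k).2 :=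
    measurable_pi_lambda _ fun k => ((measurable_pi_apply k).comp hR).snd
  have hwords : Measurable fun (v : ℕ → DrivingPath) (k : ℕ) => drivingWord (v k) :=
    measurable_pi_lambda _ fun k => hD.comp (measurable_pi_apply k)
  have hforest : Measurable fun v : Fin c.length → DrivingPath =>
      List.ofFn fun j => (c.get j, drivingWord (v j)) :=
    (measurable_blocksOf c).comp (measurable_pi_lambda _ fun k => hD.comp (measurable_pi_apply k))
  have hstream : Measurable fun (p : (ℝ≥0 → ℕ) × (ℕ → DrivingPath)) (j : ℕ) =>
      ((readPath p.1 j).2, drivingWord (p.2 j)) :=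
    measurable_pi_lambda _ fun j => Measurable.prodMk
      ((measurable_pi_apply j).comp (hgap.comp measurable_fst))
      ((measurable_pi_apply j).comp (hwords.comp measurable_snd))
  have hVm : Measurable fun ω j => V j ω := measurable_pi_lambda _ fun j => (hV j).measurable
  have hWm : Measurable fun ω j => W j ω := measurable_pi_lambda _ fun j => (hW j).measurable
  have hGm : Measurable fun ω k => (readPath (M ω) k).2 := hgap.comp hMm
  have hUm : Measurable fun ω k => drivingWord (V k ω) := hwords.comp hVm
  have hFm : Measurable fun ω => List.ofFn fun j => (c.get j, drivingWord (W j ω)) :=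
    hforest.comp hWm
  have hSm : Measurable fun ω j => ((readPath (M ω) j).2, drivingWord (V j ω)) :=
    hstream.comp (hMm.prodMk hVm)
  have hU : μ.map (fun ω k => drivingWord (V k ω)) = streamLaw (excursionLaw α 1) := by
    have h1 := (hV_indep.comp (fun _ => drivingWord) fun _ => hD).map_fun_eq_infinitePi_map
      (fun i => hD.comp (hV i).measurable)
    refine h1.trans ?_
    rw [streamLaw]
    congr 1
    funext i
    exact (hV i).map_drivingWord hα₀ hα₁
  have hS : μ.map (fun ω j => ((readPath (M ω) j).2, drivingWord (V j ω))) =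
      streamLaw ((expLaw θ).prod (excursionLaw α 1)) := by
    have hind : IndepFun (fun ω k => (readPath (M ω) k).2) (fun ω k => drivingWord (V k ω)) μ :=
      hMV.comp hgap hwords
    rw [← map_zip_streamLaw, ← hU, ← (IsPoissonProcess.map_readPath hθ.le hMm hM).1,
      ← (indepFun_iff_map_prod_eq_prod_map_map hGm.aemeasurable hUm.aemeasurable).1 hind,
      Measure.map_map (by fun_prop) (hGm.prodMk hUm)]
    rfl
  have hF : μ.map (fun ω => List.ofFn fun j => (c.get j, drivingWord (W j ω))) =
      forestLaw α c := by
    have h1 := (hW_indep.comp (fun _ => drivingWord) fun _ => hD).map_fun_eq_pi_map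
      (fun i => (hD.comp (hW i).measurable).aemeasurable)
    have h2 : (fun i => μ.map (drivingWord ∘ W i)) = fun j => excursionLaw α (c.get j : ℕ) := by
      funext j
      exact (hW j).map_drivingWord hα₀ hα₁
    have hm : Measurable fun ω i => (drivingWord ∘ W i) ω :=
      measurable_pi_lambda _ fun i => hD.comp (hW i).measurable
    rw [h2] at h1
    rw [← map_blocksOf c, ← h1, Measure.map_map (measurable_blocksOf c) hm]
    rfl
  refine ⟨hSm.prodMk hFm, ?_⟩
  have hind : IndepFun (fun ω j => ((readPath (M ω) j).2, drivingWord (V j ω)))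
      (fun ω => List.ofFn fun j => (c.get j, drivingWord (W j ω))) μ :=
    hWMV.symm.comp (φ := fun (p : (ℝ≥0 → ℕ) × (ℕ → DrivingPath)) (j : ℕ) =>
      ((readPath p.1 j).2, drivingWord (p.2 j))) (ψ := fun v : Fin c.length → DrivingPath =>
      List.ofFn fun j => (c.get j, drivingWord (v j))) hstream hforest
  rw [configLaw, ← hS, ← hF,
    ← (indepFun_iff_map_prod_eq_prod_map_map hSm.aemeasurable hFm.aemeasurable).1 hind]
  rfl

end ConfigOf

/-! ### The skewer is a section of the configuration -/

section SkewerSection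

variable {α θ : ℝ}

/-- The gaps of `M` add up to the insertion levels. With `y` between the `N`-th and the next one,
only the first `N` inserted excursions count, and each is read through its word; the same is done
for the initial tables. -/
theorem configSection_skewer (hα₁ : α ≤ 1) (hθ : 0 < θ) {c : List ℕ+}
    {W : Fin c.length → DrivingPath} (hW : ∀ j, GoodDriving α (c.get j : ℕ) (W j)) {M : ℝ≥0 → ℕ}
    (hM : IsPathOf (fun m l => if l = m + 1 then θ else 0) M (readPath M))
    (hM0 : (readPath M 0).1 = 0) {V : ℕ → DrivingPath} (hV : ∀ j, GoodDriving α 1 (V j))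
    (y : ℝ≥0) : ConfigSection y (configOf c W M V)
      ((negMarkedPath M fun j => markedContour (V j)).skewer y ++
        (List.ofFn fun j => (markedContour (W j)).skewer y).flatten) := by
  refine ⟨_, ?_, congrArg _ ?_⟩
  · choose ξ hξ hl using fun j => (hV j).exists_crossedAt hα₁
    have hax : TidyAxis M (fun j => markedContour (V j)) ξ := hM.tidyAxis hθ hM0 hξ
    obtain ⟨N, h1, h2⟩ := hM.exists_bracket y
    have hj := hM.jumpTime_eq hθ hM0
    have h3 : jumpTime M N ≤ y := by rwa [← ENNReal.coe_le_coe, hj]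
    have h4 : y < jumpTime M (N + 1) := by rwa [← ENNReal.coe_lt_coe, hj]
    choose l hl1 hl2 using fun j => hl j (y - jumpTime M (j + 1))
    rw [hax.skewer_eq h3 h4 fun j _ => hl1 j]
    have h5 := streamSection_of_bracket (g := (configOf c W M V).1) (N := N) y.coe_nonneg
      (by rw [ENNReal.ofReal_coe_nnreal]; exact h1) (by rw [ENNReal.ofReal_coe_nnreal]; exact h2)
    convert h5 using 1
    refine List.flatMap_congr fun j hjN => ?_
    have hj' : j < N := by simpa using hjN
    have h6 : ((y - jumpTime M (j + 1) : ℝ≥0) : ℝ) =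
        y - (jumpSum (readPath M) (j + 1)).toReal := by
      rw [NNReal.coe_sub ((hax.jumpTime_mono hj').trans h3), ← hj, ENNReal.coe_toReal]
    rw [hl2 j, h6]
    rfl
  · rw [forestSection, List.flatMap_def]
    congr 1
    rw [configOf, List.map_ofFn]
    congr 1
    funext j
    obtain ⟨ξ, -, hl⟩ := (hW j).exists_crossedAt hα₁
    obtain ⟨l, hl1, hl2⟩ := hl y
    rw [hl1.skewer_eq, hl2]
    rfl

open Classical in
/-- The composition-valued path of a configuration. -/
noncomputable def configPath (d : Config) (y : ℝ≥0) : List ℕ+ :=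
  if h : ∃ k, ∑ m ∈ Finset.range k, configClock (configNext^[m] d) ≤ y ∧
      y < ∑ m ∈ Finset.range (k + 1), configClock (configNext^[m] d) then
    configSizes (configNext^[Nat.find h] d)
  else []

theorem configPath_eq {d : Config} {y : ℝ≥0} {n : ℕ}
    (h1 : ∑ m ∈ Finset.range n, configClock (configNext^[m] d) ≤ y)
    (h2 : y < ∑ m ∈ Finset.range (n + 1), configClock (configNext^[m] d)) :
    configPath d y = configSizes (configNext^[n] d) := by
  classical
  have hex : ∃ k, ∑ m ∈ Finset.range k, configClock (configNext^[m] d) ≤ y ∧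
      y < ∑ m ∈ Finset.range (k + 1), configClock (configNext^[m] d) := ⟨n, h1, h2⟩
  have hmono : ∀ i j, i ≤ j → ∑ m ∈ Finset.range i, configClock (configNext^[m] d) ≤
      ∑ m ∈ Finset.range j, configClock (configNext^[m] d) := fun i j hij =>
    Finset.sum_le_sum_of_subset (Finset.range_mono hij)
  have h3 := Nat.find_spec hex
  have hn : Nat.find hex = n := by
    by_contra hne
    rcases lt_or_gt_of_ne hne with hlt | hlt
    · exact absurd h3.2 (not_lt.2 ((hmono _ _ hlt).trans h1))
    · exact absurd h2 (not_lt.2 ((hmono _ _ hlt).trans h3.1))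
  rw [configPath, dif_pos hex, hn]

theorem exists_configClock_bracket {d : Config}
    (h : ∑' m, configClock (configNext^[m] d) = ∞) (y : ℝ≥0) :
    ∃ n, ∑ m ∈ Finset.range n, configClock (configNext^[m] d) ≤ y ∧
      y < ∑ m ∈ Finset.range (n + 1), configClock (configNext^[m] d) := by
  have h1 := ENNReal.tendsto_nat_tsum fun m => configClock (configNext^[m] d)
  rw [h] at h1
  obtain ⟨n, hn⟩ := (h1.eventually_const_lt (ENNReal.coe_lt_top (r := y))).exists
  obtain ⟨m, -, h2⟩ :=
    exists_jumpSum_bracket (z := fun m => (0, configClock (configNext^[m] d))) hn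
  exact ⟨m, h2⟩

end SkewerSection

/-! ### The main theorem -/

theorem mainTheorem5 {Ω : Type*} [MeasurableSpace Ω] (μ : Measure Ω) [IsProbabilityMeasure μ]
    (α θ : ℝ) (hα₀ : 0 ≤ α) (hα₁ : α ≤ 1) (hθ : 0 < θ) (n : List ℕ+)
    -- driving processes of the `k` independent copies on the positive time axis
    (W : Fin n.length → Ω → DrivingPath)
    (hW : ∀ j, IsDriving α (n.get j : ℕ) (W j) μ)
    (hW_indep : iIndepFun W μ)
    -- insertion levels and driving processes of the IID excursions on the negative time axis
    (M : Ω → ℝ≥0 → ℕ) (hM_meas : Measurable M) (hM : IsPoissonProcess θ M μ)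
    (V : ℕ → Ω → DrivingPath)
    (hV : ∀ j, IsDriving α 1 (V j) μ)
    (hV_indep : iIndepFun V μ)
    (hMV_indep : IndepFun M (fun ω j => V j ω) μ)
    (hWMV_indep : IndepFun (fun ω j => W j ω) (fun ω => (M ω, fun j => V j ω)) μ) :
    ∃ C : Ω → ℝ≥0 → List ℕ+, IsUpDownOCRP α θ n C μ ∧
      ∀ᵐ ω ∂μ, ∀ y : ℝ≥0,
        (negMarkedPath (M ω) (fun j => markedContour (V j ω))).skewer y ++
          (List.ofFn fun j => (markedContour (W j ω)).skewer y).flatten =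
        (C ω y).map PNat.val := by
  have := (tableRate_proper hα₁).2
  have : ∀ k, IsProbabilityMeasure (excursionLaw α k) := fun k =>
    ⟨excursionLaw_univ_eq_one hα₀ hα₁ k⟩
  obtain ⟨hDm, hD⟩ := map_configOf hα₀ hα₁ hθ hW hW_indep hM_meas hM hV hV_indep hMV_indep
    hWMV_indep
  set D : Ω → Config := fun ω => configOf n (fun j => W j ω) (M ω) fun j => V j ω with hDdef
  have hsizes : ∀ m, Measurable fun d : Config => configSizes (configNext^[m] d) := fun m =>
    measurable_configSizes.comp (measurable_configNext.iterate m)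
  have hclock : ∀ m, Measurable fun d : Config => configClock (configNext^[m] d) := fun m =>
    measurable_configClock.comp (measurable_configNext.iterate m)
  have hae : ∀ {p : Config → Prop}, (∀ᵐ d ∂configLaw α θ n, p d) → ∀ᵐ ω ∂μ, p (D ω) := by
    intro p hp
    rw [← hD] at hp
    exact ae_of_ae_map (p := p) hDm.aemeasurable hp
  have hsum := hae (ae_tsum_configClock hα₀ hα₁ hθ n)
  -- Jump chain and holding times are the sizes and clocks along the iterates of `configNext`. The
  -- path is built from them, so it is the comparison with the skewers that uses the almost sure
  -- regularity of the driving paths.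
  refine ⟨fun ω => configPath (D ω), ⟨fun m ω => configSizes (configNext^[m] (D ω)),
    fun m ω => configClock (configNext^[m] (D ω)), fun m x => ?_, fun m => (hclock m).comp hDm,
    hae (ae_configLaw_configSizes n), fun m y t hy => ?_, hsum, ?_⟩, ?_⟩
  · exact ((hsizes m).comp hDm) (measurableSet_singleton x)
  · rw [← configLaw_cylinder hα₀ hα₁ hθ m y t, hy, ← hD, Measure.map_apply hDm]
    · rfl
    · have : {d : Config | ∀ k ≤ m, configSizes (configNext^[k] d) = y k ∧
          (t k : ℝ≥0∞) < configClock (configNext^[k] d)} =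
          ⋂ k, ⋂ (_ : k ≤ m), ({d | configSizes (configNext^[k] d) = y k} ∩
            {d | (t k : ℝ≥0∞) < configClock (configNext^[k] d)}) := by
        ext d; simp
      rw [this]
      exact MeasurableSet.iInter fun k => MeasurableSet.iInter fun _ =>
        (hsizes k (measurableSet_singleton _)).inter (measurableSet_lt measurable_const (hclock k))
  · exact Filter.Eventually.of_forall fun ω k t h1 h2 => configPath_eq h1 h2
  · have hgood := hae (ae_iterate_configNext hθ measurableSet_goodConfig
      (fun c => ae_goodConfig hθ c) n)
    have hWg : ∀ᵐ ω ∂μ, ∀ j, GoodDriving α (n.get j : ℕ) (W j ω) :=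
      ae_all_iff.2 fun j => (hW j).ae_good hα₀ hα₁
    have hVg : ∀ᵐ ω ∂μ, ∀ j, GoodDriving α 1 (V j ω) :=
      ae_all_iff.2 fun j => (hV j).ae_good hα₀ hα₁
    filter_upwards [hsum, hgood, hWg, hVg, (IsPoissonProcess.map_readPath hθ.le hM_meas hM).2]
      with ω hs hg hw hv hm y
    have hsec := configSection_skewer hα₁ hθ hw hm.1 hm.2 hv y
    obtain ⟨k, h1, h2⟩ := exists_configClock_bracket hs y
    rw [configPath_eq h1 h2]
    refine hsec.eq_configSizes hg y.coe_nonneg ?_ ?_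
    · rwa [ENNReal.ofReal_coe_nnreal]
    · rwa [ENNReal.ofReal_coe_nnreal]
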